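/- Let $G$ be a group and let $Y$ be a finite-dimensional Yetter–Drinfeld module for $G$ over $\mathbb C$: a $\mathbb C$-linear $G$-module (action $\triangleright$) with a grading $Y=\bigoplus_{g\in G}Y_g$ such that $g\triangleright Y_h=Y_{ghg^{-1}}$. Its dual $Y^*$ is a Yetter–Drinfeld module with the contragredient action and $(Y^*)_g=(Y_{g^{-1}})^*$. For a Yetter–Drinfeld module $V$ let $\Psi(v\otimes w)=(g\triangleright w)\otimes v$ for $v\in V_g$, $w\in V$, and put $[n]_\Psi=\mathrm{id}+\Psi_{n-1,n}+\Psi_{n-1,n}\Psi_{n-2,n-1}+\dots+\Psi_{n-1,n}\cdots\Psi_{1,2}$ and $[n]!_\Psi=([1]_\Psi\otimes\mathrm{id})([2]_\Psi\otimes\mathrm{id})\cdots[n]_\Psi$ on $V^{\otimes n}$ (with $[0]!_\Psi=\mathrm{id}$). The Nichols algebra of $V$ is $\mathcal B(V)=T(V)/\bigoplus_{n}\ker[n]!_\Psi$. *Braided Weyl algebra.* $\mathcal A_Y$ is the algebra generated by $\mathcal B(Y)$ and $\mathcal B(Y^*)$ subject to the relations $fv-(g\triangleright v)f=\langle f,v\rangle\cdot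 1$ for $f\in(Y^*)_g$, $v\in Y$, $g\in G$; the group $G$ acts on it by algebra automorphisms extending the actions on $Y$ and $Y^*$. *Braided Heisenberg double.* Let $\beta\colon Y^*\otimes Y\to\mathbb CG$, $\beta(f\otimes v)=\langle f,v\rangle x$ for $v\in Y_x$. For subspaces $R^-\subseteq T(Y)$ and $R^+\subseteq T(Y^*)$ let $A_\beta(R^-,R^+)$ be the quotient of $T(Y\oplus Y^*)\rtimes G$ by the ideal generated by $R^-$, $R^+$ and all $fv-vf-\beta(f\otimes v)$ with $f\in Y^*$, $v\in Y$. Let $I_\beta^-$ be the sum of all graded $G$-invariant two-sided ideals $I\subseteq T^{>0}(Y)$ with $[Y^*,I]\subseteq I\cdot\mathbb CG$ in $A_\beta(0,0)$, and $I_\beta^+$ the sum of all graded $G$-invariant two-sided ideals $I\subseteq T^{>0}(Y^*)$ with $[I,Y]\subseteq\mathbb CG\cdot I$ in $A_\beta(0,0)$. Then $\mathcal H_Y:=A_\beta(I_\beta^-,I_\beta^+)$ (the minimal double of $\beta$). **Theorem.** The multiplication map $\mathcal B(Y)\otimes\mathcal B(Y^*)\to\mathcal A_Y$, $b\otimes c\mapsto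 bc$, is bijective, so that $\mathcal A_Y=\mathcal B(Y)\otimes\mathcal B(Y^*)$ as a vector space; and there is a unique isomorphism of algebras $$\phi\colon\mathcal A_Y\rtimes G\xrightarrow{\ \sim\ }\mathcal H_Y$$ such that $\phi(v)=v$ for $v\in Y$, $\phi(f)=xf$ for $x\in G$ and $f\in(Y^*)_x$, and $\phi(g)=g$ for $g\in G$. -/

import Mathlib

open scoped TensorProduct

noncomputable section

/-! ### Braided symmetrisers and Nichols algebras -/

section Nichols

variable {V : Type*} [AddCommGroup V] [Module ℂ V]

/-- The identification `V^{⊗n} ⊗ V ≃ V^{⊗(n+1)}`. -/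
def tensorSucc (V : Type*) [AddCommGroup V] [Module ℂ V] (n : ℕ) :
    ((⨂[ℂ]^n V) ⊗[ℂ] V) ≃ₗ[ℂ] (⨂[ℂ]^(n + 1) V) :=
  (TensorProduct.congr (LinearEquiv.refl ℂ _)
    (PiTensorProduct.subsingletonEquiv (R := ℂ) (s := fun _ : Fin 1 => V) 0).symm).trans
    TensorPower.mulEquiv

/-- `F ⊗ id_V`, as an endomorphism of `V^{⊗(n+1)}`, for an endomorphism `F` of `V^{⊗n}`. -/
def tensorId {n : ℕ} (F : (⨂[ℂ]^n V) →ₗ[ℂ] (⨂[ℂ]^n V)) :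
    (⨂[ℂ]^(n + 1) V) →ₗ[ℂ] (⨂[ℂ]^(n + 1) V) :=
  (tensorSucc V n).conj (F.rTensor V)

/-- `Ψ_{n+1,n+2} = id ⊗ Ψ` on `V^{⊗(n+2)}`: the map `Ψ` applied to the last two tensor factors. -/
def lastLeg (Ψ : V ⊗[ℂ] V →ₗ[ℂ] V ⊗[ℂ] V) (n : ℕ) :
    (⨂[ℂ]^(n + 2) V) →ₗ[ℂ] (⨂[ℂ]^(n + 2) V) :=
  (((TensorProduct.assoc ℂ (⨂[ℂ]^n V) V V).symm.trans
    (TensorProduct.congr (tensorSucc V n) (LinearEquiv.refl ℂ V))).trans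
    (tensorSucc V (n + 1))).conj (Ψ.lTensor (⨂[ℂ]^n V))

/-- The braided integer
`[n]_Ψ = id + Ψ_{n-1,n} + Ψ_{n-1,n} Ψ_{n-2,n-1} + ... + Ψ_{n-1,n} Ψ_{n-2,n-1} ⋯ Ψ_{1,2}`
on `V^{⊗n}`, in the form `[n+1]_Ψ = id + Ψ_{n,n+1} ([n]_Ψ ⊗ id)`. The value at `n = 0` is
not used. -/
def braidedInteger (Ψ : V ⊗[ℂ] V →ₗ[ℂ] V ⊗[ℂ] V) :
    (n : ℕ) → (⨂[ℂ]^n V) →ₗ[ℂ] (⨂[ℂ]^n V)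
  | 0 => LinearMap.id
  | 1 => LinearMap.id
  | n + 2 => LinearMap.id + lastLeg Ψ n ∘ₗ tensorId (braidedInteger Ψ (n + 1))

/-- The braided factorial (Woronowicz symmetriser)
`[n]!_Ψ = ([1]_Ψ ⊗ id) ([2]_Ψ ⊗ id) ⋯ [n]_Ψ` on `V^{⊗n}`. -/
def braidedFactorial (Ψ : V ⊗[ℂ] V →ₗ[ℂ] V ⊗[ℂ] V) :
    (n : ℕ) → (⨂[ℂ]^n V) →ₗ[ℂ] (⨂[ℂ]^n V)
  | 0 => LinearMap.id
  | n + 1 => tensorId (braidedFactorial Ψ n) ∘ₗ braidedInteger Ψ (n + 1)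

/-- `I_Ψ = ⨁ₙ ker [n]!_Ψ` inside the tensor algebra `T(V)`. -/
def woronowiczKernel (Ψ : V ⊗[ℂ] V →ₗ[ℂ] V ⊗[ℂ] V) : Submodule ℂ (TensorAlgebra ℂ V) :=
  ⨆ n : ℕ, (LinearMap.ker (braidedFactorial Ψ n)).map TensorPower.toTensorAlgebra

/-- The Nichols algebra `B(V, Ψ) = T(V) / I_Ψ`. -/
abbrev NicholsAlgebra (Ψ : V ⊗[ℂ] V →ₗ[ℂ] V ⊗[ℂ] V) : Type _ :=
  RingQuot fun a b : TensorAlgebra ℂ V => a ∈ woronowiczKernel Ψ ∧ b = 0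

end Nichols

/-! ### Functoriality of the tensor algebra, semidirect products -/

section Smash

variable {V W : Type*} [AddCommGroup V] [Module ℂ V] [AddCommGroup W] [Module ℂ W]

/-- The algebra map `T(V) → T(W)` induced by a linear map `V → W`. -/
def tensorAlgebraMap (f : V →ₗ[ℂ] W) : TensorAlgebra ℂ V →ₐ[ℂ] TensorAlgebra ℂ W :=
  TensorAlgebra.lift ℂ (TensorAlgebra.ι ℂ ∘ₗ f)

@[simp] theorem tensorAlgebraMap_ι (f : V →ₗ[ℂ] W) (v : V) :
    tensorAlgebraMap f (TensorAlgebra.ι ℂ v) = TensorAlgebra.ι ℂ (f v) := by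
  simp [tensorAlgebraMap]

variable {G : Type*} [Group G]

/-- The action of `G` on `T(V)` by algebra maps extending a representation on `V`. -/
def tensorAction (ρ : Representation ℂ G V) :
    G →* (TensorAlgebra ℂ V →ₐ[ℂ] TensorAlgebra ℂ V) where
  toFun g := tensorAlgebraMap (ρ g)
  map_one' := by ext v; simp
  map_mul' g h := by ext v; simp

theorem tensorAction_apply (ρ : Representation ℂ G V) (g : G) (b : TensorAlgebra ℂ V) :
    tensorAction ρ g b = tensorAlgebraMap (ρ g) b := rfl

variable {A : Type*} [Ring A] [Algebra ℂ A]

/-- The algebra `A`, carrying the action `α` of the group `G` by algebra maps. -/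
def Acted (_α : G →* (A →ₐ[ℂ] A)) : Type _ := A

instance (α : G →* (A →ₐ[ℂ] A)) : Ring (Acted α) := inferInstanceAs (Ring A)

instance (α : G →* (A →ₐ[ℂ] A)) : Algebra ℂ (Acted α) := inferInstanceAs (Algebra ℂ A)

instance (α : G →* (A →ₐ[ℂ] A)) : MulSemiringAction G (Acted α) where
  smul g a := (α g : A →ₐ[ℂ] A) (a : A)
  one_smul a := by change α 1 _ = _; rw [map_one]; rfl
  mul_smul g h a := by change α (g * h) _ = _; rw [map_mul]; rfl
  smul_zero g := map_zero (α g)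
  smul_add g := map_add (α g)
  smul_one g := map_one (α g)
  smul_mul g := map_mul (α g)

instance (α : G →* (A →ₐ[ℂ] A)) : SMulCommClass G ℂ (Acted α) where
  smul_comm g c a := map_smul (α g) c (a : A)

/-- The semidirect (smash) product `A ⋊ G` for an action `α` of `G` on the algebra `A`: formal
sums of `a g` (`a ∈ A`, `g ∈ G`) with product `(a g) (b h) = a (g ▷ b) g h`. -/
abbrev Smash (α : G →* (A →ₐ[ℂ] A)) : Type _ := SkewMonoidAlgebra (Acted α) G

/-- The embedding `A → A ⋊ G`, `a ↦ a 1`. -/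
def Smash.ofAlg (α : G →* (A →ₐ[ℂ] A)) : A →ₐ[ℂ] Smash α where
  toFun a := SkewMonoidAlgebra.single 1 (show Acted α from a)
  map_one' := rfl
  map_mul' a b := (map_mul (SkewMonoidAlgebra.singleOneRingHom (k := Acted α) (G := G)) a b)
  map_zero' := SkewMonoidAlgebra.single_zero 1
  map_add' a b := SkewMonoidAlgebra.single_add 1 (show Acted α from a) (show Acted α from b)
  commutes' _ := rfl

/-- The embedding `G → A ⋊ G`, `g ↦ 1 g`. -/
def Smash.ofGroup (α : G →* (A →ₐ[ℂ] A)) : G →* Smash α :=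
  SkewMonoidAlgebra.of (Acted α) G

/-- The embedding `ℂG → A ⋊ G`. -/
def Smash.ofGroupAlg (α : G →* (A →ₐ[ℂ] A)) : MonoidAlgebra ℂ G →ₐ[ℂ] Smash α :=
  MonoidAlgebra.lift ℂ (Smash α) G (Smash.ofGroup α)

end Smash

/-! ### Braided doubles over a group -/

section Doubles

variable {G : Type*} [Group G]
variable {M P : Type*} [AddCommGroup M] [Module ℂ M] [AddCommGroup P] [Module ℂ P]

/-- `T(V⁻ ⊕ V⁺) ⋊ G`, where `M = V⁻` and `P = V⁺`. -/
abbrev FreeSemidirect (ρM : Representation ℂ G M) (ρP : Representation ℂ G P) : Type _ :=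
  Smash (tensorAction (ρM.prod ρP))

/-- The inclusion `T(V⁻) → T(V⁻ ⊕ V⁺) ⋊ G`. -/
def FreeSemidirect.ofMinus (ρM : Representation ℂ G M) (ρP : Representation ℂ G P) :
    TensorAlgebra ℂ M →ₐ[ℂ] FreeSemidirect ρM ρP :=
  (Smash.ofAlg _).comp (tensorAlgebraMap (LinearMap.inl ℂ M P))

/-- The inclusion `T(V⁺) → T(V⁻ ⊕ V⁺) ⋊ G`. -/
def FreeSemidirect.ofPlus (ρM : Representation ℂ G M) (ρP : Representation ℂ G P) :
    TensorAlgebra ℂ P →ₐ[ℂ] FreeSemidirect ρM ρP :=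
  (Smash.ofAlg _).comp (tensorAlgebraMap (LinearMap.inr ℂ M P))

/-- The defining relations of `A_β(R⁻, R⁺)`: the elements of `R⁻` and of `R⁺` vanish, and
`f v - v f = β(f ⊗ v)` for `f ∈ V⁺`, `v ∈ V⁻`. -/
inductive DoubleRel (ρM : Representation ℂ G M) (ρP : Representation ℂ G P)
    (β : P →ₗ[ℂ] M →ₗ[ℂ] MonoidAlgebra ℂ G)
    (RM : Submodule ℂ (TensorAlgebra ℂ M)) (RP : Submodule ℂ (TensorAlgebra ℂ P)) :
    FreeSemidirect ρM ρP → FreeSemidirect ρM ρP → Prop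
  | minus (r : TensorAlgebra ℂ M) (hr : r ∈ RM) :
      DoubleRel ρM ρP β RM RP (FreeSemidirect.ofMinus ρM ρP r) 0
  | plus (r : TensorAlgebra ℂ P) (hr : r ∈ RP) :
      DoubleRel ρM ρP β RM RP (FreeSemidirect.ofPlus ρM ρP r) 0
  | comm (f : P) (v : M) :
      DoubleRel ρM ρP β RM RP
        (FreeSemidirect.ofPlus ρM ρP (TensorAlgebra.ι ℂ f) *
            FreeSemidirect.ofMinus ρM ρP (TensorAlgebra.ι ℂ v) -
          FreeSemidirect.ofMinus ρM ρP (TensorAlgebra.ι ℂ v) *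
            FreeSemidirect.ofPlus ρM ρP (TensorAlgebra.ι ℂ f))
        (Smash.ofGroupAlg _ (β f v))

/-- The algebra `A_β(R⁻, R⁺)`. -/
abbrev DoubleAlg (ρM : Representation ℂ G M) (ρP : Representation ℂ G P)
    (β : P →ₗ[ℂ] M →ₗ[ℂ] MonoidAlgebra ℂ G)
    (RM : Submodule ℂ (TensorAlgebra ℂ M)) (RP : Submodule ℂ (TensorAlgebra ℂ P)) : Type _ :=
  RingQuot (DoubleRel ρM ρP β RM RP)

namespace DoubleAlg

variable (ρM : Representation ℂ G M) (ρP : Representation ℂ G P)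
  (β : P →ₗ[ℂ] M →ₗ[ℂ] MonoidAlgebra ℂ G)
  (RM : Submodule ℂ (TensorAlgebra ℂ M)) (RP : Submodule ℂ (TensorAlgebra ℂ P))

/-- The canonical map `T(V⁻) → A_β(R⁻, R⁺)`. -/
def ofMinus : TensorAlgebra ℂ M →ₐ[ℂ] DoubleAlg ρM ρP β RM RP :=
  (RingQuot.mkAlgHom ℂ _).comp (FreeSemidirect.ofMinus ρM ρP)

/-- The canonical map `T(V⁺) → A_β(R⁻, R⁺)`. -/
def ofPlus : TensorAlgebra ℂ P →ₐ[ℂ] DoubleAlg ρM ρP β RM RP :=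
  (RingQuot.mkAlgHom ℂ _).comp (FreeSemidirect.ofPlus ρM ρP)

/-- The canonical map `G → A_β(R⁻, R⁺)`. -/
def ofGroup : G →* DoubleAlg ρM ρP β RM RP :=
  (RingQuot.mkAlgHom ℂ (DoubleRel ρM ρP β RM RP) :
    FreeSemidirect ρM ρP →* DoubleAlg ρM ρP β RM RP).comp (Smash.ofGroup _)

end DoubleAlg

/-- `I` is a graded, `G`-invariant, two-sided ideal of `T(V)` contained in `T^{>0}(V)`. -/
structure IsGradedInvariantIdeal {V : Type*} [AddCommGroup V] [Module ℂ V]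
    (ρ : Representation ℂ G V) (I : Submodule ℂ (TensorAlgebra ℂ V)) : Prop where
  mul_mem_left : ∀ a, ∀ b ∈ I, a * b ∈ I
  mul_mem_right : ∀ a, ∀ b ∈ I, b * a ∈ I
  /-- `I` is the sum of its homogeneous components of positive degree. -/
  graded : I = ⨆ n : ℕ, I ⊓ LinearMap.range (TensorAlgebra.ι ℂ (M := V)) ^ (n + 1)
  invariant : ∀ g, ∀ b ∈ I, tensorAction ρ g b ∈ I

/-- The ideals `I⁻` of `T(V⁻)` with `[V⁺, I⁻] ⊆ I⁻ ⊗ ℂG` in `A_β(0,0)`. -/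
def IsMinusIdeal (ρM : Representation ℂ G M) (ρP : Representation ℂ G P)
    (β : P →ₗ[ℂ] M →ₗ[ℂ] MonoidAlgebra ℂ G) (I : Submodule ℂ (TensorAlgebra ℂ M)) : Prop :=
  IsGradedInvariantIdeal ρM I ∧
    ∀ (f : P), ∀ b ∈ I,
      DoubleAlg.ofPlus ρM ρP β ⊥ ⊥ (TensorAlgebra.ι ℂ f) * DoubleAlg.ofMinus ρM ρP β ⊥ ⊥ b -
        DoubleAlg.ofMinus ρM ρP β ⊥ ⊥ b * DoubleAlg.ofPlus ρM ρP β ⊥ ⊥ (TensorAlgebra.ι ℂ f) ∈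
      Submodule.span ℂ {x | ∃ c ∈ I, ∃ g : G,
        x = DoubleAlg.ofMinus ρM ρP β ⊥ ⊥ c * DoubleAlg.ofGroup ρM ρP β ⊥ ⊥ g}

/-- The ideals `I⁺` of `T(V⁺)` with `[I⁺, V⁻] ⊆ ℂG ⊗ I⁺` in `A_β(0,0)`. -/
def IsPlusIdeal (ρM : Representation ℂ G M) (ρP : Representation ℂ G P)
    (β : P →ₗ[ℂ] M →ₗ[ℂ] MonoidAlgebra ℂ G) (I : Submodule ℂ (TensorAlgebra ℂ P)) : Prop :=
  IsGradedInvariantIdeal ρP I ∧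
    ∀ b ∈ I, ∀ (v : M),
      DoubleAlg.ofPlus ρM ρP β ⊥ ⊥ b * DoubleAlg.ofMinus ρM ρP β ⊥ ⊥ (TensorAlgebra.ι ℂ v) -
        DoubleAlg.ofMinus ρM ρP β ⊥ ⊥ (TensorAlgebra.ι ℂ v) * DoubleAlg.ofPlus ρM ρP β ⊥ ⊥ b ∈
      Submodule.span ℂ {x | ∃ c ∈ I, ∃ g : G,
        x = DoubleAlg.ofGroup ρM ρP β ⊥ ⊥ g * DoubleAlg.ofPlus ρM ρP β ⊥ ⊥ c}

/-- `I_β⁻`: the sum of all ideals `I⁻` as in `IsMinusIdeal`. -/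
def maxMinusIdeal (ρM : Representation ℂ G M) (ρP : Representation ℂ G P)
    (β : P →ₗ[ℂ] M →ₗ[ℂ] MonoidAlgebra ℂ G) : Submodule ℂ (TensorAlgebra ℂ M) :=
  sSup {I | IsMinusIdeal ρM ρP β I}

/-- `I_β⁺`: the sum of all ideals `I⁺` as in `IsPlusIdeal`. -/
def maxPlusIdeal (ρM : Representation ℂ G M) (ρP : Representation ℂ G P)
    (β : P →ₗ[ℂ] M →ₗ[ℂ] MonoidAlgebra ℂ G) : Submodule ℂ (TensorAlgebra ℂ P) :=
  sSup {I | IsPlusIdeal ρM ρP β I}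

/-- The minimal double `A_β(I_β⁻, I_β⁺)`. -/
abbrev MinimalDouble (ρM : Representation ℂ G M) (ρP : Representation ℂ G P)
    (β : P →ₗ[ℂ] M →ₗ[ℂ] MonoidAlgebra ℂ G) : Type _ :=
  DoubleAlg ρM ρP β (maxMinusIdeal ρM ρP β) (maxPlusIdeal ρM ρP β)

end Doubles

/-! ### Yetter-Drinfeld modules -/

/-- A Yetter-Drinfeld module structure over the group `G` on the complex vector space `Y`: a
linear action of `G` and a grading `Y = ⨁_{g ∈ G} Y_g` with `g ▷ Y_h = Y_{g h g⁻¹}`. -/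
structure YetterDrinfeld (G : Type*) [Group G] (Y : Type*) [AddCommGroup Y] [Module ℂ Y] where
  /-- the action of `G` -/
  ρ : Representation ℂ G Y
  /-- the homogeneous components `Y_g` -/
  grading : G → Submodule ℂ Y
  independent : iSupIndep grading
  iSup_eq_top : ⨆ g, grading g = ⊤
  map_grading : ∀ g h, (grading h).map (ρ g) = grading (g * h * g⁻¹)

namespace YetterDrinfeld

variable {G : Type*} [Group G] {Y : Type*} [AddCommGroup Y] [Module ℂ Y]
variable {E : Type*} [AddCommGroup E] [Module ℂ E]

open Classical in
theorem isInternal (𝒴 : YetterDrinfeld G Y) : DirectSum.IsInternal 𝒴.grading :=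
  DirectSum.isInternal_submodule_of_iSupIndep_of_iSup_eq_top 𝒴.independent 𝒴.iSup_eq_top

theorem smul_mem (𝒴 : YetterDrinfeld G Y) (g : G) {h : G} {v : Y} (hv : v ∈ 𝒴.grading h) :
    𝒴.ρ g v ∈ 𝒴.grading (g * h * g⁻¹) := by
  rw [← 𝒴.map_grading]
  exact Submodule.mem_map_of_mem hv

open Classical in
/-- The linear map `v ↦ ∑_x φ_x(v_x)`, where `v = ∑_x v_x` with `v_x ∈ Y_x`. -/
def gradedLift (𝒴 : YetterDrinfeld G Y) (φ : G → Y →ₗ[ℂ] E) : Y →ₗ[ℂ] E :=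
  DirectSum.toModule ℂ G E (fun x => φ x ∘ₗ (𝒴.grading x).subtype) ∘ₗ
    (LinearEquiv.ofBijective (DirectSum.coeLinearMap 𝒴.grading) 𝒴.isInternal).symm.toLinearMap

theorem gradedLift_of_mem (𝒴 : YetterDrinfeld G Y) (φ : G → Y →ₗ[ℂ] E) {x : G} {v : Y}
    (hv : v ∈ 𝒴.grading x) : 𝒴.gradedLift φ v = φ x v := by
  classical
  have h : (LinearEquiv.ofBijective (DirectSum.coeLinearMap 𝒴.grading) 𝒴.isInternal).symm v =
      DirectSum.lof ℂ G (fun i => 𝒴.grading i) x ⟨v, hv⟩ := by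
    rw [LinearEquiv.symm_apply_eq]
    exact (DirectSum.coeLinearMap_lof 𝒴.grading x ⟨v, hv⟩).symm
  rw [gradedLift, LinearMap.comp_apply, LinearEquiv.coe_coe, h, DirectSum.toModule_lof]
  rfl

theorem hom_ext (𝒴 : YetterDrinfeld G Y) {a b : Y →ₗ[ℂ] E}
    (h : ∀ x, ∀ v ∈ 𝒴.grading x, a v = b v) : a = b := by
  have : (⊤ : Submodule ℂ Y) ≤ LinearMap.eqLocus a b := by
    rw [← 𝒴.iSup_eq_top]
    exact iSup_le fun x v hv => h x v hv
  ext v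
  exact this Submodule.mem_top

/-- The braiding `Ψ(y ⊗ z) = (g ▷ z) ⊗ y` for `y ∈ Y_g`, `z ∈ Y`. -/
def braiding (𝒴 : YetterDrinfeld G Y) : Y ⊗[ℂ] Y →ₗ[ℂ] Y ⊗[ℂ] Y :=
  TensorProduct.lift (𝒴.gradedLift fun g => ((TensorProduct.mk ℂ Y Y) ∘ₗ 𝒴.ρ g).flip)

theorem braiding_tmul (𝒴 : YetterDrinfeld G Y) {g : G} {y : Y} (hy : y ∈ 𝒴.grading g) (z : Y) :
    𝒴.braiding (y ⊗ₜ z) = (𝒴.ρ g z) ⊗ₜ y := by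
  simp [braiding, 𝒴.gradedLift_of_mem _ hy]

section Dual

/-- `(Y*)_g = (Y_{g⁻¹})*`: the functionals on `Y` that vanish on `Y_h` for all `h ≠ g⁻¹`. -/
def dualGrading (𝒴 : YetterDrinfeld G Y) (g : G) : Submodule ℂ (Module.Dual ℂ Y) where
  carrier := {f | ∀ h, h ≠ g⁻¹ → ∀ v ∈ 𝒴.grading h, f v = 0}
  add_mem' ha hb h hh v hv := by simp [ha h hh v hv, hb h hh v hv]
  zero_mem' _ _ _ _ := rfl
  smul_mem' c f hf h hh v hv := by simp [hf h hh v hv]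

theorem mem_dualGrading (𝒴 : YetterDrinfeld G Y) {g : G} {f : Module.Dual ℂ Y} :
    f ∈ 𝒴.dualGrading g ↔ ∀ h, h ≠ g⁻¹ → ∀ v ∈ 𝒴.grading h, f v = 0 := Iff.rfl

theorem dual_smul_mem (𝒴 : YetterDrinfeld G Y) (g : G) {h : G} {f : Module.Dual ℂ Y}
    (hf : f ∈ 𝒴.dualGrading h) : 𝒴.ρ.dual g f ∈ 𝒴.dualGrading (g * h * g⁻¹) := by
  intro k hk v hv
  have := 𝒴.smul_mem g⁻¹ hv
  refine hf _ ?_ _ this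
  intro e
  apply hk
  rw [inv_inv] at e
  calc k = g * (g⁻¹ * k * g) * g⁻¹ := by group
    _ = _ := by rw [e]; group

/-- The dual Yetter-Drinfeld module `Y*` of a finite-dimensional `Y`: the dual (contragredient)
representation, with the grading `(Y*)_g = (Y_{g⁻¹})*`. -/
def dual [FiniteDimensional ℂ Y] (𝒴 : YetterDrinfeld G Y) :
    YetterDrinfeld G (Module.Dual ℂ Y) where
  ρ := 𝒴.ρ.dual
  grading := 𝒴.dualGrading
  independent := by
    rw [iSupIndep_def]
    intro g
    rw [Submodule.disjoint_def]
    intro f hf hf'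
    have key : (⨆ j, ⨆ _ : j ≠ g, 𝒴.dualGrading j) ≤ (𝒴.grading g⁻¹).dualAnnihilator := by
      refine iSup₂_le fun j hj f hf => ?_
      rw [Submodule.mem_dualAnnihilator]
      intro v hv
      exact hf g⁻¹ (fun e => hj (inv_injective e).symm) v hv
    have h1 := (Submodule.mem_dualAnnihilator f).1 (key hf')
    refine 𝒴.hom_ext fun x v hv => ?_
    by_cases hx : x = g⁻¹
    · subst hx
      exact h1 v hv
    · exact hf x hx v hv
  iSup_eq_top := by
    classical
    have hfin : {x | 𝒴.grading x ≠ ⊥}.Finite := WellFoundedGT.finite_ne_bot_of_iSupIndep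
      𝒴.independent
    rw [eq_top_iff]
    intro f _
    have hsum : f = ∑ x ∈ hfin.toFinset, 𝒴.gradedLift (fun y => if y = x then f else 0) := by
      refine 𝒴.hom_ext fun y v hv => ?_
      rw [LinearMap.sum_apply]
      simp only [𝒴.gradedLift_of_mem _ hv]
      by_cases hy : 𝒴.grading y = ⊥
      · have : v = 0 := by rw [hy] at hv; simpa using hv
        simp [this]
      · rw [Finset.sum_eq_single y]
        · simp
        · intro b _ hb
          simp [hb.symm]
        · intro h
          simp [hy] at h
    rw [hsum]
    refine Submodule.sum_mem _ fun x _ => ?_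
    refine Submodule.mem_iSup_of_mem x⁻¹ ?_
    intro h hh v hv
    rw [𝒴.gradedLift_of_mem _ hv, if_neg (by simpa using hh)]
    rfl
  map_grading g h := by
    apply le_antisymm
    · rintro _ ⟨f, hf, rfl⟩
      exact 𝒴.dual_smul_mem g hf
    · intro f hf
      refine ⟨𝒴.ρ.dual g⁻¹ f, ?_, ?_⟩
      · have := 𝒴.dual_smul_mem g⁻¹ hf
        rwa [show g⁻¹ * (g * h * g⁻¹) * g⁻¹⁻¹ = h by group] at this
      · rw [← Module.End.mul_apply, ← map_mul, mul_inv_cancel, map_one, Module.End.one_apply]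

end Dual

/-! ### Invariance of the Woronowicz kernel under the action -/

section Invariance

theorem conj_commute {A B : Type*} [AddCommGroup A] [Module ℂ A] [AddCommGroup B] [Module ℂ B]
    (e : A ≃ₗ[ℂ] B) {Q F : A →ₗ[ℂ] A} {P : B →ₗ[ℂ] B} (h : ∀ t, e (Q t) = P (e t))
    (hF : ∀ t, F (Q t) = Q (F t)) (t : B) : e.conj F (P t) = P (e.conj F t) := by
  obtain ⟨t, rfl⟩ := e.surjective t
  simp [LinearEquiv.conj_apply, ← h, hF]

theorem tensorSucc_tprod (n : ℕ) (a : Fin n → Y) (v : Y) :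
    tensorSucc Y n (PiTensorProduct.tprod ℂ a ⊗ₜ v) =
      PiTensorProduct.tprod ℂ (Fin.append a fun _ => v) := by
  rw [tensorSucc, LinearEquiv.trans_apply, TensorProduct.congr_tmul,
    PiTensorProduct.subsingletonEquiv_symm_apply', LinearEquiv.refl_apply, ← TensorPower.gMul_def,
    TensorPower.tprod_mul_tprod]

theorem tensorSucc_map (f : Y →ₗ[ℂ] Y) (n : ℕ) (t : (⨂[ℂ]^n Y) ⊗[ℂ] Y) :
    tensorSucc Y n (TensorProduct.map (PiTensorProduct.map fun _ => f) f t) =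
      PiTensorProduct.map (fun _ => f) (tensorSucc Y n t) := by
  induction t with
  | zero => simp
  | add a b ha hb => simp only [map_add, ha, hb]
  | tmul a v =>
    induction a using PiTensorProduct.induction_on with
    | smul_tprod r a =>
      rw [← TensorProduct.smul_tmul', map_smul, map_smul, map_smul, map_smul,
        TensorProduct.map_tmul, PiTensorProduct.map_tprod, tensorSucc_tprod, tensorSucc_tprod,
        PiTensorProduct.map_tprod]
      congr 2
      funext i
      refine Fin.addCases (fun j => ?_) (fun j => ?_) i <;> simp
    | add a b ha hb => simp only [TensorProduct.add_tmul, map_add, ha, hb]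

theorem tensorId_commute (f : Y →ₗ[ℂ] Y) {n : ℕ} {F : (⨂[ℂ]^n Y) →ₗ[ℂ] (⨂[ℂ]^n Y)}
    (hF : ∀ t, F (PiTensorProduct.map (fun _ => f) t) = PiTensorProduct.map (fun _ => f) (F t))
    (t : ⨂[ℂ]^(n + 1) Y) :
    tensorId F (PiTensorProduct.map (fun _ => f) t) =
      PiTensorProduct.map (fun _ => f) (tensorId F t) := by
  refine conj_commute _ (tensorSucc_map f n) (fun t => ?_) t
  induction t with
  | zero => simp
  | add a b ha hb => simp only [map_add, ha, hb]
  | tmul a v => simp [hF]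

theorem lastLeg_commute (f : Y →ₗ[ℂ] Y) {Ψ : Y ⊗[ℂ] Y →ₗ[ℂ] Y ⊗[ℂ] Y}
    (hΨ : ∀ t, Ψ (TensorProduct.map f f t) = TensorProduct.map f f (Ψ t)) (n : ℕ)
    (t : ⨂[ℂ]^(n + 2) Y) :
    lastLeg Ψ n (PiTensorProduct.map (fun _ => f) t) =
      PiTensorProduct.map (fun _ => f) (lastLeg Ψ n t) := by
  refine conj_commute _ (Q := TensorProduct.map (PiTensorProduct.map fun _ => f)
    (TensorProduct.map f f)) (fun t => ?_) (fun t => ?_) t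
  · induction t with
    | zero => simp
    | add a b ha hb => simp only [map_add, ha, hb]
    | tmul a v =>
      induction v with
      | zero => simp
      | add a b ha hb => simp only [TensorProduct.tmul_add, map_add, ha, hb]
      | tmul v w =>
        simp only [LinearEquiv.trans_apply, TensorProduct.map_tmul, TensorProduct.assoc_symm_tmul,
          TensorProduct.congr_tmul, LinearEquiv.refl_apply]
        rw [← tensorSucc_map, TensorProduct.map_tmul, ← tensorSucc_map, TensorProduct.map_tmul]
  · induction t with
    | zero => simp
    | add a b ha hb => simp only [map_add, ha, hb]
    | tmul a v => simp [hΨ]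

theorem braidedInteger_commute (f : Y →ₗ[ℂ] Y) {Ψ : Y ⊗[ℂ] Y →ₗ[ℂ] Y ⊗[ℂ] Y}
    (hΨ : ∀ t, Ψ (TensorProduct.map f f t) = TensorProduct.map f f (Ψ t)) :
    ∀ (n : ℕ) (t : ⨂[ℂ]^n Y), braidedInteger Ψ n (PiTensorProduct.map (fun _ => f) t) =
      PiTensorProduct.map (fun _ => f) (braidedInteger Ψ n t)
  | 0, _ => rfl
  | 1, _ => rfl
  | n + 2, t => by
    simp only [braidedInteger, LinearMap.add_apply, LinearMap.comp_apply, LinearMap.id_apply,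
      map_add]
    rw [tensorId_commute f (braidedInteger_commute f hΨ (n + 1)), lastLeg_commute f hΨ]

theorem braidedFactorial_commute (f : Y →ₗ[ℂ] Y) {Ψ : Y ⊗[ℂ] Y →ₗ[ℂ] Y ⊗[ℂ] Y}
    (hΨ : ∀ t, Ψ (TensorProduct.map f f t) = TensorProduct.map f f (Ψ t)) :
    ∀ (n : ℕ) (t : ⨂[ℂ]^n Y), braidedFactorial Ψ n (PiTensorProduct.map (fun _ => f) t) =
      PiTensorProduct.map (fun _ => f) (braidedFactorial Ψ n t)
  | 0, _ => rfl
  | n + 1, t => by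
    simp only [braidedFactorial, LinearMap.comp_apply]
    rw [braidedInteger_commute f hΨ, tensorId_commute f (braidedFactorial_commute f hΨ n)]

theorem toTensorAlgebra_map (f : Y →ₗ[ℂ] Y) (n : ℕ) (t : ⨂[ℂ]^n Y) :
    TensorPower.toTensorAlgebra (PiTensorProduct.map (fun _ => f) t) =
      tensorAlgebraMap f (TensorPower.toTensorAlgebra t) := by
  induction t using PiTensorProduct.induction_on with
  | smul_tprod r a =>
    simp only [map_smul, PiTensorProduct.map_tprod, TensorPower.toTensorAlgebra_tprod,
      TensorAlgebra.tprod_apply, map_list_prod, List.map_ofFn]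
    congr 4
    funext i
    simp
  | add a b ha hb => simp only [map_add, ha, hb]

theorem woronowiczKernel_map (f : Y →ₗ[ℂ] Y) {Ψ : Y ⊗[ℂ] Y →ₗ[ℂ] Y ⊗[ℂ] Y}
    (hΨ : ∀ t, Ψ (TensorProduct.map f f t) = TensorProduct.map f f (Ψ t))
    {b : TensorAlgebra ℂ Y} (hb : b ∈ woronowiczKernel Ψ) :
    tensorAlgebraMap f b ∈ woronowiczKernel Ψ := by
  have : woronowiczKernel Ψ ≤ (woronowiczKernel Ψ).comap (tensorAlgebraMap f).toLinearMap := by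
    refine iSup_le fun n => ?_
    rintro _ ⟨t, ht, rfl⟩
    refine Submodule.mem_iSup_of_mem n ⟨PiTensorProduct.map (fun _ => f) t, ?_, ?_⟩
    · have ht' : braidedFactorial Ψ n t = 0 := ht
      change braidedFactorial Ψ n _ = 0
      rw [braidedFactorial_commute f hΨ, ht', map_zero]
    · exact toTensorAlgebra_map f n t
  exact this hb

theorem braiding_equivariant (𝒴 : YetterDrinfeld G Y) (g : G) (t : Y ⊗[ℂ] Y) :
    𝒴.braiding (TensorProduct.map (𝒴.ρ g) (𝒴.ρ g) t) =
      TensorProduct.map (𝒴.ρ g) (𝒴.ρ g) (𝒴.braiding t) := by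
  refine LinearMap.congr_fun (f := 𝒴.braiding ∘ₗ TensorProduct.map (𝒴.ρ g) (𝒴.ρ g))
    (g := TensorProduct.map (𝒴.ρ g) (𝒴.ρ g) ∘ₗ 𝒴.braiding) (TensorProduct.ext ?_) t
  refine 𝒴.hom_ext fun x v hv => ?_
  refine LinearMap.ext fun z => ?_
  change 𝒴.braiding (𝒴.ρ g v ⊗ₜ 𝒴.ρ g z) =
    TensorProduct.map (𝒴.ρ g) (𝒴.ρ g) (𝒴.braiding (v ⊗ₜ z))
  rw [𝒴.braiding_tmul hv, 𝒴.braiding_tmul (𝒴.smul_mem g hv), TensorProduct.map_tmul,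
    ← Module.End.mul_apply, ← Module.End.mul_apply, ← map_mul, ← map_mul]
  congr 3
  group

end Invariance

/-! ### The braided Heisenberg double and the braided Weyl algebra -/

/-- `β(f ⊗ v) = ⟨f, v^{(0)}⟩ v^{(1)}`, i.e. `β(f ⊗ v) = ⟨f, v⟩ x` for `v ∈ Y_x`. -/
def beta (𝒴 : YetterDrinfeld G Y) : Module.Dual ℂ Y →ₗ[ℂ] Y →ₗ[ℂ] MonoidAlgebra ℂ G :=
  (𝒴.gradedLift fun x => LinearMap.mk₂ ℂ (fun (v : Y) (f : Module.Dual ℂ Y) =>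
      MonoidAlgebra.single x (f v))
    (by simp [MonoidAlgebra.single_add]) (by simp) (by simp [MonoidAlgebra.single_add])
    (by simp)).flip

theorem beta_apply (𝒴 : YetterDrinfeld G Y) {x : G} {v : Y} (hv : v ∈ 𝒴.grading x)
    (f : Module.Dual ℂ Y) : 𝒴.beta f v = MonoidAlgebra.single x (f v) := by
  simp [beta, 𝒴.gradedLift_of_mem _ hv]

section Algebras

variable [FiniteDimensional ℂ Y] (𝒴 : YetterDrinfeld G Y)

/-- The braided Heisenberg double `H_Y`: the minimal double associated to `V⁻ = Y`, `V⁺ = Y*`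
and `β(f ⊗ v) = ⟨f, v^{(0)}⟩ v^{(1)}`. -/
abbrev Heisenberg : Type _ := MinimalDouble 𝒴.ρ 𝒴.dual.ρ 𝒴.beta

/-- The canonical map `Y → H_Y`. -/
def Heisenberg.ofY (v : Y) : 𝒴.Heisenberg :=
  DoubleAlg.ofMinus _ _ _ _ _ (TensorAlgebra.ι ℂ v)

/-- The canonical map `Y* → H_Y`. -/
def Heisenberg.ofDual (f : Module.Dual ℂ Y) : 𝒴.Heisenberg :=
  DoubleAlg.ofPlus _ _ _ _ _ (TensorAlgebra.ι ℂ f)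

/-- The canonical map `G → H_Y`. -/
def Heisenberg.ofGroup (g : G) : 𝒴.Heisenberg := DoubleAlg.ofGroup _ _ _ _ _ g

/-- The defining relations of the braided Weyl algebra: those of `B(Y)`, those of `B(Y*)`, and
`f v - (g ▷ v) f = ⟨f, v⟩ 1` for `f ∈ (Y*)_g`, `v ∈ Y`. -/
inductive WeylRel : TensorAlgebra ℂ (Y × Module.Dual ℂ Y) →
    TensorAlgebra ℂ (Y × Module.Dual ℂ Y) → Prop
  | nichols (b : TensorAlgebra ℂ Y) (hb : b ∈ woronowiczKernel 𝒴.braiding) :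
      WeylRel (tensorAlgebraMap (LinearMap.inl ℂ Y (Module.Dual ℂ Y)) b) 0
  | nicholsDual (b : TensorAlgebra ℂ (Module.Dual ℂ Y))
      (hb : b ∈ woronowiczKernel 𝒴.dual.braiding) :
      WeylRel (tensorAlgebraMap (LinearMap.inr ℂ Y (Module.Dual ℂ Y)) b) 0
  | comm (g : G) (f : Module.Dual ℂ Y) (hf : f ∈ 𝒴.dual.grading g) (v : Y) :
      WeylRel (TensorAlgebra.ι ℂ (0, f) * TensorAlgebra.ι ℂ (v, 0) -
          TensorAlgebra.ι ℂ (𝒴.ρ g v, 0) * TensorAlgebra.ι ℂ (0, f))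
        (algebraMap ℂ _ (f v))

/-- The braided Weyl algebra `A_Y`, as the algebra generated by `B(Y)` and `B(Y*)` subject to the
relations `f v - (g ▷ v) f = ⟨f, v⟩ 1` (`f ∈ (Y*)_g`, `v ∈ Y`). -/
abbrev Weyl : Type _ := RingQuot 𝒴.WeylRel

/-- The canonical map `B(Y) → A_Y`. -/
def Weyl.ofNichols : NicholsAlgebra 𝒴.braiding →ₐ[ℂ] 𝒴.Weyl :=
  RingQuot.liftAlgHom ℂ ⟨(RingQuot.mkAlgHom ℂ 𝒴.WeylRel).comp (tensorAlgebraMap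
    (LinearMap.inl ℂ Y (Module.Dual ℂ Y))), by
      rintro a b ⟨ha, rfl⟩
      simpa using RingQuot.mkAlgHom_rel ℂ (WeylRel.nichols (𝒴 := 𝒴) a ha)⟩

/-- The canonical map `B(Y*) → A_Y`. -/
def Weyl.ofNicholsDual : NicholsAlgebra 𝒴.dual.braiding →ₐ[ℂ] 𝒴.Weyl :=
  RingQuot.liftAlgHom ℂ ⟨(RingQuot.mkAlgHom ℂ 𝒴.WeylRel).comp (tensorAlgebraMap
    (LinearMap.inr ℂ Y (Module.Dual ℂ Y))), by
      rintro a b ⟨ha, rfl⟩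
      simpa using RingQuot.mkAlgHom_rel ℂ (WeylRel.nicholsDual (𝒴 := 𝒴) a ha)⟩

/-- The linear map `B(Y) ⊗ B(Y*) → A_Y`, `b ⊗ c ↦ b c`. -/
def Weyl.mulMap :
    NicholsAlgebra 𝒴.braiding ⊗[ℂ] NicholsAlgebra 𝒴.dual.braiding →ₗ[ℂ] 𝒴.Weyl :=
  LinearMap.mul' ℂ 𝒴.Weyl ∘ₗ TensorProduct.map (Weyl.ofNichols 𝒴).toLinearMap
    (Weyl.ofNicholsDual 𝒴).toLinearMap

/-- The canonical map `Y → A_Y`. -/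
def Weyl.ofY (v : Y) : 𝒴.Weyl :=
  RingQuot.mkAlgHom ℂ 𝒴.WeylRel (TensorAlgebra.ι ℂ (v, 0))

/-- The canonical map `Y* → A_Y`. -/
def Weyl.ofDual (f : Module.Dual ℂ Y) : 𝒴.Weyl :=
  RingQuot.mkAlgHom ℂ 𝒴.WeylRel (TensorAlgebra.ι ℂ (0, f))

theorem Weyl.tensorAction_rel (g : G) {a b : TensorAlgebra ℂ (Y × Module.Dual ℂ Y)}
    (h : 𝒴.WeylRel a b) :
    𝒴.WeylRel (tensorAction (𝒴.ρ.prod 𝒴.dual.ρ) g a) (tensorAction (𝒴.ρ.prod 𝒴.dual.ρ) g b) := by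
  cases h with
  | nichols b hb =>
    have e : tensorAction (𝒴.ρ.prod 𝒴.dual.ρ) g (tensorAlgebraMap (LinearMap.inl ℂ _ _) b) =
        tensorAlgebraMap (LinearMap.inl ℂ _ _) (tensorAlgebraMap (𝒴.ρ g) b) := by
      rw [tensorAction_apply]
      simp only [← AlgHom.comp_apply]
      congr 1
      ext v
      simp
    rw [e, map_zero]
    exact .nichols _ (woronowiczKernel_map _ (𝒴.braiding_equivariant g) hb)
  | nicholsDual b hb =>
    have e : tensorAction (𝒴.ρ.prod 𝒴.dual.ρ) g (tensorAlgebraMap (LinearMap.inr ℂ _ _) b) =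
        tensorAlgebraMap (LinearMap.inr ℂ _ _) (tensorAlgebraMap (𝒴.dual.ρ g) b) := by
      rw [tensorAction_apply]
      simp only [← AlgHom.comp_apply]
      congr 1
      ext v
      simp
    rw [e, map_zero]
    exact .nicholsDual _ (woronowiczKernel_map _ (𝒴.dual.braiding_equivariant g) hb)
  | comm x f hf v =>
    have h1 : 𝒴.ρ g (𝒴.ρ x v) = 𝒴.ρ (g * x * g⁻¹) (𝒴.ρ g v) := by
      rw [← Module.End.mul_apply, ← Module.End.mul_apply, ← map_mul, ← map_mul]
      congr 2
      group
    have h2 : f v = 𝒴.dual.ρ g f (𝒴.ρ g v) := by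
      change f v = f (𝒴.ρ g⁻¹ (𝒴.ρ g v))
      rw [← Module.End.mul_apply, ← map_mul, inv_mul_cancel, map_one, Module.End.one_apply]
    rw [tensorAction_apply]
    simp only [map_sub, map_mul, tensorAlgebraMap_ι, AlgHom.commutes, Representation.prod_apply_apply,
      map_zero]
    rw [h1, h2]
    exact .comm _ _ (𝒴.dual.smul_mem g hf) _

/-- The algebra endomorphism of `A_Y` given on `Y` and `Y*` by the action of `g`. -/
def Weyl.actionHom (g : G) : 𝒴.Weyl →ₐ[ℂ] 𝒴.Weyl :=
  RingQuot.liftAlgHom ℂ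
    ⟨(RingQuot.mkAlgHom ℂ 𝒴.WeylRel).comp (tensorAction (𝒴.ρ.prod 𝒴.dual.ρ) g),
      fun _ _ h => RingQuot.mkAlgHom_rel ℂ (Weyl.tensorAction_rel 𝒴 g h)⟩

theorem Weyl.actionHom_mk (g : G) (a : TensorAlgebra ℂ (Y × Module.Dual ℂ Y)) :
    Weyl.actionHom 𝒴 g (RingQuot.mkAlgHom ℂ 𝒴.WeylRel a) =
      RingQuot.mkAlgHom ℂ 𝒴.WeylRel (tensorAction (𝒴.ρ.prod 𝒴.dual.ρ) g a) :=
  RingQuot.liftAlgHom_mkAlgHom_apply _ _ _ _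

/-- The action of `G` on `A_Y` by algebra maps that extends the actions on `Y` and `Y*`. -/
def Weyl.action : G →* (𝒴.Weyl →ₐ[ℂ] 𝒴.Weyl) where
  toFun := Weyl.actionHom 𝒴
  map_one' := by
    apply RingQuot.ringQuot_ext'
    refine AlgHom.ext fun a => ?_
    rw [AlgHom.comp_apply, AlgHom.comp_apply, Weyl.actionHom_mk, map_one]
    rfl
  map_mul' g h := by
    apply RingQuot.ringQuot_ext'
    refine AlgHom.ext fun a => ?_
    rw [AlgHom.comp_apply, AlgHom.comp_apply, AlgHom.mul_apply, Weyl.actionHom_mk,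
      Weyl.actionHom_mk, Weyl.actionHom_mk, map_mul, AlgHom.mul_apply]

end Algebras
end YetterDrinfeld

end

noncomputable section
/-! ### Linear maps out of the tensor algebra defined by recursion on the right -/

section RightRecursion

open TensorAlgebra

variable {V : Type*} [AddCommGroup V] [Module ℂ V]
variable {E : Type*} [AddCommGroup E] [Module ℂ E]

/-! Everything is governed by braided derivations of tensor algebras. For a functional `f` supported
on `V_g`, let `∂_f` be the derivation with `∂(ab) = a ∂(b) + ∂(a) (g ▷ b)` (`rightDer`). On degree
`n+1` it is `[n+1]_Ψ` followed by contraction of the last tensor factor with `f`. Since `[n+1]! =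
([n]! ⊗ id) [n+1]`, induction on the degree shows that the Woronowicz kernel is the largest subspace
of the augmentation ideal stable under all `∂_f` (`woronowiczKernel_eq_rightCore`).

In the double `A_β` one has `[f, b] = ∂_f(b) g`, so `I_β⁻` has the same description and is the
Nichols ideal of `Y` (`maxMinusIdeal_eq`). On the other side, `[c, v] = y ∂(c)` for `v ∈ Y_y`, where
`∂` is of the mirrored type `∂(ab) = (y⁻¹ ▷ a) ∂(b) + ∂(a) b` (`leftDer`); so `I_β⁺` is the largest
subspace stable under the mirrored derivations (`maxPlusIdeal_eq`), which is not a priori the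
Nichols ideal of `Y*`.

The substitution `f ↦ x f` repairs this. As `x₁ f₁ x₂ f₂ = x₁ x₂ (x₂⁻¹ ▷ f₁) f₂`, a word `c` of
degree `X` becomes `X θ(c)` for a linear automorphism `θ` of `T(Y*)` (`untwist`). Transporting the
mirrored derivations by `θ` gives operators (`twistedDer`) that commute with the right derivations
up to conjugation of indices and have the same augmentation, so `θ` exchanges the two maximal
subspaces (`untwist_mem_leftCore`, `twist_mem_rightCore`). The same substitution turns the
commutator value `⟨f, v⟩ y` into `⟨f, v⟩ x y`, and a nonzero pairing forces `x y = 1`. Hence the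
relations of `A_Y ⋊ G` and of `H_Y` correspond, and the universal properties give mutually inverse
maps.

For the triangular decomposition, the relations move `Y*` to the right of `Y`, so the products `b c`
span. Injectivity comes from a Fock representation on `B(Y) ⊗ B(Y*)`: `b c` sends `1 ⊗ 1` to `b ⊗
c`. The point to check is that the relations of `B(Y*)` act by zero (`lift_fockDual_eq_zero`), which
again rests on stability of the Nichols ideal under `twistedDer`. -/

theorem TensorAlgebra.right_induction {C : TensorAlgebra ℂ V → Prop}
    (one : C 1) (smul : ∀ (r : ℂ) a, C a → C (r • a)) (add : ∀ a b, C a → C b → C (a + b))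
    (mul_ι : ∀ a v, C a → C (a * ι ℂ v)) (c : TensorAlgebra ℂ V) : C c := by
  -- Carrying an arbitrary left factor `a` makes the product case a composition of the two
  -- hypotheses.
  have key : ∀ c a : TensorAlgebra ℂ V, C a → C (a * c) := by
    intro c
    induction c using TensorAlgebra.induction with
    | algebraMap r => intro a ha; rw [← Algebra.commutes, ← Algebra.smul_def]; exact smul r a ha
    | ι v => exact fun a ha => mul_ι a v ha
    | mul x y hx hy => intro a ha; rw [← mul_assoc]; exact hy _ (hx _ ha)
    | add x y hx hy => intro a ha; rw [mul_add]; exact add _ _ (hx _ ha) (hy _ ha)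
  simpa using key c 1 one

theorem TensorAlgebra.left_induction {C : TensorAlgebra ℂ V → Prop}
    (one : C 1) (smul : ∀ (r : ℂ) a, C a → C (r • a)) (add : ∀ a b, C a → C b → C (a + b))
    (ι_mul : ∀ v a, C a → C (ι ℂ v * a)) (c : TensorAlgebra ℂ V) : C c := by
  have key : ∀ c a : TensorAlgebra ℂ V, C a → C (c * a) := by
    intro c
    induction c using TensorAlgebra.induction with
    | algebraMap r => intro a ha; rw [← Algebra.smul_def]; exact smul r a ha
    | ι v => exact fun a ha => ι_mul v a ha
    | mul x y hx hy => intro a ha; rw [mul_assoc]; exact hx _ (hy _ ha)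
    | add x y hx hy => intro a ha; rw [add_mul]; exact add _ _ (hx _ ha) (hy _ ha)
  simpa using key c 1 one

/-- The linear map `φ : T(V) → E` with `φ(1) = e` and `φ(c v) = R(v) φ(c)`. -/
def rightRec (R : V →ₗ[ℂ] Module.End ℂ E) (e : E) : TensorAlgebra ℂ V →ₗ[ℂ] E :=
  -- A word `v₁ ⋯ vₙ` must act as `R(vₙ) ⋯ R(v₁)`, an antihomomorphism; hence the opposite algebra.
  LinearMap.applyₗ e ∘ₗ (MulOpposite.opLinearEquiv ℂ).symm.toLinearMap ∘ₗ
    (TensorAlgebra.lift ℂ ((MulOpposite.opLinearEquiv ℂ).toLinearMap ∘ₗ R)).toLinearMap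

@[simp] theorem rightRec_one (R : V →ₗ[ℂ] Module.End ℂ E) (e : E) : rightRec R e 1 = e := by
  simp [rightRec]

@[simp] theorem rightRec_mul_ι (R : V →ₗ[ℂ] Module.End ℂ E) (e : E) (c : TensorAlgebra ℂ V)
    (v : V) : rightRec R e (c * ι ℂ v) = R v (rightRec R e c) := by
  simp [rightRec]

/-- The augmentation `T(V) → ℂ`. -/
abbrev tensorAug : TensorAlgebra ℂ V →ₐ[ℂ] ℂ := TensorAlgebra.algebraMapInv

@[simp] theorem tensorAug_ι (v : V) : tensorAug (ι ℂ v) = 0 := by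
  simp [tensorAug, algebraMapInv]

@[simp] theorem tensorAug_tensorAction {G : Type*} [Group G] (ρ : Representation ℂ G V) (g : G)
    (c : TensorAlgebra ℂ V) : tensorAug (tensorAction ρ g c) = tensorAug c := by
  rw [tensorAction_apply, ← AlgHom.comp_apply]
  congr 1
  ext v
  simp

@[simp] theorem tensorAction_ι {G : Type*} [Group G] (ρ : Representation ℂ G V) (g : G) (v : V) :
    tensorAction ρ g (ι ℂ v) = ι ℂ (ρ g v) := by
  rw [tensorAction_apply, tensorAlgebraMap_ι]

theorem tensorAction_mul_apply {G : Type*} [Group G] (ρ : Representation ℂ G V) (g h : G)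
    (c : TensorAlgebra ℂ V) :
    tensorAction ρ g (tensorAction ρ h c) = tensorAction ρ (g * h) c := by
  rw [map_mul, AlgHom.mul_apply]

theorem tensorAction_one_apply {G : Type*} [Group G] (ρ : Representation ℂ G V)
    (c : TensorAlgebra ℂ V) : tensorAction ρ 1 c = c := by
  rw [map_one, AlgHom.one_apply]

/-- The `(α, β)`-derivation `D` of `T(V)`, `D(ab) = α(a) D(b) + D(a) β(b)`, that extends the
functional `f` on `V`. -/
def skewDer (α β : TensorAlgebra ℂ V →ₐ[ℂ] TensorAlgebra ℂ V) (f : Module.Dual ℂ V) :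
    TensorAlgebra ℂ V →ₗ[ℂ] TensorAlgebra ℂ V :=
  -- The value at `c v` involves both `D(c)` and `c`, so the recursion carries the pair `(c, D(c))`.
  LinearMap.snd ℂ _ _ ∘ₗ rightRec (E := TensorAlgebra ℂ V × TensorAlgebra ℂ V)
    (LinearMap.mk₂ ℂ (fun v p => (p.1 * ι ℂ v, p.2 * β (ι ℂ v) + f v • α p.1))
      (by intro v w p; ext <;> simp [mul_add, add_smul]; abel)
      (by intro r v p; ext <;> simp [mul_smul])
      (by intro v p q; ext <;> simp [add_mul]; abel)
      (by intro r v p; ext <;> simp [smul_comm r])) (1, 0)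

variable (α β : TensorAlgebra ℂ V →ₐ[ℂ] TensorAlgebra ℂ V) (f : Module.Dual ℂ V)

@[simp] theorem skewDer_one : skewDer α β f 1 = 0 := by
  simp [skewDer]

theorem skewDer_mul_ι (c : TensorAlgebra ℂ V) (v : V) :
    skewDer α β f (c * ι ℂ v) = skewDer α β f c * β (ι ℂ v) + f v • α c := by
  simp only [skewDer, LinearMap.comp_apply, rightRec_mul_ι, LinearMap.mk₂_apply,
    LinearMap.snd_apply]
  -- What remains is that the first component of the recursion reproduces `c`.
  congr 3
  induction c using TensorAlgebra.right_induction with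
  | one => simp
  | smul r a h => simp [h]
  | add a b ha hb => simp [ha, hb]
  | mul_ι a v h => simp [h]

@[simp] theorem skewDer_ι (v : V) : skewDer α β f (ι ℂ v) = algebraMap ℂ _ (f v) := by
  have := skewDer_mul_ι α β f 1 v
  rw [one_mul] at this
  simp [this, Algebra.algebraMap_eq_smul_one]

theorem skewDer_mul (a b : TensorAlgebra ℂ V) :
    skewDer α β f (a * b) = α a * skewDer α β f b + skewDer α β f a * β b := by
  induction b using TensorAlgebra.right_induction with
  | one => simp
  | smul r b h => simp [h]
  | add b c hb hc => simp only [mul_add, map_add, hb, hc]; abel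
  | mul_ι b v h =>
    rw [← mul_assoc, skewDer_mul_ι, h, skewDer_mul_ι, map_mul, map_mul, mul_add, add_mul,
      mul_smul_comm]
    simp only [mul_assoc]
    abel

theorem skewDer_ι_mul (v : V) (a : TensorAlgebra ℂ V) :
    skewDer α β f (ι ℂ v * a) = α (ι ℂ v) * skewDer α β f a + f v • β a := by
  rw [skewDer_mul, skewDer_ι, Algebra.smul_def]

theorem map_skewDer (γ : TensorAlgebra ℂ V →ₐ[ℂ] TensorAlgebra ℂ V) (c : TensorAlgebra ℂ V) :
    γ (skewDer α β f c) = skewDer (γ.comp α) (γ.comp β) f c := by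
  induction c using TensorAlgebra.right_induction with
  | one => simp
  | smul r b h => simp [h]
  | add b c hb hc => simp only [map_add, hb, hc]
  | mul_ι b v h => simp [skewDer_mul_ι, h]

theorem skewDer_map (σ : V →ₗ[ℂ] V) (c : TensorAlgebra ℂ V) :
    skewDer α β f (tensorAlgebraMap σ c) =
      skewDer (α.comp (tensorAlgebraMap σ)) (β.comp (tensorAlgebraMap σ)) (f ∘ₗ σ) c := by
  induction c using TensorAlgebra.right_induction with
  | one => simp
  | smul r b h => simp [h]
  | add b c hb hc => simp only [map_add, hb, hc]
  | mul_ι b v h => simp [skewDer_mul_ι, h]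

/-- The action of `G` normalises the skew derivations. -/
theorem tensorAction_skewDer {G : Type*} [Group G] (ρ : Representation ℂ G V) (g h k : G)
    (c : TensorAlgebra ℂ V) :
    tensorAction ρ k (skewDer (tensorAction ρ g) (tensorAction ρ h) f c) =
      skewDer (tensorAction ρ (k * g * k⁻¹)) (tensorAction ρ (k * h * k⁻¹)) (ρ.dual k f)
        (tensorAction ρ k c) := by
  rw [map_skewDer]
  conv_rhs => rw [tensorAction_apply ρ k c, skewDer_map]
  have key : ∀ g, (tensorAction ρ k).comp (tensorAction ρ g) =
      (tensorAction ρ (k * g * k⁻¹)).comp (tensorAlgebraMap (ρ k)) := by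
    intro g
    ext v
    simp only [LinearMap.comp_apply, AlgHom.toLinearMap_apply, AlgHom.comp_apply, tensorAction_ι,
      tensorAlgebraMap_ι, ← Module.End.mul_apply, ← map_mul]
    congr 3
    group
  rw [key g, key h]
  congr 2
  ext v
  change f v = f (ρ k⁻¹ (ρ k v))
  rw [← Module.End.mul_apply, ← map_mul, inv_mul_cancel, map_one, Module.End.one_apply]

end RightRecursion

/-! ### The largest stable subspace of the augmentation ideal -/

section Core

open TensorAlgebra

variable {V : Type*} [AddCommGroup V] [Module ℂ V]

/-- The largest subspace of the augmentation ideal of `T(V)` that is stable under a set of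
operators. -/
def stableCore (𝒟 : Set (Module.End ℂ (TensorAlgebra ℂ V))) : Submodule ℂ (TensorAlgebra ℂ V) :=
  sSup {S | (∀ c ∈ S, tensorAug c = 0) ∧ ∀ D ∈ 𝒟, ∀ c ∈ S, D c ∈ S}

variable {𝒟 : Set (Module.End ℂ (TensorAlgebra ℂ V))}

theorem le_stableCore {S : Submodule ℂ (TensorAlgebra ℂ V)} (h₁ : ∀ c ∈ S, tensorAug c = 0)
    (h₂ : ∀ D ∈ 𝒟, ∀ c ∈ S, D c ∈ S) : S ≤ stableCore 𝒟 :=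
  le_sSup ⟨h₁, h₂⟩

theorem tensorAug_of_mem_stableCore {c : TensorAlgebra ℂ V} (hc : c ∈ stableCore 𝒟) :
    tensorAug c = 0 := by
  have : stableCore 𝒟 ≤ LinearMap.ker (tensorAug (V := V)).toLinearMap :=
    sSup_le fun S hS c hc => hS.1 c hc
  exact this hc

theorem stableCore_stable {D : Module.End ℂ (TensorAlgebra ℂ V)} (hD : D ∈ 𝒟)
    {c : TensorAlgebra ℂ V} (hc : c ∈ stableCore 𝒟) : D c ∈ stableCore 𝒟 := by
  have : stableCore 𝒟 ≤ (stableCore 𝒟).comap D :=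
    sSup_le fun S hS c hc => le_sSup (a := S) hS (hS.2 D hD c hc)
  exact this hc

/-- The form in which maximality is used: to show that a family of maps preserves the core, take for
`s` all images of core elements. Only the generators need checking, and a derivative may be a sum of
several of them. -/
theorem mem_stableCore_of_span {s : Set (TensorAlgebra ℂ V)} (h₁ : ∀ c ∈ s, tensorAug c = 0)
    (h₂ : ∀ D ∈ 𝒟, ∀ c ∈ s, D c ∈ Submodule.span ℂ s) {c : TensorAlgebra ℂ V} (hc : c ∈ s) :
    c ∈ stableCore 𝒟 := by
  refine le_stableCore (S := Submodule.span ℂ s) (fun c hc => ?_) (fun D hD c hc => ?_)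
    (Submodule.subset_span hc)
  · have : Submodule.span ℂ s ≤ LinearMap.ker (tensorAug (V := V)).toLinearMap :=
      Submodule.span_le.2 h₁
    exact this hc
  · have : Submodule.span ℂ s ≤ (Submodule.span ℂ s).comap D := Submodule.span_le.2 (h₂ D hD)
    exact this hc

variable {G : Type*} [Group G]

/-- The skew derivations of `T(V)` twisted by the action of the pairs `(g, h)`, extending the
functionals `f`, for the triples `(g, h, f)` in a given set. -/
def skewDers (ρ : Representation ℂ G V) (R : Set (G × G × Module.Dual ℂ V)) :
    Set (Module.End ℂ (TensorAlgebra ℂ V)) :=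
  (fun t => skewDer (tensorAction ρ t.1) (tensorAction ρ t.2.1) t.2.2) '' R

variable {ρ : Representation ℂ G V} {R : Set (G × G × Module.Dual ℂ V)}

theorem skewDer_mem_stableCore {g h : G} {f : Module.Dual ℂ V} (ht : (g, h, f) ∈ R)
    {c : TensorAlgebra ℂ V} (hc : c ∈ stableCore (skewDers ρ R)) :
    skewDer (tensorAction ρ g) (tensorAction ρ h) f c ∈ stableCore (skewDers ρ R) :=
  stableCore_stable (Set.mem_image_of_mem (fun t : G × G × Module.Dual ℂ V =>
    skewDer (tensorAction ρ t.1) (tensorAction ρ t.2.1) t.2.2) ht) hc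

/-- Acting by `k` conjugates the indices of a skew derivation, so the sum of all translates of the
core is again stable, hence contained in the core. -/
theorem tensorAction_mem_stableCore
    (hR : ∀ k g h f, (g, h, f) ∈ R → (k * g * k⁻¹, k * h * k⁻¹, ρ.dual k f) ∈ R)
    (k : G) {c : TensorAlgebra ℂ V} (hc : c ∈ stableCore (skewDers ρ R)) :
    tensorAction ρ k c ∈ stableCore (skewDers ρ R) := by
  refine mem_stableCore_of_span
    (s := {x | ∃ k, ∃ c ∈ stableCore (skewDers ρ R), x = tensorAction ρ k c}) ?_ ?_ ⟨k, c, hc, rfl⟩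
  · rintro _ ⟨k, c, hc, rfl⟩
    rw [tensorAug_tensorAction, tensorAug_of_mem_stableCore hc]
  · rintro _ ⟨⟨g, h, f⟩, ht, rfl⟩ _ ⟨k, c, hc, rfl⟩
    -- The index is conjugated by `k⁻¹` beforehand, so that moving the derivation past `k` restores
    -- `(g, h, f)`.
    refine Submodule.subset_span ⟨k, skewDer (tensorAction ρ (k⁻¹ * g * k⁻¹⁻¹))
      (tensorAction ρ (k⁻¹ * h * k⁻¹⁻¹)) (ρ.dual k⁻¹ f) c,
      skewDer_mem_stableCore (hR _ _ _ _ ht) hc, ?_⟩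
    rw [tensorAction_skewDer]
    have e : ∀ x : G, k * (k⁻¹ * x * k⁻¹⁻¹) * k⁻¹ = x := fun x => by group
    rw [e, e, ← Module.End.mul_apply, ← map_mul, mul_inv_cancel, map_one, Module.End.one_apply]

/-- By the twisted Leibniz rule every term of the derivative of `a c b` contains `g ▷ c`, `h ▷ c` or
the derivative of `c`, all of which lie in the core. -/
theorem mul_mem_stableCore
    (hR : ∀ k g h f, (g, h, f) ∈ R → (k * g * k⁻¹, k * h * k⁻¹, ρ.dual k f) ∈ R)
    (a b : TensorAlgebra ℂ V) {c : TensorAlgebra ℂ V} (hc : c ∈ stableCore (skewDers ρ R)) :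
    a * c * b ∈ stableCore (skewDers ρ R) := by
  refine mem_stableCore_of_span
    (s := {x | ∃ a b, ∃ c ∈ stableCore (skewDers ρ R), x = a * c * b}) ?_ ?_ ⟨a, b, c, hc, rfl⟩
  · rintro _ ⟨a, b, c, hc, rfl⟩
    rw [map_mul, map_mul, tensorAug_of_mem_stableCore hc, mul_zero, zero_mul]
  · rintro _ ⟨⟨g, h, f⟩, ht, rfl⟩ _ ⟨a, b, c, hc, rfl⟩
    rw [skewDer_mul, skewDer_mul, map_mul, add_mul]
    refine add_mem (Submodule.subset_span ⟨_, _, _, tensorAction_mem_stableCore hR g hc, rfl⟩)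
      (add_mem (Submodule.subset_span ⟨_, _, _, skewDer_mem_stableCore ht hc, rfl⟩)
        (Submodule.subset_span ⟨_, _, _, tensorAction_mem_stableCore hR h hc, rfl⟩))

theorem tensorAction_mem_pow_range (g : G) (n : ℕ) {c : TensorAlgebra ℂ V}
    (hc : c ∈ LinearMap.range (ι ℂ (M := V)) ^ n) :
    tensorAction ρ g c ∈ LinearMap.range (ι ℂ (M := V)) ^ n := by
  have : LinearMap.range (ι ℂ (M := V)) ^ n ≤
      (LinearMap.range (ι ℂ (M := V)) ^ n).comap (tensorAction ρ g).toLinearMap := by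
    rw [← Submodule.map_le_iff_le_comap, Submodule.map_pow]
    refine pow_le_pow_left' ?_ n
    rintro _ ⟨_, ⟨v, rfl⟩, rfl⟩
    exact ⟨ρ g v, by simp⟩
  exact this hc

theorem skewDer_mem_pow_range (g h : G) (f : Module.Dual ℂ V) (n : ℕ) {c : TensorAlgebra ℂ V}
    (hc : c ∈ LinearMap.range (ι ℂ (M := V)) ^ (n + 1)) :
    skewDer (tensorAction ρ g) (tensorAction ρ h) f c ∈
      LinearMap.range (ι ℂ (M := V)) ^ n := by
  induction n generalizing c with
  | zero =>
    rw [zero_add, pow_one] at hc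
    obtain ⟨v, rfl⟩ := hc
    rw [skewDer_ι, pow_zero]
    exact Submodule.algebraMap_mem _
  | succ n ih =>
    rw [pow_succ] at hc
    induction hc using Submodule.mul_induction_on' with
    | mem_mul_mem a ha b hb =>
      obtain ⟨v, rfl⟩ := hb
      rw [skewDer_mul_ι]
      refine add_mem ?_ (Submodule.smul_mem _ _ (tensorAction_mem_pow_range _ _ ha))
      rw [tensorAction_ι, pow_succ]
      exact Submodule.mul_mem_mul (ih ha) ⟨_, rfl⟩
    | add a _ b _ ha hb => rw [map_add]; exact add_mem ha hb

/-- The projection of `T(V)` onto its component of degree `n`. -/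
def tensorProj (n : ℕ) : TensorAlgebra ℂ V →ₗ[ℂ] TensorAlgebra ℂ V :=
  GradedAlgebra.proj (fun n : ℕ => LinearMap.range (ι ℂ (M := V)) ^ n) n

theorem tensorProj_of_mem {n : ℕ} {c : TensorAlgebra ℂ V}
    (hc : c ∈ LinearMap.range (ι ℂ (M := V)) ^ n) : tensorProj n c = c :=
  DirectSum.decompose_of_mem_same (fun n : ℕ => LinearMap.range (ι ℂ (M := V)) ^ n) hc

theorem tensorProj_of_mem_ne {m n : ℕ} (h : m ≠ n) {c : TensorAlgebra ℂ V}
    (hc : c ∈ LinearMap.range (ι ℂ (M := V)) ^ m) : tensorProj n c = 0 :=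
  DirectSum.decompose_of_mem_ne (fun n : ℕ => LinearMap.range (ι ℂ (M := V)) ^ n) hc h

theorem tensorProj_mem (n : ℕ) (c : TensorAlgebra ℂ V) :
    tensorProj n c ∈ LinearMap.range (ι ℂ (M := V)) ^ n :=
  (DirectSum.decompose (fun n : ℕ => LinearMap.range (ι ℂ (M := V)) ^ n) c n).2

theorem tensorAlgebra_homogeneous_induction {C : TensorAlgebra ℂ V → Prop}
    (mem : ∀ n, ∀ c ∈ LinearMap.range (ι ℂ (M := V)) ^ n, C c)
    (add : ∀ a b, C a → C b → C (a + b)) (c : TensorAlgebra ℂ V) : C c :=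
  DirectSum.Decomposition.inductionOn (fun n : ℕ => LinearMap.range (ι ℂ (M := V)) ^ n)
    (mem 0 0 (zero_mem _)) (fun m => mem _ _ m.2) (fun a b => add a b) c

theorem skewDer_tensorProj (g h : G) (f : Module.Dual ℂ V) (n : ℕ) (c : TensorAlgebra ℂ V) :
    skewDer (tensorAction ρ g) (tensorAction ρ h) f (tensorProj (n + 1) c) =
      tensorProj n (skewDer (tensorAction ρ g) (tensorAction ρ h) f c) := by
  induction c using tensorAlgebra_homogeneous_induction with
  | add a b ha hb => simp only [map_add, ha, hb]
  | mem m c hc =>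
    rcases m with _ | m
    · rw [tensorProj_of_mem_ne (by omega) hc]
      rw [pow_zero, Submodule.mem_one] at hc
      obtain ⟨r, rfl⟩ := hc
      simp [Algebra.algebraMap_eq_smul_one]
    · by_cases e : m = n
      · subst e
        rw [tensorProj_of_mem hc, tensorProj_of_mem (skewDer_mem_pow_range _ _ _ _ hc)]
      · rw [tensorProj_of_mem_ne (by omega) hc, map_zero,
          tensorProj_of_mem_ne e (skewDer_mem_pow_range _ _ _ _ hc)]

theorem tensorAug_of_mem_pow {n : ℕ} {c : TensorAlgebra ℂ V}
    (hc : c ∈ LinearMap.range (ι ℂ (M := V)) ^ (n + 1)) : tensorAug c = 0 := by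
  rw [pow_succ] at hc
  induction hc using Submodule.mul_induction_on' with
  | mem_mul_mem a _ b hb => obtain ⟨v, rfl⟩ := hb; simp
  | add a _ b _ ha hb => rw [map_add, ha, hb, add_zero]

theorem tensorProj_zero (c : TensorAlgebra ℂ V) :
    tensorProj 0 c = algebraMap ℂ _ (tensorAug c) := by
  induction c using tensorAlgebra_homogeneous_induction with
  | add a b ha hb => simp only [map_add, ha, hb]
  | mem m c hc =>
    rcases m with _ | m
    · rw [tensorProj_of_mem hc]
      rw [pow_zero, Submodule.mem_one] at hc
      obtain ⟨r, rfl⟩ := hc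
      rw [AlgHom.commutes]
      rfl
    · rw [tensorProj_of_mem_ne (by omega) hc, tensorAug_of_mem_pow hc, map_zero]

/-- Skew derivations lower the degree by one, so they permute the projections of core elements; the
projection to degree 0 is the augmentation, which vanishes on the core. -/
theorem tensorProj_mem_stableCore (n : ℕ) {c : TensorAlgebra ℂ V}
    (hc : c ∈ stableCore (skewDers ρ R)) : tensorProj n c ∈ stableCore (skewDers ρ R) := by
  refine mem_stableCore_of_span
    (s := {x | ∃ n, ∃ c ∈ stableCore (skewDers ρ R), x = tensorProj n c}) ?_ ?_ ⟨n, c, hc, rfl⟩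
  · rintro _ ⟨_ | n, c, hc, rfl⟩
    · rw [tensorProj_zero, tensorAug_of_mem_stableCore hc, map_zero, map_zero]
    · exact tensorAug_of_mem_pow (tensorProj_mem _ c)
  · rintro _ ⟨⟨g, h, f⟩, ht, rfl⟩ _ ⟨_ | n, c, hc, rfl⟩
    · rw [tensorProj_zero, tensorAug_of_mem_stableCore hc, map_zero, map_zero]
      exact zero_mem _
    · exact Submodule.subset_span ⟨n, _, skewDer_mem_stableCore ht hc, skewDer_tensorProj _ _ _ _ _⟩

theorem mem_of_tensorProj_mem {S : Submodule ℂ (TensorAlgebra ℂ V)} {c : TensorAlgebra ℂ V}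
    (h : ∀ n, tensorProj n c ∈ S) : c ∈ S := by
  classical
  rw [← DirectSum.sum_support_decompose (fun n : ℕ => LinearMap.range (ι ℂ (M := V)) ^ n) c]
  exact Submodule.sum_mem _ fun n _ => h n

theorem isGradedInvariantIdeal_stableCore
    (hR : ∀ k g h f, (g, h, f) ∈ R → (k * g * k⁻¹, k * h * k⁻¹, ρ.dual k f) ∈ R) :
    IsGradedInvariantIdeal ρ (stableCore (skewDers ρ R)) where
  mul_mem_left a b hb := by simpa using mul_mem_stableCore hR a 1 hb
  mul_mem_right a b hb := by simpa using mul_mem_stableCore hR 1 a hb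
  graded := by
    refine le_antisymm (fun c hc => mem_of_tensorProj_mem fun n => ?_)
      (iSup_le fun n => inf_le_left)
    rcases n with _ | n
    · rw [tensorProj_zero, tensorAug_of_mem_stableCore hc, map_zero]
      exact zero_mem _
    · exact Submodule.mem_iSup_of_mem n ⟨tensorProj_mem_stableCore _ hc, tensorProj_mem _ _⟩
  invariant g b hb := tensorAction_mem_stableCore hR g hb

theorem IsGradedInvariantIdeal.tensorAug_eq_zero {I : Submodule ℂ (TensorAlgebra ℂ V)}
    (hI : IsGradedInvariantIdeal ρ I) {c : TensorAlgebra ℂ V} (hc : c ∈ I) : tensorAug c = 0 := by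
  have : I ≤ LinearMap.ker (tensorAug (V := V)).toLinearMap := by
    rw [hI.graded]
    exact iSup_le fun n c hc => tensorAug_of_mem_pow hc.2
  exact this hc

end Core
end

noncomputable section
/-! ### The two families of braided derivations of a Yetter-Drinfeld module -/

namespace YetterDrinfeld

open TensorAlgebra

variable {G : Type*} [Group G] {V : Type*} [AddCommGroup V] [Module ℂ V]
variable {E : Type*} [AddCommGroup E] [Module ℂ E]
variable (𝒱 : YetterDrinfeld G V)

theorem grading_induction {C : V → Prop} (zero : C 0) (add : ∀ v w, C v → C w → C (v + w))
    (mem : ∀ x, ∀ v ∈ 𝒱.grading x, C v) (v : V) : C v := by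
  have hv : v ∈ ⨆ x, 𝒱.grading x := by rw [𝒱.iSup_eq_top]; trivial
  exact Submodule.iSup_induction _ (motive := C) hv mem zero add

theorem right_induction {C : TensorAlgebra ℂ V → Prop}
    (one : C 1) (smul : ∀ (r : ℂ) a, C a → C (r • a)) (add : ∀ a b, C a → C b → C (a + b))
    (mul_ι : ∀ a x, ∀ v ∈ 𝒱.grading x, C a → C (a * ι ℂ v)) (c : TensorAlgebra ℂ V) : C c := by
  refine TensorAlgebra.right_induction one smul add (fun a v ha => ?_) c
  refine 𝒱.grading_induction (C := fun v => C (a * ι ℂ v)) ?_ (fun v w hv hw => ?_)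
    (fun x v hv => mul_ι a x v hv ha) v
  · simpa using smul 0 1 one
  · rw [map_add, mul_add]
    exact add _ _ hv hw

theorem left_induction {C : TensorAlgebra ℂ V → Prop}
    (one : C 1) (smul : ∀ (r : ℂ) a, C a → C (r • a)) (add : ∀ a b, C a → C b → C (a + b))
    (ι_mul : ∀ x, ∀ v ∈ 𝒱.grading x, ∀ a, C a → C (ι ℂ v * a)) (c : TensorAlgebra ℂ V) : C c := by
  refine TensorAlgebra.left_induction one smul add (fun v a ha => ?_) c
  refine 𝒱.grading_induction (C := fun v => C (ι ℂ v * a)) ?_ (fun v w hv hw => ?_)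
    (fun x v hv => ι_mul x v hv a ha) v
  · simpa using smul 0 1 one
  · rw [map_add, add_mul]
    exact add _ _ hv hw

/-- Used throughout on terms with coefficient `f v`: either the term vanishes, or the degree of `v`
may be replaced by the degree on which `f` is supported. -/
theorem eq_of_apply_ne_zero {g x : G} {f : Module.Dual ℂ V} (hf : f ∈ 𝒱.dualGrading g⁻¹) {v : V}
    (hv : v ∈ 𝒱.grading x) (h : f v ≠ 0) : x = g := by
  by_contra e
  exact h (hf x (by rwa [inv_inv]) v hv)

theorem dual_smul_mem_inv (k : G) {g : G} {f : Module.Dual ℂ V} (hf : f ∈ 𝒱.dualGrading g⁻¹) :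
    𝒱.ρ.dual k f ∈ 𝒱.dualGrading (k * g * k⁻¹)⁻¹ := by
  have := 𝒱.dual_smul_mem k hf
  rwa [show k * g⁻¹ * k⁻¹ = (k * g * k⁻¹)⁻¹ by group] at this

theorem dual_apply_smul (k : G) (f : Module.Dual ℂ V) (v : V) : 𝒱.ρ.dual k f (𝒱.ρ k v) = f v := by
  change f (𝒱.ρ k⁻¹ (𝒱.ρ k v)) = f v
  rw [← Module.End.mul_apply, ← map_mul, inv_mul_cancel, map_one, Module.End.one_apply]

theorem dual_inv_apply (k : G) (f : Module.Dual ℂ V) (v : V) : 𝒱.ρ.dual k⁻¹ f v = f (𝒱.ρ k v) := by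
  change f (𝒱.ρ k⁻¹⁻¹ v) = _
  rw [inv_inv]

theorem dual_mul_apply (k l : G) (f : Module.Dual ℂ V) :
    𝒱.ρ.dual k (𝒱.ρ.dual l f) = 𝒱.ρ.dual (k * l) f := by
  rw [map_mul, Module.End.mul_apply]

/-- The indices of the derivations `∂(ab) = a ∂(b) + ∂(a) (g ▷ b)` that extend functionals
supported on `V_g`. -/
def rightTriples : Set (G × G × Module.Dual ℂ V) :=
  {t | t.1 = 1 ∧ t.2.2 ∈ 𝒱.dualGrading t.2.1⁻¹}

/-- The indices of the derivations `∂(ab) = (g ▷ a) ∂(b) + ∂(a) b` that extend functionals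
supported on `V_g`. -/
def leftTriples : Set (G × G × Module.Dual ℂ V) :=
  {t | t.2.1 = 1 ∧ t.2.2 ∈ 𝒱.dualGrading t.1⁻¹}

/-- The derivation `∂` of `T(V)` with `∂(ab) = a ∂(b) + ∂(a) (g ▷ b)` that extends `f`. -/
abbrev rightDer (g : G) (f : Module.Dual ℂ V) : TensorAlgebra ℂ V →ₗ[ℂ] TensorAlgebra ℂ V :=
  skewDer (tensorAction 𝒱.ρ 1) (tensorAction 𝒱.ρ g) f

/-- The derivation `∂` of `T(V)` with `∂(ab) = (g ▷ a) ∂(b) + ∂(a) b` that extends `f`. -/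
abbrev leftDer (g : G) (f : Module.Dual ℂ V) : TensorAlgebra ℂ V →ₗ[ℂ] TensorAlgebra ℂ V :=
  skewDer (tensorAction 𝒱.ρ g) (tensorAction 𝒱.ρ 1) f

theorem rightDer_mul_ι (g : G) (f : Module.Dual ℂ V) (c : TensorAlgebra ℂ V) (v : V) :
    𝒱.rightDer g f (c * ι ℂ v) = 𝒱.rightDer g f c * ι ℂ (𝒱.ρ g v) + f v • c := by
  rw [rightDer, skewDer_mul_ι, tensorAction_ι, tensorAction_one_apply]

theorem leftDer_mul_ι (g : G) (f : Module.Dual ℂ V) (c : TensorAlgebra ℂ V) (v : V) :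
    𝒱.leftDer g f (c * ι ℂ v) = 𝒱.leftDer g f c * ι ℂ v + f v • tensorAction 𝒱.ρ g c := by
  rw [leftDer, skewDer_mul_ι, tensorAction_one_apply]

/-- The largest subspace of the augmentation ideal stable under the derivations `rightDer`. -/
def rightCore : Submodule ℂ (TensorAlgebra ℂ V) := stableCore (skewDers 𝒱.ρ 𝒱.rightTriples)

/-- The largest subspace of the augmentation ideal stable under the derivations `leftDer`. -/
def leftCore : Submodule ℂ (TensorAlgebra ℂ V) := stableCore (skewDers 𝒱.ρ 𝒱.leftTriples)

theorem isGradedInvariantIdeal_rightCore : IsGradedInvariantIdeal 𝒱.ρ 𝒱.rightCore := by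
  refine isGradedInvariantIdeal_stableCore ?_
  rintro k g h f ⟨h₁, h₂⟩
  refine ⟨?_, 𝒱.dual_smul_mem_inv k h₂⟩
  change g = 1 at h₁
  simp [h₁]

theorem isGradedInvariantIdeal_leftCore : IsGradedInvariantIdeal 𝒱.ρ 𝒱.leftCore := by
  refine isGradedInvariantIdeal_stableCore ?_
  rintro k g h f ⟨h₁, h₂⟩
  refine ⟨?_, 𝒱.dual_smul_mem_inv k h₂⟩
  change h = 1 at h₁
  simp [h₁]

variable {𝒱}

theorem rightDer_mem {g : G} {f : Module.Dual ℂ V} (hf : f ∈ 𝒱.dualGrading g⁻¹)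
    {c : TensorAlgebra ℂ V} (hc : c ∈ 𝒱.rightCore) : 𝒱.rightDer g f c ∈ 𝒱.rightCore :=
  skewDer_mem_stableCore (R := 𝒱.rightTriples) ⟨rfl, hf⟩ hc

theorem leftDer_mem {g : G} {f : Module.Dual ℂ V} (hf : f ∈ 𝒱.dualGrading g⁻¹)
    {c : TensorAlgebra ℂ V} (hc : c ∈ 𝒱.leftCore) : 𝒱.leftDer g f c ∈ 𝒱.leftCore :=
  skewDer_mem_stableCore (R := 𝒱.leftTriples) ⟨rfl, hf⟩ hc

theorem mem_rightCore_of_span {s : Set (TensorAlgebra ℂ V)} (h₁ : ∀ c ∈ s, tensorAug c = 0)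
    (h₂ : ∀ g, ∀ f ∈ 𝒱.dualGrading g⁻¹, ∀ c ∈ s, 𝒱.rightDer g f c ∈ Submodule.span ℂ s)
    {c : TensorAlgebra ℂ V} (hc : c ∈ s) : c ∈ 𝒱.rightCore := by
  refine mem_stableCore_of_span h₁ ?_ hc
  rintro _ ⟨⟨g, h, f⟩, ⟨h₁, hf⟩, rfl⟩ c hc
  change g = 1 at h₁
  subst h₁
  exact h₂ h f hf c hc

theorem mem_leftCore_of_span {s : Set (TensorAlgebra ℂ V)} (h₁ : ∀ c ∈ s, tensorAug c = 0)
    (h₂ : ∀ g, ∀ f ∈ 𝒱.dualGrading g⁻¹, ∀ c ∈ s, 𝒱.leftDer g f c ∈ Submodule.span ℂ s)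
    {c : TensorAlgebra ℂ V} (hc : c ∈ s) : c ∈ 𝒱.leftCore := by
  refine mem_stableCore_of_span h₁ ?_ hc
  rintro _ ⟨⟨g, h, f⟩, ⟨h₁, hf⟩, rfl⟩ c hc
  change h = 1 at h₁
  subst h₁
  exact h₂ g f hf c hc

variable (𝒱)

/-! ### The grading of the tensor algebra by the group -/

/-- The coaction of `G` on `T(V)`: the components of an element with respect to the grading of
`T(V)` by `G`. -/
def coact : TensorAlgebra ℂ V →ₗ[ℂ] (G →₀ TensorAlgebra ℂ V) :=
  rightRec (𝒱.gradedLift fun x => LinearMap.mk₂ ℂ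
    (fun (v : V) (p : G →₀ TensorAlgebra ℂ V) =>
      Finsupp.lsum ℂ (fun X => Finsupp.lsingle (X * x) ∘ₗ LinearMap.mulRight ℂ (ι ℂ v)) p)
    (by
      intro v w p
      simp [mul_add, Finsupp.sum, Finset.sum_add_distrib])
    (by
      intro r v p
      simp [Finsupp.sum, Finset.smul_sum])
    (fun v p q => map_add _ p q) (fun r v p => map_smul _ r p)) (Finsupp.single 1 1)

/-- The component of degree `X` of an element of `T(V)`. -/
def gradedProj (X : G) : TensorAlgebra ℂ V →ₗ[ℂ] TensorAlgebra ℂ V :=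
  Finsupp.lapply X ∘ₗ 𝒱.coact

/-- The linear map `c ↦ ∑_X φ_X(c_X)` on `T(V)`, where `c_X` is the component of degree `X`. -/
def gradedSum (φ : G → TensorAlgebra ℂ V →ₗ[ℂ] E) : TensorAlgebra ℂ V →ₗ[ℂ] E :=
  Finsupp.lsum ℂ φ ∘ₗ 𝒱.coact

theorem coact_mul_ι {x : G} {v : V} (hv : v ∈ 𝒱.grading x) (c : TensorAlgebra ℂ V) :
    𝒱.coact (c * ι ℂ v) = Finsupp.lsum ℂ
      (fun X => Finsupp.lsingle (X * x) ∘ₗ LinearMap.mulRight ℂ (ι ℂ v)) (𝒱.coact c) := by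
  rw [coact, rightRec_mul_ι, 𝒱.gradedLift_of_mem _ hv]
  rfl

@[simp] theorem gradedSum_one (φ : G → TensorAlgebra ℂ V →ₗ[ℂ] E) :
    𝒱.gradedSum φ 1 = φ 1 1 := by
  simp [gradedSum, coact]

theorem gradedSum_mul_ι (φ : G → TensorAlgebra ℂ V →ₗ[ℂ] E) {x : G} {v : V}
    (hv : v ∈ 𝒱.grading x) (c : TensorAlgebra ℂ V) :
    𝒱.gradedSum φ (c * ι ℂ v) =
      𝒱.gradedSum (fun X => φ (X * x) ∘ₗ LinearMap.mulRight ℂ (ι ℂ v)) c := by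
  rw [gradedSum, LinearMap.comp_apply, 𝒱.coact_mul_ι hv, gradedSum, LinearMap.comp_apply,
    ← LinearMap.comp_apply]
  congr 1
  refine Finsupp.lhom_ext fun X b => ?_
  simp only [LinearMap.comp_apply, Finsupp.lsum_single, Finsupp.lsingle_apply]

theorem gradedSum_apply (φ : G → TensorAlgebra ℂ V →ₗ[ℂ] E) (c : TensorAlgebra ℂ V) :
    𝒱.gradedSum φ c = ∑ X ∈ (𝒱.coact c).support, φ X (𝒱.gradedProj X c) := rfl

theorem gradedSum_comp {F : Type*} [AddCommGroup F] [Module ℂ F] (L : E →ₗ[ℂ] F)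
    (φ : G → TensorAlgebra ℂ V →ₗ[ℂ] E) (c : TensorAlgebra ℂ V) :
    L (𝒱.gradedSum φ c) = 𝒱.gradedSum (fun X => L ∘ₗ φ X) c := by
  simp [gradedSum_apply]

theorem gradedProj_mul_ι (X : G) {x : G} {v : V} (hv : v ∈ 𝒱.grading x) (c : TensorAlgebra ℂ V) :
    𝒱.gradedProj X (c * ι ℂ v) = 𝒱.gradedProj (X * x⁻¹) c * ι ℂ v := by
  classical
  rw [gradedProj, LinearMap.comp_apply, 𝒱.coact_mul_ι hv, gradedProj, LinearMap.comp_apply]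
  refine LinearMap.congr_fun (f := Finsupp.lapply X ∘ₗ Finsupp.lsum ℂ
      (fun X => Finsupp.lsingle (X * x) ∘ₗ LinearMap.mulRight ℂ (ι ℂ v)))
    (g := LinearMap.mulRight ℂ (ι ℂ v) ∘ₗ Finsupp.lapply (X * x⁻¹)) ?_ (𝒱.coact c)
  refine Finsupp.lhom_ext fun Z b => ?_
  simp only [LinearMap.comp_apply, Finsupp.lsum_single, Finsupp.lsingle_apply,
    Finsupp.lapply_apply, Finsupp.single_apply, LinearMap.mulRight_apply, eq_mul_inv_iff_mul_eq]
  split_ifs <;> simp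

theorem gradedProj_one [DecidableEq G] (X : G) :
    𝒱.gradedProj X 1 = if 1 = X then 1 else 0 := by
  simp [gradedProj, coact, Finsupp.single_apply]

/-- Removing a letter of degree `g` with this derivation multiplies the `G`-degree by `g⁻¹` on the
right: the letters after it are acted on by `g`, and `g⁻¹ (g x g⁻¹) = x g⁻¹`. -/
theorem rightDer_gradedProj {g : G} {f : Module.Dual ℂ V} (hf : f ∈ 𝒱.dualGrading g⁻¹)
    (c : TensorAlgebra ℂ V) (X : G) :
    𝒱.rightDer g f (𝒱.gradedProj X c) = 𝒱.gradedProj (X * g⁻¹) (𝒱.rightDer g f c) := by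
  classical
  induction c using 𝒱.right_induction generalizing X with
  | one => rw [gradedProj_one, skewDer_one, map_zero]; split_ifs <;> simp
  | smul r a h => simp [h]
  | add a b ha hb => simp only [map_add, ha, hb]
  | mul_ι c x v hv h =>
    rw [gradedProj_mul_ι _ _ hv, rightDer_mul_ι, h, rightDer_mul_ι, map_add,
      gradedProj_mul_ι _ _ (𝒱.smul_mem g hv), map_smul]
    congr 1
    · congr 3
      group
    · by_cases e : f v = 0
      · simp [e]
      · rw [𝒱.eq_of_apply_ne_zero hf hv e]

theorem tensorAug_gradedProj [DecidableEq G] (c : TensorAlgebra ℂ V) (X : G) :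
    tensorAug (𝒱.gradedProj X c) = if 1 = X then tensorAug c else 0 := by
  induction c using 𝒱.right_induction with
  | one => rw [gradedProj_one]; split_ifs <;> simp
  | smul r a h => simp [h]
  | add a b ha hb => simp only [map_add, ha, hb]; split_ifs <;> simp
  | mul_ι c x v hv h => simp [gradedProj_mul_ι _ _ hv]

/-- The right derivations shift the `G`-grading, so the span of all `G`-components of core elements
is stable. This makes sums `∑ φ_X(c_X)` controllable on the core. -/
theorem gradedProj_mem_rightCore (X : G) {c : TensorAlgebra ℂ V} (hc : c ∈ 𝒱.rightCore) :
    𝒱.gradedProj X c ∈ 𝒱.rightCore := by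
  classical
  refine mem_rightCore_of_span
    (s := {x | ∃ X, ∃ c ∈ 𝒱.rightCore, x = 𝒱.gradedProj X c}) ?_ ?_ ⟨X, c, hc, rfl⟩
  · rintro _ ⟨X, c, hc, rfl⟩
    rw [tensorAug_gradedProj, tensorAug_of_mem_stableCore hc, ite_self]
  · rintro g f hf _ ⟨X, c, hc, rfl⟩
    exact Submodule.subset_span ⟨_, _, rightDer_mem hf hc, 𝒱.rightDer_gradedProj hf c X⟩

theorem gradedSum_mem_of_mem_rightCore (φ : G → TensorAlgebra ℂ V →ₗ[ℂ] E) {S : Submodule ℂ E}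
    (hφ : ∀ X, ∀ c ∈ 𝒱.rightCore, φ X c ∈ S) {c : TensorAlgebra ℂ V} (hc : c ∈ 𝒱.rightCore) :
    𝒱.gradedSum φ c ∈ S := by
  rw [gradedSum_apply]
  exact Submodule.sum_mem _ fun X _ => hφ X _ (𝒱.gradedProj_mem_rightCore X hc)

/-! ### Comparison of the two cores -/

/-- The linear automorphism `θ` of `T(V)` with `θ(c v) = (s(x) ▷ θ(c)) v` for `v ∈ V_x`. -/
def twist (s : G → G) : TensorAlgebra ℂ V →ₗ[ℂ] TensorAlgebra ℂ V :=
  rightRec (𝒱.gradedLift fun x => LinearMap.mk₂ ℂ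
    (fun v c => tensorAction 𝒱.ρ (s x) c * ι ℂ v)
    (by intro v w c; simp [mul_add]) (by simp) (by intro v c d; simp [add_mul]) (by simp)) 1

@[simp] theorem twist_one (s : G → G) : 𝒱.twist s 1 = 1 := by simp [twist]

theorem twist_mul_ι (s : G → G) {x : G} {v : V} (hv : v ∈ 𝒱.grading x) (c : TensorAlgebra ℂ V) :
    𝒱.twist s (c * ι ℂ v) = tensorAction 𝒱.ρ (s x) (𝒱.twist s c) * ι ℂ v := by
  rw [twist, rightRec_mul_ι, 𝒱.gradedLift_of_mem _ hv]
  rfl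

theorem twist_tensorAction {s : G → G} (hs : ∀ k x, s (k * x * k⁻¹) = k * s x * k⁻¹) (k : G)
    (c : TensorAlgebra ℂ V) :
    𝒱.twist s (tensorAction 𝒱.ρ k c) = tensorAction 𝒱.ρ k (𝒱.twist s c) := by
  induction c using 𝒱.right_induction with
  | one => simp
  | smul r a h => simp [h]
  | add a b ha hb => simp only [map_add, ha, hb]
  | mul_ι c x v hv h =>
    rw [map_mul, tensorAction_ι, 𝒱.twist_mul_ι s (𝒱.smul_mem k hv), h, 𝒱.twist_mul_ι s hv, map_mul,
      tensorAction_ι, hs, tensorAction_mul_apply, tensorAction_mul_apply, inv_mul_cancel_right]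

theorem twist_twist {s t : G → G} (hs : ∀ k x, s (k * x * k⁻¹) = k * s x * k⁻¹)
    (hst : ∀ x, s x * t x = 1) (c : TensorAlgebra ℂ V) : 𝒱.twist s (𝒱.twist t c) = c := by
  induction c using 𝒱.right_induction with
  | one => simp
  | smul r a h => simp [h]
  | add a b ha hb => simp only [map_add, ha, hb]
  | mul_ι c x v hv h =>
    rw [𝒱.twist_mul_ι t hv, 𝒱.twist_mul_ι s hv, 𝒱.twist_tensorAction hs, h, tensorAction_mul_apply,
      hst, tensorAction_one_apply]

theorem tensorAug_twist (s : G → G) (c : TensorAlgebra ℂ V) :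
    tensorAug (𝒱.twist s c) = tensorAug c := by
  induction c using 𝒱.right_induction with
  | one => simp
  | smul r a h => simp [h]
  | add a b ha hb => simp only [map_add, ha, hb]
  | mul_ι c x v hv h => simp [𝒱.twist_mul_ι s hv]

/-- The linear automorphism `θ` of `T(V)` with `θ(c v) = (x⁻¹ ▷ θ(c)) v` for `v ∈ V_x`. -/
abbrev untwist : TensorAlgebra ℂ V →ₗ[ℂ] TensorAlgebra ℂ V := 𝒱.twist fun x => x⁻¹

theorem twist_untwist (c : TensorAlgebra ℂ V) : 𝒱.twist id (𝒱.untwist c) = c :=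
  𝒱.twist_twist (by simp) (by simp) c

theorem untwist_twist (c : TensorAlgebra ℂ V) : 𝒱.untwist (𝒱.twist id c) = c :=
  𝒱.twist_twist (by intro k x; group) (by simp) c

/-- The derivation `leftDer`, transported by `untwist`. -/
def twistedDer (g : G) (f : Module.Dual ℂ V) : TensorAlgebra ℂ V →ₗ[ℂ] TensorAlgebra ℂ V :=
  𝒱.twist id ∘ₗ 𝒱.leftDer g f ∘ₗ 𝒱.untwist

@[simp] theorem twistedDer_one (g : G) (f : Module.Dual ℂ V) : 𝒱.twistedDer g f 1 = 0 := by
  simp [twistedDer]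

theorem untwist_twistedDer (g : G) (f : Module.Dual ℂ V) (c : TensorAlgebra ℂ V) :
    𝒱.untwist (𝒱.twistedDer g f c) = 𝒱.leftDer g f (𝒱.untwist c) :=
  𝒱.untwist_twist _

theorem twist_leftDer (g : G) (f : Module.Dual ℂ V) (c : TensorAlgebra ℂ V) :
    𝒱.twist id (𝒱.leftDer g f c) = 𝒱.twistedDer g f (𝒱.twist id c) := by
  rw [twistedDer, LinearMap.comp_apply, LinearMap.comp_apply, 𝒱.untwist_twist]

/-- After conjugation by the twist, `leftDer` becomes a right derivation for the inverse braiding: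
in passing `v` it is the functional that is moved by `x`, while `v` itself stays unchanged. In
`rightDer` the letter `v` is moved instead. -/
theorem twistedDer_mul_ι {g : G} {f : Module.Dual ℂ V} (hf : f ∈ 𝒱.dualGrading g⁻¹) {x : G} {v : V}
    (hv : v ∈ 𝒱.grading x) (c : TensorAlgebra ℂ V) :
    𝒱.twistedDer g f (c * ι ℂ v) =
      𝒱.twistedDer (x * g * x⁻¹) (𝒱.ρ.dual x f) c * ι ℂ v + f v • c := by
  have e₁ : 𝒱.leftDer g f (tensorAction 𝒱.ρ x⁻¹ (𝒱.untwist c)) =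
      tensorAction 𝒱.ρ x⁻¹ (𝒱.leftDer (x * g * x⁻¹) (𝒱.ρ.dual x f) (𝒱.untwist c)) := by
    rw [leftDer, leftDer, tensorAction_skewDer, dual_mul_apply, inv_mul_cancel, map_one 𝒱.ρ.dual,
      Module.End.one_apply]
    congr 3 <;> group
  -- If `f v ≠ 0` then `x = g`, and the factor `g` from the Leibniz rule cancels the `x⁻¹` from
  -- `untwist`.
  have e₂ : f v • tensorAction 𝒱.ρ g (tensorAction 𝒱.ρ x⁻¹ (𝒱.untwist c)) =
      f v • 𝒱.untwist c := by
    by_cases e : f v = 0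
    · simp [e]
    · rw [𝒱.eq_of_apply_ne_zero hf hv e, tensorAction_mul_apply, mul_inv_cancel,
        tensorAction_one_apply]
  rw [twistedDer, LinearMap.comp_apply, LinearMap.comp_apply, 𝒱.twist_mul_ι _ hv, leftDer_mul_ι, e₁,
    e₂, map_add, 𝒱.twist_mul_ι _ hv, 𝒱.twist_tensorAction (by simp), tensorAction_mul_apply, id,
    mul_inv_cancel, tensorAction_one_apply, map_smul, twist_untwist]
  rfl

/-- Both recursions differ only in terms ending in a letter, which the augmentation kills; the
remaining term is `f v • c` in both. -/
theorem tensorAug_twistedDer {g : G} {f : Module.Dual ℂ V} (hf : f ∈ 𝒱.dualGrading g⁻¹)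
    (c : TensorAlgebra ℂ V) :
    tensorAug (𝒱.twistedDer g f c) = tensorAug (𝒱.rightDer g f c) := by
  induction c using 𝒱.right_induction with
  | one => simp
  | smul r a h => simp [h]
  | add a b ha hb => simp only [map_add, ha, hb]
  | mul_ι c x v hv h =>
    rw [𝒱.twistedDer_mul_ι hf hv, rightDer_mul_ι]
    simp

/-- The crucial commutation. On `c v` both sides consist of a term where both functionals act inside
`c` and two terms where one of them consumes `v`. These match because `rightDer` moves the later
letters and their degrees by `k`, in step with the conjugated index of the other derivation. -/
theorem twistedDer_rightDer {g k : G} {e f : Module.Dual ℂ V} (hf : f ∈ 𝒱.dualGrading g⁻¹)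
    (he : e ∈ 𝒱.dualGrading k⁻¹) (c : TensorAlgebra ℂ V) :
    𝒱.rightDer k e (𝒱.twistedDer g f c) =
      𝒱.twistedDer (k * g * k⁻¹) (𝒱.ρ.dual k f) (𝒱.rightDer k e c) := by
  induction c using 𝒱.right_induction generalizing g f with
  | one => simp
  | smul r a h => simp [h hf]
  | add a b ha hb => simp only [map_add, ha hf, hb hf]
  | mul_ι c x v hv h =>
    have hkf := 𝒱.dual_smul_mem_inv k hf
    rw [𝒱.twistedDer_mul_ι hf hv, map_add, rightDer_mul_ι, map_smul,
      h (𝒱.dual_smul_mem_inv x hf), rightDer_mul_ι, map_add,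
      𝒱.twistedDer_mul_ι hkf (𝒱.smul_mem k hv), dual_apply_smul, map_smul, dual_mul_apply,
      dual_mul_apply, inv_mul_cancel_right, add_assoc, add_assoc]
    have e₁ : k * x * k⁻¹ * (k * g * k⁻¹) * (k * x * k⁻¹)⁻¹ = k * (x * g * x⁻¹) * k⁻¹ := by group
    -- Here `e` consumes `v`, which forces `x = k`: conjugation by the degree of `v` and conjugation
    -- by `k` agree.
    have e₂ : e v • 𝒱.twistedDer (x * g * x⁻¹) (𝒱.ρ.dual x f) c =
        e v • 𝒱.twistedDer (k * g * k⁻¹) (𝒱.ρ.dual k f) c := by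
      by_cases e0 : e v = 0
      · simp [e0]
      · rw [𝒱.eq_of_apply_ne_zero he hv e0]
    rw [e₁, e₂, add_comm (e v • _)]

/-- The derivatives of core elements under all `twistedDer` form a family that right derivations
preserve, by `twistedDer_rightDer`, and whose augmentation vanishes, by `tensorAug_twistedDer`. -/
theorem twistedDer_mem_rightCore {g : G} {f : Module.Dual ℂ V} (hf : f ∈ 𝒱.dualGrading g⁻¹)
    {c : TensorAlgebra ℂ V} (hc : c ∈ 𝒱.rightCore) : 𝒱.twistedDer g f c ∈ 𝒱.rightCore := by
  refine mem_rightCore_of_span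
    (s := {x | ∃ g, ∃ f ∈ 𝒱.dualGrading g⁻¹, ∃ c ∈ 𝒱.rightCore, x = 𝒱.twistedDer g f c}) ?_ ?_
    ⟨g, f, hf, c, hc, rfl⟩
  · rintro _ ⟨g, f, hf, c, hc, rfl⟩
    rw [𝒱.tensorAug_twistedDer hf, tensorAug_of_mem_stableCore (rightDer_mem hf hc)]
  · rintro k e he _ ⟨g, f, hf, c, hc, rfl⟩
    exact Submodule.subset_span
      ⟨_, _, 𝒱.dual_smul_mem_inv k hf, _, rightDer_mem he hc, 𝒱.twistedDer_rightDer hf he c⟩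

theorem untwist_mem_leftCore {c : TensorAlgebra ℂ V} (hc : c ∈ 𝒱.rightCore) :
    𝒱.untwist c ∈ 𝒱.leftCore := by
  refine mem_leftCore_of_span (s := {x | ∃ c ∈ 𝒱.rightCore, x = 𝒱.untwist c}) ?_ ?_ ⟨c, hc, rfl⟩
  · rintro _ ⟨c, hc, rfl⟩
    rw [tensorAug_twist, tensorAug_of_mem_stableCore hc]
  · rintro g f hf _ ⟨c, hc, rfl⟩
    exact Submodule.subset_span
      ⟨_, 𝒱.twistedDer_mem_rightCore hf hc, (𝒱.untwist_twistedDer g f c).symm⟩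

/-- The mirror image of `twistedDer_mem_rightCore`: the right derivations, transported to the left
side, commute with `leftDer` up to conjugation and so preserve `leftCore`. -/
theorem rightDer_twist_mem {k : G} {e : Module.Dual ℂ V} (he : e ∈ 𝒱.dualGrading k⁻¹)
    {c : TensorAlgebra ℂ V} (hc : c ∈ 𝒱.leftCore) :
    𝒱.untwist (𝒱.rightDer k e (𝒱.twist id c)) ∈ 𝒱.leftCore := by
  refine mem_leftCore_of_span (s := {x | ∃ k, ∃ e ∈ 𝒱.dualGrading k⁻¹, ∃ c ∈ 𝒱.leftCore,
    x = 𝒱.untwist (𝒱.rightDer k e (𝒱.twist id c))}) ?_ ?_ ⟨k, e, he, c, hc, rfl⟩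
  · rintro _ ⟨k, e, he, c, hc, rfl⟩
    rw [tensorAug_twist, ← 𝒱.tensorAug_twistedDer he, ← twist_leftDer, tensorAug_twist,
      tensorAug_of_mem_stableCore (leftDer_mem he hc)]
  · rintro g f hf _ ⟨k, e, he, c, hc, rfl⟩
    refine Submodule.subset_span ⟨k, e, he, 𝒱.leftDer (k⁻¹ * g * k⁻¹⁻¹) (𝒱.ρ.dual k⁻¹ f) c,
      leftDer_mem (𝒱.dual_smul_mem_inv k⁻¹ hf) hc, ?_⟩
    rw [twist_leftDer, 𝒱.twistedDer_rightDer (𝒱.dual_smul_mem_inv k⁻¹ hf) he, untwist_twistedDer,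
      dual_mul_apply, mul_inv_cancel, map_one, Module.End.one_apply]
    congr 2
    group

theorem twist_mem_rightCore {c : TensorAlgebra ℂ V} (hc : c ∈ 𝒱.leftCore) :
    𝒱.twist id c ∈ 𝒱.rightCore := by
  refine mem_rightCore_of_span (s := {x | ∃ c ∈ 𝒱.leftCore, x = 𝒱.twist id c}) ?_ ?_ ⟨c, hc, rfl⟩
  · rintro _ ⟨c, hc, rfl⟩
    rw [tensorAug_twist, tensorAug_of_mem_stableCore hc]
  · rintro k e he _ ⟨c, hc, rfl⟩
    exact Submodule.subset_span ⟨_, 𝒱.rightDer_twist_mem he hc, (𝒱.twist_untwist _).symm⟩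

end YetterDrinfeld
end

noncomputable section
/-! ### The kernel of the braided factorials as the largest stable subspace -/

section TensorPowers

open TensorAlgebra

variable {V : Type*} [AddCommGroup V] [Module ℂ V]

theorem toTensorAlgebra_injective (n : ℕ) :
    Function.Injective (TensorPower.toTensorAlgebra : (⨂[ℂ]^n V) →ₗ[ℂ] TensorAlgebra ℂ V) := by
  intro s t h
  have key : ∀ t : ⨂[ℂ]^n V, TensorAlgebra.ofDirectSum (DirectSum.of (fun n => ⨂[ℂ]^n V) n t) =
      TensorPower.toTensorAlgebra t := fun t =>
    DirectSum.toAddMonoid_of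
      (fun _ => LinearMap.toAddMonoidHom TensorPower.toTensorAlgebra) _ _
  rw [← key, ← key] at h
  exact DirectSum.of_injective (β := fun n => ⨂[ℂ]^n V) n
    ((TensorAlgebra.equivDirectSum (R := ℂ) (M := V)).symm.injective h)

theorem toTensorAlgebra_tensorSucc (n : ℕ) (a : ⨂[ℂ]^n V) (v : V) :
    TensorPower.toTensorAlgebra (tensorSucc V n (a ⊗ₜ v)) =
      TensorPower.toTensorAlgebra a * ι ℂ v := by
  rw [tensorSucc, LinearEquiv.trans_apply, TensorProduct.congr_tmul,
    PiTensorProduct.subsingletonEquiv_symm_apply', LinearEquiv.refl_apply, ← TensorPower.gMul_def,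
    TensorPower.toTensorAlgebra_gMul, TensorPower.toTensorAlgebra_tprod]
  simp [TensorAlgebra.tprod_apply]

theorem toTensorAlgebra_zero (a : ⨂[ℂ]^0 V) :
    ∃ r : ℂ, algebraMap ℂ (TensorAlgebra ℂ V) r = TensorPower.toTensorAlgebra a := by
  induction a using PiTensorProduct.induction_on with
  | smul_tprod r a =>
    refine ⟨r, ?_⟩
    rw [map_smul, TensorPower.toTensorAlgebra_tprod, TensorAlgebra.tprod_apply,
      Algebra.algebraMap_eq_smul_one]
    simp
  | add a b ha hb =>
    obtain ⟨r, hr⟩ := ha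
    obtain ⟨s, hs⟩ := hb
    exact ⟨r + s, by rw [map_add, map_add, hr, hs]⟩

/-- Every tensor of positive degree is a sum of tensors `a ⊗ v`. -/
theorem tensorSucc_induction {n : ℕ} {C : (⨂[ℂ]^(n + 1) V) → Prop}
    (tmul : ∀ a v, C (tensorSucc V n (a ⊗ₜ v))) (add : ∀ s t, C s → C t → C (s + t))
    (t : ⨂[ℂ]^(n + 1) V) : C t := by
  obtain ⟨z, rfl⟩ := (tensorSucc V n).surjective t
  induction z with
  | zero => simpa using tmul 0 0
  | tmul a v => exact tmul a v
  | add a b ha hb => rw [map_add]; exact add _ _ ha hb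

theorem mem_range_toTensorAlgebra {n : ℕ} {c : TensorAlgebra ℂ V}
    (hc : c ∈ LinearMap.range (ι ℂ (M := V)) ^ n) :
    ∃ t : ⨂[ℂ]^n V, TensorPower.toTensorAlgebra t = c := by
  induction n generalizing c with
  | zero =>
    rw [pow_zero, Submodule.mem_one] at hc
    obtain ⟨r, rfl⟩ := hc
    exact ⟨_, TensorPower.toTensorAlgebra_galgebra_toFun r⟩
  | succ n ih =>
    rw [pow_succ] at hc
    induction hc using Submodule.mul_induction_on' with
    | mem_mul_mem a ha b hb =>
      obtain ⟨v, rfl⟩ := hb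
      obtain ⟨t, rfl⟩ := ih ha
      exact ⟨_, toTensorAlgebra_tensorSucc n t v⟩
    | add a _ b _ ha hb =>
      obtain ⟨s, rfl⟩ := ha
      obtain ⟨t, rfl⟩ := hb
      exact ⟨s + t, map_add _ _ _⟩

/-- The contraction `id ⊗ f` of the last tensor factor with a functional. -/
def contractLast (f : Module.Dual ℂ V) (n : ℕ) : (⨂[ℂ]^(n + 1) V) →ₗ[ℂ] (⨂[ℂ]^n V) :=
  (TensorProduct.rid ℂ _).toLinearMap ∘ₗ f.lTensor _ ∘ₗ (tensorSucc V n).symm.toLinearMap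

@[simp] theorem contractLast_tensorSucc (f : Module.Dual ℂ V) (n : ℕ) (a : ⨂[ℂ]^n V) (v : V) :
    contractLast f n (tensorSucc V n (a ⊗ₜ v)) = f v • a := by
  simp [contractLast]

@[simp] theorem tensorId_tensorSucc {n : ℕ} (F : (⨂[ℂ]^n V) →ₗ[ℂ] (⨂[ℂ]^n V)) (a : ⨂[ℂ]^n V)
    (v : V) : tensorId F (tensorSucc V n (a ⊗ₜ v)) = tensorSucc V n (F a ⊗ₜ v) := by
  simp [tensorId, LinearEquiv.conj_apply]

theorem contractLast_tensorId (f : Module.Dual ℂ V) {n : ℕ} (F : (⨂[ℂ]^n V) →ₗ[ℂ] (⨂[ℂ]^n V))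
    (t : ⨂[ℂ]^(n + 1) V) : contractLast f n (tensorId F t) = F (contractLast f n t) := by
  induction t using tensorSucc_induction with
  | tmul a v => simp
  | add s t hs ht => simp only [map_add, hs, ht]

/-- The coordinates of `t` with respect to a basis of the last factor are its contractions with the
coordinate functionals. -/
theorem eq_zero_of_contractLast {n : ℕ} {t : ⨂[ℂ]^(n + 1) V}
    (h : ∀ f : Module.Dual ℂ V, contractLast f n t = 0) : t = 0 := by
  classical
  have b := Module.Basis.ofVectorSpace ℂ V
  refine (tensorSucc V n).symm.injective
    ((TensorProduct.equivFinsuppOfBasisRight (M := ⨂[ℂ]^n V) b).injective ?_)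
  rw [map_zero, map_zero]
  ext1 i
  rw [TensorProduct.equivFinsuppOfBasisRight_apply]
  exact h (b.coord i)

theorem lastLeg_tensorSucc (Ψ : V ⊗[ℂ] V →ₗ[ℂ] V ⊗[ℂ] V) (n : ℕ) (a : ⨂[ℂ]^n V) (v w : V) :
    lastLeg Ψ n (tensorSucc V (n + 1) (tensorSucc V n (a ⊗ₜ v) ⊗ₜ w)) =
      (((TensorProduct.assoc ℂ (⨂[ℂ]^n V) V V).symm.trans
        (TensorProduct.congr (tensorSucc V n) (LinearEquiv.refl ℂ V))).trans
        (tensorSucc V (n + 1))) (a ⊗ₜ Ψ (v ⊗ₜ w)) := by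
  set e := (((TensorProduct.assoc ℂ (⨂[ℂ]^n V) V V).symm.trans
        (TensorProduct.congr (tensorSucc V n) (LinearEquiv.refl ℂ V))).trans
        (tensorSucc V (n + 1))) with he
  have : tensorSucc V (n + 1) (tensorSucc V n (a ⊗ₜ v) ⊗ₜ w) = e (a ⊗ₜ (v ⊗ₜ w)) := by
    simp [he]
  rw [this, lastLeg, ← he, LinearEquiv.conj_apply]
  simp

end TensorPowers

namespace YetterDrinfeld

open TensorAlgebra

variable {G : Type*} [Group G] {V : Type*} [AddCommGroup V] [Module ℂ V]
variable (𝒱 : YetterDrinfeld G V)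

/-- The braiding turns `v ⊗ w` into `(x ▷ w) ⊗ v` for `v ∈ V_x`, so contracting the last factor
evaluates `f` on `v`; only `x = g` contributes. -/
theorem contractLast_lastLeg {g : G} {f : Module.Dual ℂ V} (hf : f ∈ 𝒱.dualGrading g⁻¹) (n : ℕ)
    (t : ⨂[ℂ]^(n + 1) V) (w : V) :
    contractLast f (n + 1) (lastLeg 𝒱.braiding n (tensorSucc V (n + 1) (t ⊗ₜ w))) =
      tensorSucc V n (contractLast f n t ⊗ₜ 𝒱.ρ g w) := by
  induction t using tensorSucc_induction with
  | add s t hs ht => simp only [TensorProduct.add_tmul, map_add, hs, ht]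
  | tmul a v =>
    induction v using 𝒱.grading_induction with
    | zero => simp
    | add v v' hv hv' => simp only [TensorProduct.tmul_add, TensorProduct.add_tmul, map_add, hv, hv']
    | mem x v hv =>
      rw [lastLeg_tensorSucc, 𝒱.braiding_tmul hv]
      simp only [LinearEquiv.trans_apply, TensorProduct.assoc_symm_tmul, TensorProduct.congr_tmul,
        LinearEquiv.refl_apply, contractLast_tensorSucc]
      rw [← TensorProduct.smul_tmul', map_smul]
      by_cases e : f v = 0
      · simp [e]
      · rw [𝒱.eq_of_apply_ne_zero hf hv e]

/-- The two recursions coincide. In `[n+2] = id + Ψ_{n+1,n+2} ([n+1] ⊗ id)` applied to `a ⊗ v`, the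
identity contributes `f(v) a`, and the second summand contributes `∂(a) (g ▷ v)` by
`contractLast_lastLeg`. -/
theorem rightDer_toTensorAlgebra {g : G} {f : Module.Dual ℂ V} (hf : f ∈ 𝒱.dualGrading g⁻¹)
    (n : ℕ) (t : ⨂[ℂ]^(n + 1) V) :
    𝒱.rightDer g f (TensorPower.toTensorAlgebra t) =
      TensorPower.toTensorAlgebra (contractLast f n (braidedInteger 𝒱.braiding (n + 1) t)) := by
  induction n with
  | zero =>
    induction t using tensorSucc_induction with
    | add s t hs ht => simp only [map_add, hs, ht]
    | tmul a v =>
      obtain ⟨r, hr⟩ := toTensorAlgebra_zero a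
      simp only [braidedInteger, LinearMap.id_apply, contractLast_tensorSucc]
      rw [toTensorAlgebra_tensorSucc, rightDer_mul_ι, ← hr, Algebra.algebraMap_eq_smul_one,
        map_smul, skewDer_one, map_smul, ← hr, Algebra.algebraMap_eq_smul_one]
      simp
  | succ n ih =>
    induction t using tensorSucc_induction with
    | add s t hs ht => simp only [map_add, hs, ht]
    | tmul a v =>
      rw [toTensorAlgebra_tensorSucc, rightDer_mul_ι, ih, braidedInteger, LinearMap.add_apply,
        LinearMap.comp_apply, LinearMap.id_apply, tensorId_tensorSucc, map_add,
        𝒱.contractLast_lastLeg hf, contractLast_tensorSucc, map_add, toTensorAlgebra_tensorSucc,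
        map_smul, add_comm]

/-- Contraction of the last factor commutes with `[n]! ⊗ id`, and contractions with homogeneous
functionals suffice to detect zero because these span the dual of a finite-dimensional space. -/
theorem braidedFactorial_succ_eq_zero_iff [FiniteDimensional ℂ V] (n : ℕ) (t : ⨂[ℂ]^(n + 1) V) :
    braidedFactorial 𝒱.braiding (n + 1) t = 0 ↔ ∀ g, ∀ f ∈ 𝒱.dualGrading g⁻¹,
      braidedFactorial 𝒱.braiding n
        (contractLast f n (braidedInteger 𝒱.braiding (n + 1) t)) = 0 := by
  simp only [← contractLast_tensorId]
  rw [braidedFactorial, LinearMap.comp_apply]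
  refine ⟨fun h g f _ => by rw [h, map_zero], fun h => eq_zero_of_contractLast fun f => ?_⟩
  induction f using 𝒱.dual.grading_induction with
  | zero => simp [contractLast]
  | add f e hf he =>
    have : contractLast (f + e) n = contractLast f n + contractLast e n := by
      ext; simp [contractLast, LinearMap.lTensor_add]
    rw [this, LinearMap.add_apply, hf, he, add_zero]
  | mem g f hf => exact h g⁻¹ f (by rw [inv_inv]; exact hf)

/-- The kernel is stable under the right derivations, so it lies in the core by maximality.
Conversely the core is graded, and a homogeneous element of it is killed by the factorial by
induction on the degree, as all its derivatives are. -/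
theorem woronowiczKernel_eq_rightCore [FiniteDimensional ℂ V] :
    woronowiczKernel 𝒱.braiding = 𝒱.rightCore := by
  apply le_antisymm
  · intro c hc
    refine mem_rightCore_of_span (s := woronowiczKernel 𝒱.braiding) (fun c hc => ?_)
      (fun g f hf c hc => ?_) hc
    · have : woronowiczKernel 𝒱.braiding ≤ LinearMap.ker (tensorAug (V := V)).toLinearMap := by
        refine iSup_le ?_
        -- In degree 0 the factorial is the identity and its kernel is zero; in positive degree the
        -- augmentation vanishes.
        rintro (_ | n) _ ⟨t, ht, rfl⟩
        · have ht' : t = 0 := ht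
          simp [ht']
        · clear ht
          rw [LinearMap.mem_ker]
          induction t using tensorSucc_induction with
          | add s t hs ht => simp only [map_add, hs, ht, add_zero]
          | tmul a v => rw [toTensorAlgebra_tensorSucc]; simp
      exact this hc
    · rw [Submodule.span_eq]
      have : woronowiczKernel 𝒱.braiding ≤
          (woronowiczKernel 𝒱.braiding).comap (𝒱.rightDer g f) := by
        refine iSup_le ?_
        rintro (_ | n) _ ⟨t, ht, rfl⟩
        · have ht' : t = 0 := ht
          simp [ht']
        · rw [Submodule.mem_comap, 𝒱.rightDer_toTensorAlgebra hf]
          refine Submodule.mem_iSup_of_mem n ⟨_, ?_, rfl⟩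
          exact (𝒱.braidedFactorial_succ_eq_zero_iff n t).1 ht g f hf
      exact this hc
  · have key : ∀ n, ∀ t : ⨂[ℂ]^n V, TensorPower.toTensorAlgebra t ∈ 𝒱.rightCore →
        braidedFactorial 𝒱.braiding n t = 0 := by
      intro n
      induction n with
      | zero =>
        intro t ht
        obtain ⟨r, hr⟩ := toTensorAlgebra_zero t
        have h₁ := tensorAug_of_mem_stableCore ht
        rw [← hr, AlgHom.commutes, Algebra.algebraMap_self_apply] at h₁
        rw [h₁, map_zero] at hr
        exact toTensorAlgebra_injective 0 (by rw [braidedFactorial, LinearMap.id_apply, ← hr, map_zero])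
      | succ n ih =>
        intro t ht
        rw [𝒱.braidedFactorial_succ_eq_zero_iff]
        intro g f hf
        refine ih _ ?_
        rw [← 𝒱.rightDer_toTensorAlgebra hf]
        exact rightDer_mem hf ht
    intro c hc
    refine mem_of_tensorProj_mem fun n => ?_
    obtain ⟨t, ht⟩ := mem_range_toTensorAlgebra (tensorProj_mem n c)
    rw [← ht]
    refine Submodule.mem_iSup_of_mem n ⟨t, key n t ?_, rfl⟩
    rw [ht]
    exact tensorProj_mem_stableCore n hc

end YetterDrinfeld
end

noncomputable section
/-! ### Universal properties of semidirect products and of braided doubles -/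

section SmashLift

variable {G : Type*} [Group G] {A B : Type*} [Ring A] [Algebra ℂ A] [Ring B] [Algebra ℂ B]
variable {α : G →* (A →ₐ[ℂ] A)}

/-- The algebra map `A ⋊ G → B` given by a covariant pair of maps `A → B` and `G → B`. -/
def Smash.lift (a : A →ₐ[ℂ] B) (u : G →* B) (h : ∀ g x, a (α g x) * u g = u g * a x) :
    Smash α →ₐ[ℂ] B :=
  SkewMonoidAlgebra.liftNCAlgHom (A := Acted α) (show Acted α →ₐ[ℂ] B from a) u
    (fun {x y} => h y x)

variable (a : A →ₐ[ℂ] B) (u : G →* B) (h : ∀ g x, a (α g x) * u g = u g * a x)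

@[simp] theorem Smash.lift_ofAlg (x : A) : Smash.lift a u h (Smash.ofAlg α x) = a x := by
  change SkewMonoidAlgebra.liftNC _ _ (SkewMonoidAlgebra.single _ _) = _
  rw [SkewMonoidAlgebra.liftNC_single, map_one, mul_one]
  rfl

@[simp] theorem Smash.lift_ofGroup (g : G) : Smash.lift a u h (Smash.ofGroup α g) = u g := by
  change SkewMonoidAlgebra.liftNC _ _ (SkewMonoidAlgebra.single g 1) = _
  rw [SkewMonoidAlgebra.liftNC_single]
  change a 1 * u g = u g
  rw [map_one, one_mul]

theorem Smash.ofAlg_mul_ofGroup (x : A) (g : G) :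
    Smash.ofAlg α x * Smash.ofGroup α g = SkewMonoidAlgebra.single g (show Acted α from x) := by
  change SkewMonoidAlgebra.single 1 (show Acted α from x) * SkewMonoidAlgebra.single g 1 = _
  rw [SkewMonoidAlgebra.single_mul_single, one_mul, smul_one, mul_one]

theorem Smash.ofGroup_mul_ofAlg (g : G) (x : A) :
    Smash.ofGroup α g * Smash.ofAlg α x = Smash.ofAlg α (α g x) * Smash.ofGroup α g := by
  rw [Smash.ofAlg_mul_ofGroup]
  change SkewMonoidAlgebra.single g 1 * SkewMonoidAlgebra.single 1 (show Acted α from x) = _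
  rw [SkewMonoidAlgebra.single_mul_single, one_mul, mul_one]
  rfl

theorem Smash.hom_ext {F F' : Smash α →ₐ[ℂ] B}
    (h₁ : ∀ x, F (Smash.ofAlg α x) = F' (Smash.ofAlg α x))
    (h₂ : ∀ g, F (Smash.ofGroup α g) = F' (Smash.ofGroup α g)) : F = F' := by
  refine AlgHom.ext fun s => ?_
  induction s using SkewMonoidAlgebra.induction_on' with
  | add s t hs ht => rw [map_add, map_add, hs, ht]
  | single g x =>
    have key : ∀ y : A, F (SkewMonoidAlgebra.single g (show Acted α from y)) =
        F' (SkewMonoidAlgebra.single g (show Acted α from y)) := fun y => by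
      rw [← Smash.ofAlg_mul_ofGroup, map_mul, map_mul, h₁, h₂]
    exact key x

end SmashLift

theorem tensorAlgebra_lift_covariant {G V B : Type*} [Group G] [AddCommGroup V] [Module ℂ V]
    [Ring B] [Algebra ℂ B] {ρ : Representation ℂ G V} {i : V →ₗ[ℂ] B} {u : G →* B}
    (hi : ∀ g v, i (ρ g v) * u g = u g * i v) (g : G) (x : TensorAlgebra ℂ V) :
    TensorAlgebra.lift ℂ i (tensorAction ρ g x) * u g = u g * TensorAlgebra.lift ℂ i x := by
  induction x using TensorAlgebra.induction with
  | algebraMap r => simp only [AlgHom.commutes, Algebra.commutes]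
  | ι v => rw [tensorAction_ι, TensorAlgebra.lift_ι_apply, TensorAlgebra.lift_ι_apply, hi]
  | mul x y hx hy => rw [map_mul, map_mul, map_mul, mul_assoc, hy, ← mul_assoc, hx, mul_assoc]
  | add x y hx hy => rw [map_add, map_add, map_add, add_mul, hx, hy, mul_add]

namespace DoubleAlg

open TensorAlgebra

variable {G : Type*} [Group G]
variable {M P : Type*} [AddCommGroup M] [Module ℂ M] [AddCommGroup P] [Module ℂ P]
variable {ρM : Representation ℂ G M} {ρP : Representation ℂ G P}
variable {β : P →ₗ[ℂ] M →ₗ[ℂ] MonoidAlgebra ℂ G}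
variable {RM : Submodule ℂ (TensorAlgebra ℂ M)} {RP : Submodule ℂ (TensorAlgebra ℂ P)}
variable {B : Type*} [Ring B] [Algebra ℂ B]

section Lift

variable (i : M →ₗ[ℂ] B) (j : P →ₗ[ℂ] B) (u : G →* B)
  (hi : ∀ g v, i (ρM g v) * u g = u g * i v) (hj : ∀ g f, j (ρP g f) * u g = u g * j f)

/-- The algebra map `T(V⁻ ⊕ V⁺) ⋊ G → B` given by covariant linear maps `V⁻ → B`, `V⁺ → B`. -/
def freeLift : FreeSemidirect ρM ρP →ₐ[ℂ] B :=
  Smash.lift (TensorAlgebra.lift ℂ (i.coprod j)) u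
    (tensorAlgebra_lift_covariant (ρ := ρM.prod ρP) fun g p => by
      simp [LinearMap.coprod_apply, add_mul, mul_add, hi, hj])

theorem freeLift_ofMinus (b : TensorAlgebra ℂ M) :
    freeLift i j u hi hj (FreeSemidirect.ofMinus ρM ρP b) = TensorAlgebra.lift ℂ i b := by
  rw [FreeSemidirect.ofMinus, AlgHom.comp_apply, freeLift, Smash.lift_ofAlg, ← AlgHom.comp_apply]
  congr 1
  ext v
  simp

theorem freeLift_ofPlus (b : TensorAlgebra ℂ P) :
    freeLift i j u hi hj (FreeSemidirect.ofPlus ρM ρP b) = TensorAlgebra.lift ℂ j b := by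
  rw [FreeSemidirect.ofPlus, AlgHom.comp_apply, freeLift, Smash.lift_ofAlg, ← AlgHom.comp_apply]
  congr 1
  ext v
  simp

theorem freeLift_ofGroupAlg (s : MonoidAlgebra ℂ G) :
    freeLift i j u hi hj (Smash.ofGroupAlg _ s) = MonoidAlgebra.lift ℂ B G u s := by
  rw [Smash.ofGroupAlg, ← AlgHom.comp_apply]
  congr 1
  ext g
  simp [freeLift]

variable (hc : ∀ f v, j f * i v - i v * j f = MonoidAlgebra.lift ℂ B G u (β f v))
  (hM : ∀ r ∈ RM, TensorAlgebra.lift ℂ i r = 0) (hP : ∀ r ∈ RP, TensorAlgebra.lift ℂ j r = 0)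

/-- The universal property of `A_β(R⁻, R⁺)`. -/
def lift : DoubleAlg ρM ρP β RM RP →ₐ[ℂ] B :=
  RingQuot.liftAlgHom ℂ ⟨freeLift i j u hi hj, by
    intro a b h
    cases h with
    | minus r hr => rw [freeLift_ofMinus, hM r hr, map_zero]
    | plus r hr => rw [freeLift_ofPlus, hP r hr, map_zero]
    | comm f v =>
      rw [map_sub, map_mul, map_mul, freeLift_ofMinus, freeLift_ofPlus, freeLift_ofGroupAlg,
        lift_ι_apply, lift_ι_apply, hc]⟩

@[simp] theorem lift_ofMinus (b : TensorAlgebra ℂ M) :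
    lift i j u hi hj hc hM hP (ofMinus ρM ρP β RM RP b) = TensorAlgebra.lift ℂ i b := by
  rw [lift, ofMinus, AlgHom.comp_apply, RingQuot.liftAlgHom_mkAlgHom_apply, freeLift_ofMinus]

@[simp] theorem lift_ofPlus (b : TensorAlgebra ℂ P) :
    lift i j u hi hj hc hM hP (ofPlus ρM ρP β RM RP b) = TensorAlgebra.lift ℂ j b := by
  rw [lift, ofPlus, AlgHom.comp_apply, RingQuot.liftAlgHom_mkAlgHom_apply, freeLift_ofPlus]

@[simp] theorem lift_ofGroup (g : G) :
    lift i j u hi hj hc hM hP (ofGroup ρM ρP β RM RP g) = u g := by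
  change RingQuot.liftAlgHom ℂ _ (RingQuot.mkAlgHom ℂ _ _) = _
  rw [RingQuot.liftAlgHom_mkAlgHom_apply, freeLift, Smash.lift_ofGroup]

end Lift

theorem hom_ext {F F' : DoubleAlg ρM ρP β RM RP →ₐ[ℂ] B}
    (h₁ : ∀ v, F (ofMinus ρM ρP β RM RP (ι ℂ v)) = F' (ofMinus ρM ρP β RM RP (ι ℂ v)))
    (h₂ : ∀ f, F (ofPlus ρM ρP β RM RP (ι ℂ f)) = F' (ofPlus ρM ρP β RM RP (ι ℂ f)))
    (h₃ : ∀ g, F (ofGroup ρM ρP β RM RP g) = F' (ofGroup ρM ρP β RM RP g)) : F = F' := by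
  refine RingQuot.ringQuot_ext' _ _ _ (Smash.hom_ext (fun x => ?_) h₃)
  refine DFunLike.congr_fun (F := TensorAlgebra ℂ (M × P) →ₐ[ℂ] B)
    (f := (F.comp (RingQuot.mkAlgHom ℂ _)).comp (Smash.ofAlg _))
    (g := (F'.comp (RingQuot.mkAlgHom ℂ _)).comp (Smash.ofAlg _)) ?_ x
  ext v
  · have := h₁ v
    simp only [ofMinus, FreeSemidirect.ofMinus, AlgHom.comp_apply, tensorAlgebraMap_ι] at this
    exact this
  · have := h₂ v
    simp only [ofPlus, FreeSemidirect.ofPlus, AlgHom.comp_apply, tensorAlgebraMap_ι] at this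
    exact this

theorem ofMinus_eq_zero {r : TensorAlgebra ℂ M} (hr : r ∈ RM) :
    ofMinus ρM ρP β RM RP r = 0 := by
  have := RingQuot.mkAlgHom_rel ℂ (DoubleRel.minus (ρM := ρM) (ρP := ρP) (β := β) (RP := RP) r hr)
  rwa [map_zero] at this

theorem ofPlus_eq_zero {r : TensorAlgebra ℂ P} (hr : r ∈ RP) :
    ofPlus ρM ρP β RM RP r = 0 := by
  have := RingQuot.mkAlgHom_rel ℂ (DoubleRel.plus (ρM := ρM) (ρP := ρP) (β := β) (RM := RM) r hr)
  rwa [map_zero] at this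

theorem ofGroup_mul_ofMinus (g : G) (b : TensorAlgebra ℂ M) :
    ofGroup ρM ρP β RM RP g * ofMinus ρM ρP β RM RP b =
      ofMinus ρM ρP β RM RP (tensorAction ρM g b) * ofGroup ρM ρP β RM RP g := by
  have e : tensorAction (ρM.prod ρP) g (tensorAlgebraMap (LinearMap.inl ℂ M P) b) =
      tensorAlgebraMap (LinearMap.inl ℂ M P) (tensorAction ρM g b) := by
    rw [← AlgHom.comp_apply, ← AlgHom.comp_apply]
    congr 1
    ext v
    simp
  have := Smash.ofGroup_mul_ofAlg (α := tensorAction (ρM.prod ρP)) g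
    (tensorAlgebraMap (LinearMap.inl ℂ M P) b)
  rw [e] at this
  have := congrArg (RingQuot.mkAlgHom ℂ (DoubleRel ρM ρP β RM RP)) this
  rwa [map_mul, map_mul] at this

theorem ofGroup_mul_ofPlus (g : G) (b : TensorAlgebra ℂ P) :
    ofGroup ρM ρP β RM RP g * ofPlus ρM ρP β RM RP b =
      ofPlus ρM ρP β RM RP (tensorAction ρP g b) * ofGroup ρM ρP β RM RP g := by
  have e : tensorAction (ρM.prod ρP) g (tensorAlgebraMap (LinearMap.inr ℂ M P) b) =
      tensorAlgebraMap (LinearMap.inr ℂ M P) (tensorAction ρP g b) := by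
    rw [← AlgHom.comp_apply, ← AlgHom.comp_apply]
    congr 1
    ext v
    simp
  have := Smash.ofGroup_mul_ofAlg (α := tensorAction (ρM.prod ρP)) g
    (tensorAlgebraMap (LinearMap.inr ℂ M P) b)
  rw [e] at this
  have := congrArg (RingQuot.mkAlgHom ℂ (DoubleRel ρM ρP β RM RP)) this
  rwa [map_mul, map_mul] at this

theorem commutator (f : P) (v : M) :
    ofPlus ρM ρP β RM RP (ι ℂ f) * ofMinus ρM ρP β RM RP (ι ℂ v) -
        ofMinus ρM ρP β RM RP (ι ℂ v) * ofPlus ρM ρP β RM RP (ι ℂ f) =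
      MonoidAlgebra.lift ℂ _ G (ofGroup ρM ρP β RM RP) (β f v) := by
  have := RingQuot.mkAlgHom_rel ℂ (DoubleRel.comm (ρM := ρM) (ρP := ρP) (β := β) (RM := RM)
    (RP := RP) f v)
  rw [map_sub, map_mul, map_mul] at this
  refine this.trans ?_
  rw [Smash.ofGroupAlg, ← AlgHom.comp_apply]
  congr 1
  ext g
  simp [ofGroup]

end DoubleAlg
end

noncomputable section
/-! ### The maximal ideals of the braided Heisenberg double -/

theorem skewDer_add {V : Type*} [AddCommGroup V] [Module ℂ V]
    (α β : TensorAlgebra ℂ V →ₐ[ℂ] TensorAlgebra ℂ V) (e f : Module.Dual ℂ V) :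
    skewDer α β (e + f) = skewDer α β e + skewDer α β f := by
  refine LinearMap.ext fun c => ?_
  induction c using TensorAlgebra.right_induction with
  | one => simp
  | smul r a h => rw [map_smul, map_smul, h]
  | add a b ha hb => rw [map_add, map_add, ha, hb]
  | mul_ι a v h =>
    rw [skewDer_mul_ι, h, LinearMap.add_apply, LinearMap.add_apply, LinearMap.add_apply,
      skewDer_mul_ι, skewDer_mul_ι, add_mul, add_smul]
    abel

theorem skewDer_smul {V : Type*} [AddCommGroup V] [Module ℂ V]
    (α β : TensorAlgebra ℂ V →ₐ[ℂ] TensorAlgebra ℂ V) (r : ℂ) (f : Module.Dual ℂ V) :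
    skewDer α β (r • f) = r • skewDer α β f := by
  refine LinearMap.ext fun c => ?_
  induction c using TensorAlgebra.right_induction with
  | one => simp
  | smul r a h => rw [map_smul, map_smul, h]
  | add a b ha hb => rw [map_add, map_add, ha, hb]
  | mul_ι a v h =>
    rw [skewDer_mul_ι, h, LinearMap.smul_apply, LinearMap.smul_apply, LinearMap.smul_apply,
      skewDer_mul_ι, smul_mul_assoc, smul_add, smul_smul, smul_eq_mul]

/-- `skewDer` as a linear map in the functional. -/
def skewDerLin {V : Type*} [AddCommGroup V] [Module ℂ V]
    (α β : TensorAlgebra ℂ V →ₐ[ℂ] TensorAlgebra ℂ V) :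
    Module.Dual ℂ V →ₗ[ℂ] Module.End ℂ (TensorAlgebra ℂ V) where
  toFun := skewDer α β
  map_add' := skewDer_add α β
  map_smul' := skewDer_smul α β

theorem mul_sub_mul_eq_of_mul {B : Type*} [Ring B] {f a b p q : B} (ha : f * a - a * f = p)
    (hb : f * b - b * f = q) : f * (a * b) - a * b * f = p * b + a * q := by
  rw [← ha, ← hb]
  noncomm_ring

theorem mul_mul_sub_eq_of_mul {B : Type*} [Ring B] {v a b p q : B} (ha : a * v - v * a = p)
    (hb : b * v - v * b = q) : a * b * v - v * (a * b) = a * q + p * b := by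
  rw [← ha, ← hb]
  noncomm_ring

namespace YetterDrinfeld

open TensorAlgebra DoubleAlg

variable {G : Type*} [Group G] {Y : Type*} [AddCommGroup Y] [Module ℂ Y]
variable (𝒴 : YetterDrinfeld G Y)

theorem lift_beta {B : Type*} [Ring B] [Algebra ℂ B] (u : G →* B) {x : G} {v : Y}
    (hv : v ∈ 𝒴.grading x) (f : Module.Dual ℂ Y) :
    MonoidAlgebra.lift ℂ B G u (𝒴.beta f v) = f v • u x := by
  rw [beta_apply _ hv, MonoidAlgebra.lift_single]

variable [FiniteDimensional ℂ Y]

/-- The evaluation at `v ∈ Y_y`, as a functional on `Y*`, is supported on `(Y*)_{y⁻¹}`. -/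
theorem eval_mem_dualGrading {y : G} {v : Y} (hv : v ∈ 𝒴.grading y) :
    Module.Dual.eval ℂ Y v ∈ 𝒴.dual.dualGrading y := by
  intro h hh f hf
  refine hf y (fun e => hh ?_) v hv
  rw [e, inv_inv]

/-- By reflexivity a functional on `Y*` is evaluation at some `v`; being supported on one component,
it does not see the other components of `v`, so these vanish. -/
theorem exists_eval_eq {y : G} {e : Module.Dual ℂ (Module.Dual ℂ Y)}
    (he : e ∈ 𝒴.dual.dualGrading y) : ∃ v ∈ 𝒴.grading y, Module.Dual.eval ℂ Y v = e := by
  classical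
  obtain ⟨v, rfl⟩ := (Module.evalEquiv ℂ Y).surjective e
  refine ⟨v, ?_, rfl⟩
  -- The lifted map is the projection onto `Y_y`; homogeneous functionals cannot distinguish `v`
  -- from its projection.
  have key : 𝒴.gradedLift (fun x => if x = y then LinearMap.id else 0) v = v := by
    refine sub_eq_zero.1 ((Module.forall_dual_apply_eq_zero_iff ℂ _).1 fun f => ?_)
    induction f using 𝒴.dual.grading_induction with
    | zero => rfl
    | add f e hf he => rw [LinearMap.add_apply, hf, he, add_zero]
    | mem x f hf =>
      rw [map_sub]
      by_cases hx : x = y⁻¹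
      · subst hx
        have : f ∘ₗ 𝒴.gradedLift (fun x => if x = y then LinearMap.id else 0) = f := by
          refine 𝒴.hom_ext fun z w hw => ?_
          rw [LinearMap.comp_apply, 𝒴.gradedLift_of_mem _ hw]
          split_ifs with hz
          · rfl
          · rw [LinearMap.zero_apply, map_zero, hf z (by rwa [inv_inv]) w hw]
        rw [← LinearMap.comp_apply, this, sub_self]
      · have h₁ : f v = 0 := he x hx f hf
        have : f ∘ₗ 𝒴.gradedLift (fun x => if x = y then LinearMap.id else 0) = 0 := by
          refine 𝒴.hom_ext fun z w hw => ?_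
          rw [LinearMap.comp_apply, 𝒴.gradedLift_of_mem _ hw]
          split_ifs with hz
          · refine hf z (fun e => hx ?_) w hw
            rw [← hz, e, inv_inv]
          · rw [LinearMap.zero_apply, map_zero, LinearMap.zero_apply]
        rw [← LinearMap.comp_apply, this, h₁, LinearMap.zero_apply, sub_zero]
  rw [← key]
  have : ∀ w, 𝒴.gradedLift (fun x => if x = y then LinearMap.id else 0) w ∈ 𝒴.grading y := by
    intro w
    induction w using 𝒴.grading_induction with
    | zero => rw [map_zero]; exact zero_mem _
    | add a b ha hb => rw [map_add]; exact add_mem ha hb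
    | mem z w hw =>
      rw [𝒴.gradedLift_of_mem _ hw]
      split_ifs with hz
      · rw [← hz]; exact hw
      · exact zero_mem _
  exact this v

/-! ### Commutators in the double are braided derivations. -/

section Relations

variable {RM : Submodule ℂ (TensorAlgebra ℂ Y)} {RP : Submodule ℂ (TensorAlgebra ℂ (Module.Dual ℂ Y))}

theorem commutator_ι {x : G} {v : Y} (hv : v ∈ 𝒴.grading x) (f : Module.Dual ℂ Y) :
    ofPlus 𝒴.ρ 𝒴.dual.ρ 𝒴.beta RM RP (ι ℂ f) * ofMinus 𝒴.ρ 𝒴.dual.ρ 𝒴.beta RM RP (ι ℂ v) -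
        ofMinus 𝒴.ρ 𝒴.dual.ρ 𝒴.beta RM RP (ι ℂ v) * ofPlus 𝒴.ρ 𝒴.dual.ρ 𝒴.beta RM RP (ι ℂ f) =
      f v • ofGroup 𝒴.ρ 𝒴.dual.ρ 𝒴.beta RM RP x := by
  rw [DoubleAlg.commutator, lift_beta _ _ hv]

/-- The commutator with `f` is a derivation with value `f(v) g` on letters `v`. Collecting the group
element on the right moves it past the later letters, which is exactly the twist in `rightDer`. -/
theorem commutator_ofMinus {g : G} {f : Module.Dual ℂ Y} (hf : f ∈ 𝒴.dualGrading g⁻¹)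
    (b : TensorAlgebra ℂ Y) :
    ofPlus 𝒴.ρ 𝒴.dual.ρ 𝒴.beta RM RP (ι ℂ f) * ofMinus 𝒴.ρ 𝒴.dual.ρ 𝒴.beta RM RP b -
        ofMinus 𝒴.ρ 𝒴.dual.ρ 𝒴.beta RM RP b * ofPlus 𝒴.ρ 𝒴.dual.ρ 𝒴.beta RM RP (ι ℂ f) =
      ofMinus 𝒴.ρ 𝒴.dual.ρ 𝒴.beta RM RP (𝒴.rightDer g f b) *
        ofGroup 𝒴.ρ 𝒴.dual.ρ 𝒴.beta RM RP g := by
  induction b using 𝒴.right_induction with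
  | one => simp
  | smul r a h =>
    simp only [map_smul, mul_smul_comm, smul_mul_assoc, ← h]
    exact (smul_sub r _ _).symm
  | add a b ha hb => simp only [map_add, mul_add, add_mul, ← ha, ← hb]; abel
  | mul_ι c x v hv h =>
    have e : f v • ofGroup 𝒴.ρ 𝒴.dual.ρ 𝒴.beta RM RP x =
        f v • ofGroup 𝒴.ρ 𝒴.dual.ρ 𝒴.beta RM RP g := by
      by_cases e : f v = 0
      · simp [e]
      · rw [𝒴.eq_of_apply_ne_zero hf hv e]
    rw [map_mul, mul_sub_mul_eq_of_mul h (𝒴.commutator_ι hv f), e, rightDer_mul_ι, map_add, map_mul,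
      mul_assoc, ofGroup_mul_ofMinus, tensorAction_ι, ← mul_assoc, map_smul, add_mul,
      mul_smul_comm, smul_mul_assoc]

/-- Here the group element is collected on the left: `c y = y (y⁻¹ ▷ c)` makes the earlier letters
carry the twist, which gives `leftDer` with index `y⁻¹`. -/
theorem commutator_ofPlus {y : G} {v : Y} (hv : v ∈ 𝒴.grading y)
    (b : TensorAlgebra ℂ (Module.Dual ℂ Y)) :
    ofPlus 𝒴.ρ 𝒴.dual.ρ 𝒴.beta RM RP b * ofMinus 𝒴.ρ 𝒴.dual.ρ 𝒴.beta RM RP (ι ℂ v) -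
        ofMinus 𝒴.ρ 𝒴.dual.ρ 𝒴.beta RM RP (ι ℂ v) * ofPlus 𝒴.ρ 𝒴.dual.ρ 𝒴.beta RM RP b =
      ofGroup 𝒴.ρ 𝒴.dual.ρ 𝒴.beta RM RP y *
        ofPlus 𝒴.ρ 𝒴.dual.ρ 𝒴.beta RM RP (𝒴.dual.leftDer y⁻¹ (Module.Dual.eval ℂ Y v) b) := by
  induction b using TensorAlgebra.right_induction with
  | one => simp
  | smul r a h =>
    simp only [map_smul, mul_smul_comm, smul_mul_assoc, ← h]
    exact (smul_sub r _ _).symm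
  | add a b ha hb => simp only [map_add, mul_add, add_mul, ← ha, ← hb]; abel
  | mul_ι c f h =>
    have e : ofGroup 𝒴.ρ 𝒴.dual.ρ 𝒴.beta RM RP y *
        ofPlus 𝒴.ρ 𝒴.dual.ρ 𝒴.beta RM RP (tensorAction 𝒴.dual.ρ y⁻¹ c) =
          ofPlus 𝒴.ρ 𝒴.dual.ρ 𝒴.beta RM RP c * ofGroup 𝒴.ρ 𝒴.dual.ρ 𝒴.beta RM RP y := by
      rw [ofGroup_mul_ofPlus, tensorAction_mul_apply, mul_inv_cancel, tensorAction_one_apply]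
    rw [map_mul, mul_mul_sub_eq_of_mul h (𝒴.commutator_ι hv f), leftDer_mul_ι, map_add, map_mul,
      map_smul, mul_add, mul_smul_comm, mul_smul_comm, e, mul_assoc, add_comm]
    rfl

end Relations

/-! ### The ideal `I_β⁻` is the Nichols ideal of `Y`. -/

section Minus

/-- The action of `A_β(0,0)` on `T(Y)`, where `Y*` acts by braided derivations. -/
def minusModule : DoubleAlg 𝒴.ρ 𝒴.dual.ρ 𝒴.beta ⊥ ⊥ →ₐ[ℂ] Module.End ℂ (TensorAlgebra ℂ Y) :=
  DoubleAlg.lift (LinearMap.mul ℂ _ ∘ₗ ι ℂ)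
    -- A functional in `(Y*)_x` is supported on `Y_{x⁻¹}`, so it acts by `rightDer` with index
    -- `x⁻¹`.
    (𝒴.dual.gradedLift fun x => skewDerLin (tensorAction 𝒴.ρ 1) (tensorAction 𝒴.ρ x⁻¹))
    { toFun := fun g => (tensorAction 𝒴.ρ g).toLinearMap
      map_one' := by rw [map_one]; rfl
      map_mul' := fun g h => by rw [map_mul]; rfl }
    (by
      intro g v
      refine LinearMap.ext fun c => ?_
      simp)
    (by
      intro g f
      induction f using 𝒴.dual.grading_induction with
      | zero => simp
      | add f e hf he => simp only [map_add, add_mul, mul_add, hf, he]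
      | mem x f hf =>
        rw [𝒴.dual.gradedLift_of_mem _ hf, 𝒴.dual.gradedLift_of_mem _ (𝒴.dual.smul_mem g hf)]
        refine LinearMap.ext fun c => ?_
        refine Eq.trans ?_ (tensorAction_skewDer _ _ _ _ _ _).symm
        rw [mul_one, mul_inv_cancel, show g * x⁻¹ * g⁻¹ = (g * x * g⁻¹)⁻¹ by group]
        rfl)
    (by
      intro f v
      induction v using 𝒴.grading_induction with
      | zero => simp
      | add v w hv hw => simp only [map_add, add_mul, mul_add, ← hv, ← hw]; abel
      | mem y v hv =>
        rw [𝒴.lift_beta _ hv]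
        induction f using 𝒴.dual.grading_induction with
        | zero => simp
        | add f e hf he =>
          simp only [map_add, add_mul, mul_add, LinearMap.add_apply, add_smul, ← hf, ← he]; abel
        | mem x f hf =>
          rw [𝒴.dual.gradedLift_of_mem _ hf]
          have hf' : f ∈ 𝒴.dualGrading x⁻¹⁻¹ := by rw [inv_inv]; exact hf
          refine LinearMap.ext fun c => ?_
          change skewDer _ _ f (ι ℂ v * c) - ι ℂ v * skewDer _ _ f c = f v • tensorAction 𝒴.ρ y c
          rw [skewDer_ι_mul, tensorAction_one_apply, add_sub_cancel_left]
          by_cases e : f v = 0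
          · simp [e]
          · rw [𝒴.eq_of_apply_ne_zero hf' hv e])
    (by simp) (by simp)

/-- Together with `minusModule_ofGroup`, acting on `1` sends `b g` to `b`. This recovers an element
of `T(Y)` from its image in `A_β(0,0)`. -/
theorem minusModule_ofMinus (b : TensorAlgebra ℂ Y) :
    𝒴.minusModule (ofMinus _ _ _ _ _ b) 1 = b := by
  have : (TensorAlgebra.lift ℂ (LinearMap.mul ℂ _ ∘ₗ ι ℂ (M := Y))) =
      Algebra.lmul ℂ (TensorAlgebra ℂ Y) := by
    ext v : 2
    simp
  rw [minusModule, lift_ofMinus, this]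
  simp

theorem minusModule_ofGroup (g : G) : 𝒴.minusModule (ofGroup _ _ _ _ _ g) 1 = 1 := by
  rw [minusModule, lift_ofGroup]
  simp

theorem isMinusIdeal_rightCore : IsMinusIdeal 𝒴.ρ 𝒴.dual.ρ 𝒴.beta 𝒴.rightCore := by
  refine ⟨𝒴.isGradedInvariantIdeal_rightCore, fun f b hb => ?_⟩
  induction f using 𝒴.dual.grading_induction with
  | zero => simp
  | add f e hf he =>
    rw [map_add, map_add, add_mul, mul_add, add_sub_add_comm]
    exact add_mem hf he
  | mem x f hf =>
    have hf' : f ∈ 𝒴.dualGrading x⁻¹⁻¹ := by rw [inv_inv]; exact hf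
    rw [𝒴.commutator_ofMinus hf']
    exact Submodule.subset_span ⟨_, rightDer_mem hf' hb, _, rfl⟩

/-- Since the commutator with `f` is `∂_f(b) g`, the condition on an ideal amounts to stability
under the right derivations. -/
theorem maxMinusIdeal_eq : maxMinusIdeal 𝒴.ρ 𝒴.dual.ρ 𝒴.beta = 𝒴.rightCore := by
  refine le_antisymm (sSup_le fun I hI b hb => ?_) (le_sSup 𝒴.isMinusIdeal_rightCore)
  refine mem_rightCore_of_span (s := I) (fun c hc => hI.1.tensorAug_eq_zero hc)
    (fun g f hf c hc => ?_) hb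
  rw [Submodule.span_eq]
  have h := hI.2 f c hc
  rw [𝒴.commutator_ofMinus hf] at h
  -- Acting on `1` carries the span of the `c g` with `c ∈ I` into `I`, so `∂_f(c) g` in that span
  -- gives `∂_f(c) ∈ I`.
  have key : Submodule.span ℂ {x | ∃ c ∈ I, ∃ g : G,
        x = ofMinus 𝒴.ρ 𝒴.dual.ρ 𝒴.beta ⊥ ⊥ c * ofGroup 𝒴.ρ 𝒴.dual.ρ 𝒴.beta ⊥ ⊥ g} ≤
      I.comap (LinearMap.applyₗ 1 ∘ₗ 𝒴.minusModule.toLinearMap) := by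
    rw [Submodule.span_le]
    rintro _ ⟨c, hc, g, rfl⟩
    change 𝒴.minusModule (_ * _) 1 ∈ I
    rwa [map_mul, Module.End.mul_apply, minusModule_ofGroup, minusModule_ofMinus]
  have h := key h
  change 𝒴.minusModule (_ * _) 1 ∈ I at h
  rwa [map_mul, Module.End.mul_apply, minusModule_ofGroup, minusModule_ofMinus] at h

end Minus

/-! ### The ideal `I_β⁺` and the left derivations of `T(Y*)`. -/

section Plus

/-- The right action of `A_β(0,0)` on `T(Y*)`, where `Y` acts by braided derivations. -/
def plusModule : DoubleAlg 𝒴.ρ 𝒴.dual.ρ 𝒴.beta ⊥ ⊥ →ₐ[ℂ]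
    (Module.End ℂ (TensorAlgebra ℂ (Module.Dual ℂ Y)))ᵐᵒᵖ :=
  DoubleAlg.lift
    ((MulOpposite.opLinearEquiv ℂ).toLinearMap ∘ₗ 𝒴.gradedLift fun y =>
      skewDerLin (tensorAction 𝒴.dual.ρ y⁻¹) (tensorAction 𝒴.dual.ρ 1) ∘ₗ Module.Dual.eval ℂ Y)
    ((MulOpposite.opLinearEquiv ℂ).toLinearMap ∘ₗ (LinearMap.mul ℂ _).flip ∘ₗ ι ℂ)
    -- A right action of `G` is obtained from the left action through inverses.
    { toFun := fun g => MulOpposite.op (tensorAction 𝒴.dual.ρ g⁻¹).toLinearMap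
      map_one' := by rw [inv_one, map_one]; rfl
      map_mul' := fun g h => by rw [mul_inv_rev, map_mul]; rfl }
    (by
      intro g v
      induction v using 𝒴.grading_induction with
      | zero => simp
      | add f e hf he => simp only [map_add, add_mul, mul_add, hf, he]
      | mem x v hv =>
        rw [LinearMap.comp_apply, LinearMap.comp_apply, 𝒴.gradedLift_of_mem _ hv,
          𝒴.gradedLift_of_mem _ (𝒴.smul_mem g hv)]
        apply MulOpposite.unop_injective
        refine LinearMap.ext fun c => ?_
        refine (tensorAction_skewDer _ _ _ _ _ _).trans ?_
        have e : 𝒴.dual.ρ.dual g⁻¹ (Module.Dual.eval ℂ Y (𝒴.ρ g v)) = Module.Dual.eval ℂ Y v := by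
          ext f
          rw [dual_inv_apply]
          exact 𝒴.dual_apply_smul g f v
        rw [LinearMap.comp_apply, e, mul_one, mul_inv_cancel,
          show g⁻¹ * (g * x * g⁻¹)⁻¹ * g⁻¹⁻¹ = x⁻¹ by group]
        rfl)
    (by
      intro g f
      apply MulOpposite.unop_injective
      refine LinearMap.ext fun c => ?_
      change tensorAction 𝒴.dual.ρ g⁻¹ (c * ι ℂ (𝒴.dual.ρ g f)) =
        tensorAction 𝒴.dual.ρ g⁻¹ c * ι ℂ f
      rw [map_mul, tensorAction_ι, ← Module.End.mul_apply, ← map_mul, inv_mul_cancel, map_one,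
        Module.End.one_apply])
    (by
      intro f v
      induction v using 𝒴.grading_induction with
      | zero => simp
      | add v w hv hw => simp only [map_add, add_mul, mul_add, ← hv, ← hw]; abel
      | mem y v hv =>
        rw [𝒴.lift_beta _ hv]
        simp only [LinearMap.comp_apply, 𝒴.gradedLift_of_mem _ hv]
        apply MulOpposite.unop_injective
        refine LinearMap.ext fun c => ?_
        change 𝒴.dual.leftDer y⁻¹ (Module.Dual.eval ℂ Y v) (c * ι ℂ f) -
          𝒴.dual.leftDer y⁻¹ (Module.Dual.eval ℂ Y v) c * ι ℂ f =
            f v • tensorAction 𝒴.dual.ρ y⁻¹ c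
        rw [leftDer_mul_ι, add_sub_cancel_left]
        rfl)
    (by simp) (by simp)

theorem plusModule_ofPlus (b : TensorAlgebra ℂ (Module.Dual ℂ Y)) :
    (𝒴.plusModule (ofPlus _ _ _ _ _ b)).unop 1 = b := by
  rw [plusModule, lift_ofPlus]
  induction b using TensorAlgebra.right_induction with
  | one => simp
  | smul r a h => rw [map_smul, MulOpposite.unop_smul, LinearMap.smul_apply, h]
  | add a b ha hb => rw [map_add, MulOpposite.unop_add, LinearMap.add_apply, ha, hb]
  | mul_ι a f h =>
    rw [map_mul, lift_ι_apply, MulOpposite.unop_mul, Module.End.mul_apply, h]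
    simp

theorem plusModule_ofGroup (g : G) : (𝒴.plusModule (ofGroup _ _ _ _ _ g)).unop 1 = 1 := by
  rw [plusModule, lift_ofGroup]
  simp

theorem isPlusIdeal_leftCore : IsPlusIdeal 𝒴.ρ 𝒴.dual.ρ 𝒴.beta 𝒴.dual.leftCore := by
  refine ⟨𝒴.dual.isGradedInvariantIdeal_leftCore, fun b hb v => ?_⟩
  induction v using 𝒴.grading_induction with
  | zero => simp
  | add f e hf he =>
    rw [map_add, map_add, add_mul, mul_add, add_sub_add_comm]
    exact add_mem hf he
  | mem y v hv =>
    rw [𝒴.commutator_ofPlus hv]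
    refine Submodule.subset_span ⟨_, leftDer_mem ?_ hb, _, rfl⟩
    rw [inv_inv]
    exact 𝒴.eval_mem_dualGrading hv

/-- The commutators with `v ∈ Y_y` are `y ∂(b)`, and by `exists_eval_eq` evaluations at homogeneous
`v` give all the left derivations of `T(Y*)`. -/
theorem maxPlusIdeal_eq : maxPlusIdeal 𝒴.ρ 𝒴.dual.ρ 𝒴.beta = 𝒴.dual.leftCore := by
  refine le_antisymm (sSup_le fun I hI b hb => ?_) (le_sSup 𝒴.isPlusIdeal_leftCore)
  refine mem_leftCore_of_span (s := I) (fun c hc => hI.1.tensorAug_eq_zero hc)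
    (fun g e he c hc => ?_) hb
  rw [Submodule.span_eq]
  obtain ⟨v, hv, rfl⟩ := 𝒴.exists_eval_eq he
  have h := hI.2 c hc v
  rw [𝒴.commutator_ofPlus hv, inv_inv] at h
  have key : Submodule.span ℂ {x | ∃ c ∈ I, ∃ g : G,
        x = ofGroup 𝒴.ρ 𝒴.dual.ρ 𝒴.beta ⊥ ⊥ g * ofPlus 𝒴.ρ 𝒴.dual.ρ 𝒴.beta ⊥ ⊥ c} ≤
      I.comap (LinearMap.applyₗ 1 ∘ₗ (MulOpposite.opLinearEquiv ℂ).symm.toLinearMap ∘ₗ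
        𝒴.plusModule.toLinearMap) := by
    rw [Submodule.span_le]
    rintro _ ⟨c, hc, g, rfl⟩
    change (𝒴.plusModule (_ * _)).unop 1 ∈ I
    rwa [map_mul, MulOpposite.unop_mul, Module.End.mul_apply, plusModule_ofGroup, plusModule_ofPlus]
  have h := key h
  change (𝒴.plusModule (_ * _)).unop 1 ∈ I at h
  rwa [map_mul, MulOpposite.unop_mul, Module.End.mul_apply, plusModule_ofGroup,
    plusModule_ofPlus] at h

end Plus

end YetterDrinfeld
end

noncomputable section
namespace YetterDrinfeld

open TensorAlgebra DoubleAlg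

variable {G : Type*} [Group G] {Y : Type*} [AddCommGroup Y] [Module ℂ Y] [FiniteDimensional ℂ Y]
variable (𝒴 : YetterDrinfeld G Y)

/-! ### The universal property of the braided Weyl algebra -/

namespace Weyl

/-- The canonical map `T(Y) → A_Y`. -/
def ofTensor : TensorAlgebra ℂ Y →ₐ[ℂ] 𝒴.Weyl :=
  (RingQuot.mkAlgHom ℂ 𝒴.WeylRel).comp (tensorAlgebraMap (LinearMap.inl ℂ Y (Module.Dual ℂ Y)))

/-- The canonical map `T(Y*) → A_Y`. -/
def ofTensorDual : TensorAlgebra ℂ (Module.Dual ℂ Y) →ₐ[ℂ] 𝒴.Weyl :=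
  (RingQuot.mkAlgHom ℂ 𝒴.WeylRel).comp (tensorAlgebraMap (LinearMap.inr ℂ Y (Module.Dual ℂ Y)))

theorem ofTensor_ι (v : Y) : ofTensor 𝒴 (ι ℂ v) = ofY 𝒴 v := by
  simp [ofTensor, ofY]

theorem ofTensorDual_ι (f : Module.Dual ℂ Y) : ofTensorDual 𝒴 (ι ℂ f) = ofDual 𝒴 f := by
  simp [ofTensorDual, ofDual]

theorem mk_ι (p : Y × Module.Dual ℂ Y) : RingQuot.mkAlgHom ℂ 𝒴.WeylRel (ι ℂ p) =
    ofTensor 𝒴 (ι ℂ p.1) + ofTensorDual 𝒴 (ι ℂ p.2) := by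
  rw [ofTensor_ι, ofTensorDual_ι, ofY, ofDual, ← map_add, ← map_add]
  simp

theorem ofTensor_eq_zero {b : TensorAlgebra ℂ Y} (hb : b ∈ woronowiczKernel 𝒴.braiding) :
    ofTensor 𝒴 b = 0 := by
  have := RingQuot.mkAlgHom_rel ℂ (WeylRel.nichols (𝒴 := 𝒴) b hb)
  rwa [map_zero] at this

theorem ofTensorDual_eq_zero {b : TensorAlgebra ℂ (Module.Dual ℂ Y)}
    (hb : b ∈ woronowiczKernel 𝒴.dual.braiding) : ofTensorDual 𝒴 b = 0 := by
  have := RingQuot.mkAlgHom_rel ℂ (WeylRel.nicholsDual (𝒴 := 𝒴) b hb)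
  rwa [map_zero] at this

theorem ofTensorDual_mul_ofTensor_ι {x : G} {f : Module.Dual ℂ Y} (hf : f ∈ 𝒴.dual.grading x)
    (v : Y) : ofTensorDual 𝒴 (ι ℂ f) * ofTensor 𝒴 (ι ℂ v) =
      ofTensor 𝒴 (ι ℂ (𝒴.ρ x v)) * ofTensorDual 𝒴 (ι ℂ f) + f v • 1 := by
  have := RingQuot.mkAlgHom_rel ℂ (WeylRel.comm (𝒴 := 𝒴) x f hf v)
  rw [map_sub, map_mul, map_mul, AlgHom.commutes, Algebra.algebraMap_eq_smul_one] at this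
  rw [ofTensor_ι, ofTensor_ι, ofTensorDual_ι, ofY, ofY, ofDual, ← this]
  exact (add_sub_cancel _ _).symm

theorem action_ofTensor_ι (g : G) (v : Y) :
    action 𝒴 g (ofTensor 𝒴 (ι ℂ v)) = ofTensor 𝒴 (ι ℂ (𝒴.ρ g v)) := by
  rw [ofTensor_ι, ofTensor_ι]
  refine (actionHom_mk 𝒴 g _).trans ?_
  rw [tensorAction_ι]
  simp [ofY]

theorem action_ofTensorDual_ι (g : G) (f : Module.Dual ℂ Y) :
    action 𝒴 g (ofTensorDual 𝒴 (ι ℂ f)) = ofTensorDual 𝒴 (ι ℂ (𝒴.dual.ρ g f)) := by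
  rw [ofTensorDual_ι, ofTensorDual_ι]
  refine (actionHom_mk 𝒴 g _).trans ?_
  rw [tensorAction_ι]
  simp [ofDual]

variable {𝒴}

/-- Induction on the elements of `A_Y` by left multiplication with generators. -/
theorem left_induction {C : 𝒴.Weyl → Prop} (one : C 1) (smul : ∀ (r : ℂ) a, C a → C (r • a))
    (add : ∀ a b, C a → C b → C (a + b)) (ofY_mul : ∀ v a, C a → C (ofTensor 𝒴 (ι ℂ v) * a))
    (ofDual_mul : ∀ x, ∀ f ∈ 𝒴.dual.grading x, ∀ a, C a → C (ofTensorDual 𝒴 (ι ℂ f) * a))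
    (a : 𝒴.Weyl) : C a := by
  obtain ⟨t, rfl⟩ := RingQuot.mkAlgHom_surjective ℂ 𝒴.WeylRel a
  induction t using TensorAlgebra.left_induction with
  | one => rw [map_one]; exact one
  | smul r a h => rw [map_smul]; exact smul r _ h
  | add a b ha hb => rw [map_add]; exact add _ _ ha hb
  | ι_mul p a h =>
    rw [map_mul, mk_ι, add_mul]
    refine add _ _ (ofY_mul _ _ h) ?_
    refine 𝒴.dual.grading_induction
      (C := fun f => C (ofTensorDual 𝒴 (ι ℂ f) * RingQuot.mkAlgHom ℂ 𝒴.WeylRel a))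
      ?_ (fun f e hf he => ?_) (fun x f hf => ofDual_mul x f hf _ h) p.2
    · simpa using smul 0 1 one
    · rw [map_add, map_add, add_mul]
      exact add _ _ hf he

variable {B : Type*} [Ring B] [Algebra ℂ B]

theorem hom_ext {F F' : 𝒴.Weyl →ₐ[ℂ] B}
    (h₁ : ∀ v, F (ofTensor 𝒴 (ι ℂ v)) = F' (ofTensor 𝒴 (ι ℂ v)))
    (h₂ : ∀ x, ∀ f ∈ 𝒴.dual.grading x,
      F (ofTensorDual 𝒴 (ι ℂ f)) = F' (ofTensorDual 𝒴 (ι ℂ f))) : F = F' := by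
  refine AlgHom.ext fun a => ?_
  induction a using left_induction with
  | one => rw [map_one, map_one]
  | smul r a h => rw [map_smul, map_smul, h]
  | add a b ha hb => rw [map_add, map_add, ha, hb]
  | ofY_mul v a h => rw [map_mul, map_mul, h, h₁]
  | ofDual_mul x f hf a h => rw [map_mul, map_mul, h, h₂ x f hf]

section Lift

variable (i : Y →ₗ[ℂ] B) (j : Module.Dual ℂ Y →ₗ[ℂ] B)
  (hc : ∀ x, ∀ f ∈ 𝒴.dual.grading x, ∀ v, j f * i v = i (𝒴.ρ x v) * j f + f v • 1)
  (hM : ∀ r ∈ woronowiczKernel 𝒴.braiding, TensorAlgebra.lift ℂ i r = 0)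
  (hP : ∀ r ∈ woronowiczKernel 𝒴.dual.braiding, TensorAlgebra.lift ℂ j r = 0)

/-- The universal property of the braided Weyl algebra. -/
def lift : 𝒴.Weyl →ₐ[ℂ] B :=
  RingQuot.liftAlgHom ℂ ⟨TensorAlgebra.lift ℂ (i.coprod j), by
    have h₁ : (TensorAlgebra.lift ℂ (i.coprod j)).comp (tensorAlgebraMap (LinearMap.inl ℂ _ _)) =
        TensorAlgebra.lift ℂ i := by ext; simp
    have h₂ : (TensorAlgebra.lift ℂ (i.coprod j)).comp (tensorAlgebraMap (LinearMap.inr ℂ _ _)) =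
        TensorAlgebra.lift ℂ j := by ext; simp
    intro a b h
    cases h with
    | nichols b hb => rw [← AlgHom.comp_apply, h₁, hM b hb, map_zero]
    | nicholsDual b hb => rw [← AlgHom.comp_apply, h₂, hP b hb, map_zero]
    | comm x f hf v =>
      simp only [map_sub, map_mul, lift_ι_apply, LinearMap.coprod_apply, map_zero, zero_add,
        add_zero, hc x f hf v, Algebra.algebraMap_eq_smul_one, map_smul, map_one,
        add_sub_cancel_left]⟩

@[simp] theorem lift_ofTensor (b : TensorAlgebra ℂ Y) :
    lift i j hc hM hP (ofTensor 𝒴 b) = TensorAlgebra.lift ℂ i b := by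
  rw [lift, ofTensor, AlgHom.comp_apply, RingQuot.liftAlgHom_mkAlgHom_apply, ← AlgHom.comp_apply]
  congr 1
  ext
  simp

@[simp] theorem lift_ofTensorDual (b : TensorAlgebra ℂ (Module.Dual ℂ Y)) :
    lift i j hc hM hP (ofTensorDual 𝒴 b) = TensorAlgebra.lift ℂ j b := by
  rw [lift, ofTensorDual, AlgHom.comp_apply, RingQuot.liftAlgHom_mkAlgHom_apply,
    ← AlgHom.comp_apply]
  congr 1
  ext
  simp

end Lift

end Weyl

/-! ### The isomorphism with the braided Heisenberg double -/

section Heisenberg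

local notation "hM" => ofMinus 𝒴.ρ 𝒴.dual.ρ 𝒴.beta (maxMinusIdeal 𝒴.ρ 𝒴.dual.ρ 𝒴.beta) (maxPlusIdeal 𝒴.ρ 𝒴.dual.ρ 𝒴.beta)
local notation "hP" => ofPlus 𝒴.ρ 𝒴.dual.ρ 𝒴.beta (maxMinusIdeal 𝒴.ρ 𝒴.dual.ρ 𝒴.beta) (maxPlusIdeal 𝒴.ρ 𝒴.dual.ρ 𝒴.beta)
local notation "hG" => ofGroup 𝒴.ρ 𝒴.dual.ρ 𝒴.beta (maxMinusIdeal 𝒴.ρ 𝒴.dual.ρ 𝒴.beta) (maxPlusIdeal 𝒴.ρ 𝒴.dual.ρ 𝒴.beta)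

/-- The map `Y* → H_Y`, `f ↦ x f` for `f ∈ (Y*)_x`. -/
def dualToHeisenberg : Module.Dual ℂ Y →ₗ[ℂ] 𝒴.Heisenberg :=
  𝒴.dual.gradedLift fun x => LinearMap.mulLeft ℂ (hG x) ∘ₗ (hP).toLinearMap ∘ₗ ι ℂ

theorem dualToHeisenberg_of_mem {x : G} {f : Module.Dual ℂ Y} (hf : f ∈ 𝒴.dual.grading x) :
    𝒴.dualToHeisenberg f = hG x * hP (ι ℂ f) := by
  rw [dualToHeisenberg, gradedLift_of_mem _ _ hf]
  rfl

/-- Moving all group elements of `x₁ f₁ x₂ f₂ ⋯` to the left replaces the letters before each `x_i`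
by their images under `x_i⁻¹`; this produces the total degree times `untwist` of the word. -/
theorem lift_dualToHeisenberg (c : TensorAlgebra ℂ (Module.Dual ℂ Y)) :
    TensorAlgebra.lift ℂ 𝒴.dualToHeisenberg c = 𝒴.dual.gradedSum (fun X =>
      LinearMap.mulLeft ℂ (hG X) ∘ₗ (hP).toLinearMap ∘ₗ 𝒴.dual.untwist) c := by
  induction c using 𝒴.dual.right_induction with
  | one => simp
  | smul r a h => rw [map_smul, map_smul, h]
  | add a b ha hb => rw [map_add, map_add, ha, hb]
  | mul_ι c x f hf h =>
    rw [map_mul, h, lift_ι_apply, 𝒴.dual.gradedSum_mul_ι _ hf, 𝒴.dualToHeisenberg_of_mem hf,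
      ← LinearMap.mulRight_apply (R := ℂ), gradedSum_comp]
    congr 2
    funext X
    refine LinearMap.ext fun b => ?_
    simp only [LinearMap.comp_apply, LinearMap.mulRight_apply, LinearMap.mulLeft_apply,
      AlgHom.toLinearMap_apply]
    have e : hG x * hP (tensorAction 𝒴.dual.ρ x⁻¹ (𝒴.dual.untwist b)) =
        hP (𝒴.dual.untwist b) * hG x := by
      rw [ofGroup_mul_ofPlus, tensorAction_mul_apply, mul_inv_cancel, tensorAction_one_apply]
    rw [twist_mul_ι _ _ hf, map_mul, map_mul (hP), mul_assoc, mul_assoc,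
      ← mul_assoc (hG x) (hP (tensorAction _ _ _)), e, mul_assoc]

theorem dualToHeisenberg_covariant (g : G) (f : Module.Dual ℂ Y) :
    𝒴.dualToHeisenberg (𝒴.dual.ρ g f) * hG g = hG g * 𝒴.dualToHeisenberg f := by
  induction f using 𝒴.dual.grading_induction with
  | zero => simp
  | add f e hf he => simp only [map_add, add_mul, mul_add, hf, he]
  | mem x f hf =>
    rw [𝒴.dualToHeisenberg_of_mem hf, 𝒴.dualToHeisenberg_of_mem (𝒴.dual.smul_mem g hf), mul_assoc,
      ← tensorAction_ι, ← ofGroup_mul_ofPlus, ← mul_assoc, ← mul_assoc, ← map_mul, ← map_mul,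
      inv_mul_cancel_right]

theorem lift_ofMinus_comp (b : TensorAlgebra ℂ Y) :
    TensorAlgebra.lift ℂ ((hM).toLinearMap ∘ₗ ι ℂ) b = hM b := by
  congr 1
  ext
  simp

/-- The map `A_Y → H_Y` with `v ↦ v` and `f ↦ x f` for `f ∈ (Y*)_x`. -/
def weylToHeisenberg : 𝒴.Weyl →ₐ[ℂ] 𝒴.Heisenberg :=
  Weyl.lift ((hM).toLinearMap ∘ₗ ι ℂ) 𝒴.dualToHeisenberg
    (by
      intro x f hf v
      rw [𝒴.dualToHeisenberg_of_mem hf]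
      induction v using 𝒴.grading_induction with
      | zero => simp
      | add v w hv hw =>
        rw [map_add, mul_add, hv, hw, map_add, map_add, add_mul, map_add, add_smul]
        abel
      | mem y v hv =>
        have hf' : f ∈ 𝒴.dualGrading x⁻¹⁻¹ := by rw [inv_inv]; exact hf
        -- A nonzero pairing forces `y = x⁻¹`, so the group-like commutator becomes a scalar.
        have e : f v • (hG x * hG y) = f v • 1 := by
          by_cases e : f v = 0
          · simp [e]
          · rw [𝒴.eq_of_apply_ne_zero hf' hv e, ← map_mul, mul_inv_cancel, map_one]
        have h := 𝒴.commutator_ι (RM := maxMinusIdeal 𝒴.ρ 𝒴.dual.ρ 𝒴.beta)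
          (RP := maxPlusIdeal 𝒴.ρ 𝒴.dual.ρ 𝒴.beta) hv f
        rw [sub_eq_iff_eq_add] at h
        simp only [LinearMap.comp_apply, AlgHom.toLinearMap_apply]
        rw [mul_assoc, h, mul_add, mul_smul_comm, e, ← mul_assoc (hG x), ofGroup_mul_ofMinus,
          tensorAction_ι, mul_assoc, add_comm])
    (by
      intro r hr
      rw [woronowiczKernel_eq_rightCore, ← maxMinusIdeal_eq] at hr
      rw [lift_ofMinus_comp, ofMinus_eq_zero hr])
    (by
      intro r hr
      rw [woronowiczKernel_eq_rightCore] at hr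
      rw [lift_dualToHeisenberg, ← Submodule.mem_bot ℂ]
      -- Each `G`-component of a relation of `B(Y*)` is again a relation, and `untwist` carries it
      -- into `I_β⁺`.
      refine 𝒴.dual.gradedSum_mem_of_mem_rightCore _ (fun X c hc => ?_) hr
      have h := 𝒴.dual.untwist_mem_leftCore hc
      rw [← maxPlusIdeal_eq] at h
      rw [Submodule.mem_bot]
      simp [ofPlus_eq_zero h])

@[simp] theorem weylToHeisenberg_ofTensor_ι (v : Y) :
    𝒴.weylToHeisenberg (Weyl.ofTensor 𝒴 (ι ℂ v)) = hM (ι ℂ v) := by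
  rw [weylToHeisenberg, Weyl.lift_ofTensor, lift_ι_apply]
  rfl

@[simp] theorem weylToHeisenberg_ofTensorDual_ι (f : Module.Dual ℂ Y) :
    𝒴.weylToHeisenberg (Weyl.ofTensorDual 𝒴 (ι ℂ f)) = 𝒴.dualToHeisenberg f := by
  rw [weylToHeisenberg, Weyl.lift_ofTensorDual, lift_ι_apply]

/-- The map `A_Y ⋊ G → H_Y` with `v ↦ v`, `g ↦ g` and `f ↦ x f` for `f ∈ (Y*)_x`. -/
def smashToHeisenberg : Smash (Weyl.action 𝒴) →ₐ[ℂ] 𝒴.Heisenberg :=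
  Smash.lift 𝒴.weylToHeisenberg (hG) (by
    intro g x
    induction x using Weyl.left_induction with
    | one => simp
    | smul r a h => rw [map_smul, map_smul, smul_mul_assoc, h, map_smul, mul_smul_comm]
    | add a b ha hb => rw [map_add, map_add, add_mul, ha, hb, map_add, mul_add]
    | ofY_mul v a h =>
      rw [map_mul, map_mul, mul_assoc, h, map_mul, Weyl.action_ofTensor_ι,
        weylToHeisenberg_ofTensor_ι, weylToHeisenberg_ofTensor_ι, ← mul_assoc, ← mul_assoc,
        ofGroup_mul_ofMinus, tensorAction_ι]
    | ofDual_mul x f hf a h =>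
      rw [map_mul, map_mul, mul_assoc, h, map_mul, Weyl.action_ofTensorDual_ι,
        weylToHeisenberg_ofTensorDual_ι, weylToHeisenberg_ofTensorDual_ι, ← mul_assoc, ← mul_assoc,
        dualToHeisenberg_covariant])

/-- The map `Y* → A_Y ⋊ G`, `f ↦ x⁻¹ f` for `f ∈ (Y*)_x`. -/
def dualToSmash : Module.Dual ℂ Y →ₗ[ℂ] Smash (Weyl.action 𝒴) :=
  𝒴.dual.gradedLift fun x => LinearMap.mulLeft ℂ (Smash.ofGroup (Weyl.action 𝒴) x⁻¹) ∘ₗ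
    (Smash.ofAlg (Weyl.action 𝒴)).toLinearMap ∘ₗ (Weyl.ofTensorDual 𝒴).toLinearMap ∘ₗ ι ℂ

theorem dualToSmash_of_mem {x : G} {f : Module.Dual ℂ Y} (hf : f ∈ 𝒴.dual.grading x) :
    𝒴.dualToSmash f =
      Smash.ofGroup _ x⁻¹ * Smash.ofAlg _ (Weyl.ofTensorDual 𝒴 (ι ℂ f)) := by
  rw [dualToSmash, gradedLift_of_mem _ _ hf]
  rfl

theorem dualToSmash_covariant (g : G) (f : Module.Dual ℂ Y) :
    𝒴.dualToSmash (𝒴.dual.ρ g f) * Smash.ofGroup _ g = Smash.ofGroup _ g * 𝒴.dualToSmash f := by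
  induction f using 𝒴.dual.grading_induction with
  | zero => simp
  | add f e hf he => simp only [map_add, add_mul, mul_add, hf, he]
  | mem x f hf =>
    rw [𝒴.dualToSmash_of_mem hf, 𝒴.dualToSmash_of_mem (𝒴.dual.smul_mem g hf), mul_assoc,
      ← Weyl.action_ofTensorDual_ι, ← Smash.ofGroup_mul_ofAlg, ← mul_assoc, ← mul_assoc, ← map_mul,
      ← map_mul]
    congr 2
    group

/-- The converse bookkeeping: a word in the `x⁻¹ f` is evaluated on `untwist c`, because the action
of `x⁻¹` on the earlier letters is undone by moving the new `x⁻¹` to the left. -/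
theorem lift_dualToSmash_untwist (c : TensorAlgebra ℂ (Module.Dual ℂ Y)) :
    TensorAlgebra.lift ℂ 𝒴.dualToSmash (𝒴.dual.untwist c) = 𝒴.dual.gradedSum (fun X =>
      LinearMap.mulLeft ℂ (Smash.ofGroup (Weyl.action 𝒴) X⁻¹) ∘ₗ
        (Smash.ofAlg (Weyl.action 𝒴)).toLinearMap ∘ₗ (Weyl.ofTensorDual 𝒴).toLinearMap) c := by
  induction c using 𝒴.dual.right_induction with
  | one => simp
  | smul r a h => simp only [map_smul, h]
  | add a b ha hb => simp only [map_add, ha, hb]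
  | mul_ι c x f hf h =>
    have hcov := tensorAlgebra_lift_covariant (𝒴.dualToSmash_covariant) x⁻¹ (𝒴.dual.untwist c)
    rw [twist_mul_ι _ _ hf, map_mul, lift_ι_apply, 𝒴.dualToSmash_of_mem hf, ← mul_assoc, hcov, h,
      𝒴.dual.gradedSum_mul_ι _ hf]
    refine (𝒴.dual.gradedSum_comp (LinearMap.mulRight ℂ (Smash.ofAlg _ (Weyl.ofTensorDual 𝒴 (ι ℂ f)))
      ∘ₗ LinearMap.mulLeft ℂ (Smash.ofGroup (Weyl.action 𝒴) x⁻¹)) _ c).trans ?_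
    congr 2
    funext X
    refine LinearMap.ext fun b => ?_
    simp only [LinearMap.comp_apply, LinearMap.mulRight_apply, LinearMap.mulLeft_apply,
      AlgHom.toLinearMap_apply, map_mul, mul_inv_rev, mul_assoc]

/-- The map `H_Y → A_Y ⋊ G` with `v ↦ v`, `g ↦ g` and `f ↦ x⁻¹ f` for `f ∈ (Y*)_x`. -/
def heisenbergToSmash : 𝒴.Heisenberg →ₐ[ℂ] Smash (Weyl.action 𝒴) :=
  DoubleAlg.lift ((Smash.ofAlg _).toLinearMap ∘ₗ (Weyl.ofTensor 𝒴).toLinearMap ∘ₗ ι ℂ)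
    𝒴.dualToSmash (Smash.ofGroup _)
    (by
      intro g v
      simp only [LinearMap.comp_apply, AlgHom.toLinearMap_apply]
      rw [Smash.ofGroup_mul_ofAlg, Weyl.action_ofTensor_ι])
    𝒴.dualToSmash_covariant
    (by
      intro f v
      induction v using 𝒴.grading_induction with
      | zero => simp
      | add v w hv hw => simp only [map_add, add_mul, mul_add, ← hv, ← hw]; abel
      | mem y v hv =>
        rw [𝒴.lift_beta _ hv]
        simp only [LinearMap.comp_apply, AlgHom.toLinearMap_apply]
        induction f using 𝒴.dual.grading_induction with
        | zero => simp
        | add f e hf he =>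
          simp only [map_add, add_mul, mul_add, LinearMap.add_apply, add_smul, ← hf, ← he]; abel
        | mem x f hf =>
          have hf' : f ∈ 𝒴.dualGrading x⁻¹⁻¹ := by rw [inv_inv]; exact hf
          have e : f v • Smash.ofGroup (Weyl.action 𝒴) y = f v • Smash.ofGroup _ x⁻¹ := by
            by_cases e : f v = 0
            · simp [e]
            · rw [𝒴.eq_of_apply_ne_zero hf' hv e]
          have h : Smash.ofAlg (Weyl.action 𝒴) (Weyl.ofTensor 𝒴 (ι ℂ v)) * Smash.ofGroup _ x⁻¹ =
              Smash.ofGroup _ x⁻¹ * Smash.ofAlg _ (Weyl.ofTensor 𝒴 (ι ℂ (𝒴.ρ x v))) := by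
            rw [Smash.ofGroup_mul_ofAlg, Weyl.action_ofTensor_ι, ← Module.End.mul_apply, ← map_mul,
              inv_mul_cancel, map_one, Module.End.one_apply]
          rw [𝒴.dualToSmash_of_mem hf, e, mul_assoc, ← map_mul,
            Weyl.ofTensorDual_mul_ofTensor_ι 𝒴 hf, ← mul_assoc, h, mul_assoc, ← map_mul, map_add,
            mul_add, add_sub_cancel_left, map_smul, map_one, mul_smul_comm, mul_one])
    (by
      intro r hr
      rw [maxMinusIdeal_eq, ← woronowiczKernel_eq_rightCore] at hr
      have : TensorAlgebra.lift ℂ ((Smash.ofAlg (Weyl.action 𝒴)).toLinearMap ∘ₗ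
          (Weyl.ofTensor 𝒴).toLinearMap ∘ₗ ι ℂ) =
          (Smash.ofAlg (Weyl.action 𝒴)).comp (Weyl.ofTensor 𝒴) := by ext; simp
      rw [this, AlgHom.comp_apply, Weyl.ofTensor_eq_zero 𝒴 hr, map_zero])
    (by
      intro r hr
      rw [maxPlusIdeal_eq] at hr
      -- A relation in `I_β⁺` is `untwist` of an element of the Nichols ideal of `Y*`, to which
      -- `lift_dualToSmash_untwist` applies.
      rw [← 𝒴.dual.untwist_twist r, lift_dualToSmash_untwist, ← Submodule.mem_bot ℂ]
      refine 𝒴.dual.gradedSum_mem_of_mem_rightCore _ (fun X c hc => ?_)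
        (𝒴.dual.twist_mem_rightCore hr)
      rw [← woronowiczKernel_eq_rightCore] at hc
      rw [Submodule.mem_bot]
      simp [Weyl.ofTensorDual_eq_zero 𝒴 hc])

theorem smashToHeisenberg_dualToSmash (f : Module.Dual ℂ Y) :
    𝒴.smashToHeisenberg (𝒴.dualToSmash f) = hP (ι ℂ f) := by
  induction f using 𝒴.dual.grading_induction with
  | zero => simp
  | add f e hf he => simp only [map_add, hf, he]
  | mem x f hf =>
    rw [𝒴.dualToSmash_of_mem hf, map_mul, smashToHeisenberg, Smash.lift_ofGroup, Smash.lift_ofAlg,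
      weylToHeisenberg_ofTensorDual_ι, 𝒴.dualToHeisenberg_of_mem hf, ← mul_assoc, ← map_mul,
      inv_mul_cancel, map_one, one_mul]

/-- The isomorphism `A_Y ⋊ G ≃ H_Y`. -/
def smashEquivHeisenberg : Smash (Weyl.action 𝒴) ≃ₐ[ℂ] 𝒴.Heisenberg :=
  AlgEquiv.ofAlgHom 𝒴.smashToHeisenberg 𝒴.heisenbergToSmash
    (DoubleAlg.hom_ext
      (fun v => by
        rw [AlgHom.comp_apply, heisenbergToSmash, lift_ofMinus, lift_ι_apply]
        simp [smashToHeisenberg])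
      (fun f => by
        rw [AlgHom.comp_apply, heisenbergToSmash, lift_ofPlus, lift_ι_apply,
          smashToHeisenberg_dualToSmash, AlgHom.id_apply])
      (fun g => by
        rw [AlgHom.comp_apply, heisenbergToSmash, lift_ofGroup, smashToHeisenberg,
          Smash.lift_ofGroup, AlgHom.id_apply]))
    (Smash.hom_ext
      (fun x => by
        refine DFunLike.congr_fun (F := 𝒴.Weyl →ₐ[ℂ] Smash (Weyl.action 𝒴))
          (f := (𝒴.heisenbergToSmash.comp 𝒴.smashToHeisenberg).comp (Smash.ofAlg _))
          (g := (AlgHom.id ℂ _).comp (Smash.ofAlg _)) (Weyl.hom_ext (fun v => ?_)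
          (fun x f hf => ?_)) x
        · simp only [AlgHom.comp_apply, AlgHom.id_apply]
          rw [smashToHeisenberg, Smash.lift_ofAlg, weylToHeisenberg_ofTensor_ι, heisenbergToSmash,
            lift_ofMinus, lift_ι_apply]
          rfl
        · simp only [AlgHom.comp_apply, AlgHom.id_apply]
          rw [smashToHeisenberg, Smash.lift_ofAlg, weylToHeisenberg_ofTensorDual_ι,
            𝒴.dualToHeisenberg_of_mem hf, map_mul, heisenbergToSmash, lift_ofGroup, lift_ofPlus,
            lift_ι_apply, 𝒴.dualToSmash_of_mem hf, ← mul_assoc, ← map_mul, mul_inv_cancel, map_one,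
            one_mul])
      (fun g => by
        rw [AlgHom.comp_apply, smashToHeisenberg, Smash.lift_ofGroup, heisenbergToSmash,
          lift_ofGroup, AlgHom.id_apply]))

end Heisenberg

end YetterDrinfeld
end

noncomputable section
/-! ### The triangular decomposition of the braided Weyl algebra -/

/-- The family of endomorphisms of `M ⧸ W` induced by a family of endomorphisms of `M` that
preserve `W`. -/
def quotientEnd {E M : Type*} [AddCommGroup E] [Module ℂ E] [AddCommGroup M] [Module ℂ M]
    (W : Submodule ℂ M) (D : E →ₗ[ℂ] Module.End ℂ M) (h : ∀ e, ∀ a ∈ W, D e a ∈ W) :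
    E →ₗ[ℂ] Module.End ℂ (M ⧸ W) :=
  W.mapQLinear W ∘ₗ D.codRestrict (Submodule.compatibleMaps W W) h

@[simp] theorem quotientEnd_mk {E M : Type*} [AddCommGroup E] [Module ℂ E] [AddCommGroup M]
    [Module ℂ M] (W : Submodule ℂ M) (D : E →ₗ[ℂ] Module.End ℂ M) (h : ∀ e, ∀ a ∈ W, D e a ∈ W)
    (e : E) (a : M) :
    quotientEnd W D h e (Submodule.Quotient.mk a) = Submodule.Quotient.mk (D e a) := rfl

/-- The projection `T(V) → B(V, Ψ)`. -/
def NicholsAlgebra.mk {V : Type*} [AddCommGroup V] [Module ℂ V] (Ψ : V ⊗[ℂ] V →ₗ[ℂ] V ⊗[ℂ] V) :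
    TensorAlgebra ℂ V →ₐ[ℂ] NicholsAlgebra Ψ := RingQuot.mkAlgHom ℂ _

theorem NicholsAlgebra.mk_surjective {V : Type*} [AddCommGroup V] [Module ℂ V]
    (Ψ : V ⊗[ℂ] V →ₗ[ℂ] V ⊗[ℂ] V) : Function.Surjective (NicholsAlgebra.mk Ψ) :=
  RingQuot.mkAlgHom_surjective ℂ _

theorem NicholsAlgebra.mk_eq_zero {V : Type*} [AddCommGroup V] [Module ℂ V]
    {Ψ : V ⊗[ℂ] V →ₗ[ℂ] V ⊗[ℂ] V} {r : TensorAlgebra ℂ V} (hr : r ∈ woronowiczKernel Ψ) :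
    NicholsAlgebra.mk Ψ r = 0 := by
  rw [← map_zero (NicholsAlgebra.mk Ψ)]
  exact RingQuot.mkAlgHom_rel ℂ ⟨hr, rfl⟩

namespace YetterDrinfeld

open TensorAlgebra

variable {G : Type*} [Group G] {Y : Type*} [AddCommGroup Y] [Module ℂ Y] [FiniteDimensional ℂ Y]
variable (𝒴 : YetterDrinfeld G Y)

namespace Weyl

theorem mulMap_tmul (b : TensorAlgebra ℂ Y) (c : TensorAlgebra ℂ (Module.Dual ℂ Y)) :
    mulMap 𝒴 (NicholsAlgebra.mk _ b ⊗ₜ NicholsAlgebra.mk _ c) =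
      ofTensor 𝒴 b * ofTensorDual 𝒴 c := by
  rw [mulMap, LinearMap.comp_apply, TensorProduct.map_tmul, LinearMap.mul'_apply,
    AlgHom.toLinearMap_apply, AlgHom.toLinearMap_apply, ofNichols, ofNicholsDual, NicholsAlgebra.mk, NicholsAlgebra.mk,
    RingQuot.liftAlgHom_mkAlgHom_apply, RingQuot.liftAlgHom_mkAlgHom_apply]
  rfl

/-- Iterating `f v = (x ▷ v) f + ⟨f, v⟩` through a word: each letter passed is acted on by `x`, and
the terms in which `f` is absorbed add up to a skew derivation. -/
theorem ofTensorDual_ι_mul_ofTensor {x : G} {f : Module.Dual ℂ Y} (hf : f ∈ 𝒴.dual.grading x)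
    (b : TensorAlgebra ℂ Y) :
    ofTensorDual 𝒴 (ι ℂ f) * ofTensor 𝒴 b =
      ofTensor 𝒴 (tensorAction 𝒴.ρ x b) * ofTensorDual 𝒴 (ι ℂ f) +
        ofTensor 𝒴 (skewDer (tensorAction 𝒴.ρ x) (tensorAction 𝒴.ρ 1) f b) := by
  induction b using TensorAlgebra.left_induction with
  | one => simp
  | smul r a h => simp only [map_smul, mul_smul_comm, smul_mul_assoc, h, smul_add]
  | add a b ha hb => simp only [map_add, mul_add, add_mul, ha, hb]; abel
  | ι_mul v a h =>
    rw [map_mul, ← mul_assoc, ofTensorDual_mul_ofTensor_ι 𝒴 hf, add_mul, mul_assoc, h,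
      skewDer_ι_mul, tensorAction_one_apply, map_mul, tensorAction_ι, map_mul, map_add, map_mul,
      map_smul, smul_mul_assoc, one_mul, mul_add, mul_assoc, add_assoc]

/-- The range contains `1` and is stable under left multiplication by generators: for `Y` this is
immediate, for `Y*` it is `ofTensorDual_ι_mul_ofTensor`. -/
theorem mulMap_surjective : Function.Surjective (mulMap 𝒴) := by
  have key (b : TensorAlgebra ℂ Y) (c : TensorAlgebra ℂ (Module.Dual ℂ Y)) :
      ofTensor 𝒴 b * ofTensorDual 𝒴 c ∈ LinearMap.range (mulMap 𝒴) :=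
    ⟨_, mulMap_tmul 𝒴 b c⟩
  have stable (z : 𝒴.Weyl) (hz : ∀ (b : TensorAlgebra ℂ Y) (c : TensorAlgebra ℂ (Module.Dual ℂ Y)),
      z * (ofTensor 𝒴 b * ofTensorDual 𝒴 c) ∈ LinearMap.range (mulMap 𝒴)) :
      ∀ a ∈ LinearMap.range (mulMap 𝒴), z * a ∈ LinearMap.range (mulMap 𝒴) := by
    rintro _ ⟨t, rfl⟩
    induction t with
    | zero => simp
    | add s t hs ht => rw [map_add, mul_add]; exact Submodule.add_mem _ hs ht
    | tmul b c =>
      obtain ⟨b, rfl⟩ := NicholsAlgebra.mk_surjective _ b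
      obtain ⟨c, rfl⟩ := NicholsAlgebra.mk_surjective _ c
      rw [mulMap_tmul]
      exact hz b c
  intro a
  change a ∈ LinearMap.range (mulMap 𝒴)
  induction a using left_induction with
  | one => simpa using key 1 1
  | smul r a h => exact Submodule.smul_mem _ r h
  | add a b ha hb => exact Submodule.add_mem _ ha hb
  | ofY_mul v a h =>
    refine stable _ (fun b c => ?_) a h
    rw [← mul_assoc, ← map_mul]
    exact key _ _
  | ofDual_mul x f hf a h =>
    refine stable _ (fun b c => ?_) a h
    rw [← mul_assoc, ofTensorDual_ι_mul_ofTensor 𝒴 hf, add_mul, mul_assoc, ← map_mul]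
    exact Submodule.add_mem _ (key _ _) (key _ _)

variable {𝒴} in
/-- Commuting an element of `Y` past the images of the elements of `T(Y*)`. -/
theorem lift_mul_of_comm {B : Type*} [Ring B] [Algebra ℂ B] {i : Y →ₗ[ℂ] B}
    {j : Module.Dual ℂ Y →ₗ[ℂ] B}
    (hc : ∀ x, ∀ f ∈ 𝒴.dual.grading x, ∀ v, j f * i v = i (𝒴.ρ x v) * j f + f v • 1)
    {y : G} {v : Y} (hv : v ∈ 𝒴.grading y) (c : TensorAlgebra ℂ (Module.Dual ℂ Y)) :
    TensorAlgebra.lift ℂ j c * i v =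
      𝒴.dual.gradedSum (fun X =>
        LinearMap.mulLeft ℂ (i (𝒴.ρ X v)) ∘ₗ (TensorAlgebra.lift ℂ j).toLinearMap) c +
      TensorAlgebra.lift ℂ j (𝒴.dual.twistedDer y⁻¹ (Module.Dual.eval ℂ Y v) c) := by
  induction c using 𝒴.dual.right_induction generalizing y v with
  | one => simp
  | smul r a h => simp only [map_smul, smul_mul_assoc, h hv, smul_add]
  | add a b ha hb => simp only [map_add, add_mul, ha hv, hb hv]; abel
  | mul_ι c x f hf h =>
    have he : Module.Dual.eval ℂ Y v ∈ 𝒴.dual.dualGrading y⁻¹⁻¹ := by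
      rw [inv_inv]
      exact 𝒴.eval_mem_dualGrading hv
    have e₁ : 𝒴.dual.ρ.dual x (Module.Dual.eval ℂ Y v) = Module.Dual.eval ℂ Y (𝒴.ρ x v) := by
      refine LinearMap.ext fun f => ?_
      change f (𝒴.ρ x⁻¹⁻¹ v) = f (𝒴.ρ x v)
      rw [inv_inv]
    have e₂ : x * y⁻¹ * x⁻¹ = (x * y * x⁻¹)⁻¹ := by group
    rw [𝒴.dual.twistedDer_mul_ι he hf, e₁, e₂, map_mul, lift_ι_apply, mul_assoc, hc x f hf, mul_add,
      ← mul_assoc, h (𝒴.smul_mem x hv), 𝒴.dual.gradedSum_mul_ι _ hf, map_add, map_mul, lift_ι_apply,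
      map_smul, add_mul, mul_smul_comm, mul_one, ← LinearMap.mulRight_apply (R := ℂ) (j f),
      gradedSum_comp, add_assoc]
    congr 3
    funext X
    refine LinearMap.ext fun b => ?_
    simp [mul_assoc]

/-- This derivation is the action of `x` composed with `rightDer` of index `x⁻¹`, and both preserve
the core. -/
theorem skewDer_mem_rightCore {x : G} {f : Module.Dual ℂ Y} (hf : f ∈ 𝒴.dual.grading x)
    {a : TensorAlgebra ℂ Y} (ha : a ∈ 𝒴.rightCore) :
    skewDer (tensorAction 𝒴.ρ x) (tensorAction 𝒴.ρ 1) f a ∈ 𝒴.rightCore := by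
  have hf' : f ∈ 𝒴.dualGrading x⁻¹⁻¹ := by rw [inv_inv]; exact hf
  have e (y z : G) : (tensorAction 𝒴.ρ y).comp (tensorAction 𝒴.ρ z) = tensorAction 𝒴.ρ (y * z) :=
    (map_mul _ y z).symm
  have h := map_skewDer (tensorAction 𝒴.ρ 1) (tensorAction 𝒴.ρ x⁻¹) f (tensorAction 𝒴.ρ x) a
  rw [e, e, mul_one, mul_inv_cancel] at h
  rw [← h]
  exact 𝒴.isGradedInvariantIdeal_rightCore.invariant x _ (rightDer_mem hf' ha)

/-! ### The Fock representation of the braided Weyl algebra. -/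

section Fock

variable {C : Type*} [Ring C] [Algebra ℂ C] (p : TensorAlgebra ℂ (Module.Dual ℂ Y) →ₐ[ℂ] C)

variable (C) in
/-- The space on which the braided Weyl algebra is represented by left multiplication. -/
abbrev FockSpace : Type _ := (TensorAlgebra ℂ Y ⧸ 𝒴.rightCore) ⊗[ℂ] C

variable (C) in
/-- The action of `Y` on the space `FockSpace`. -/
def fockY : Y →ₗ[ℂ] Module.End ℂ (FockSpace 𝒴 C) :=
  LinearMap.rTensorHom _ ∘ₗ quotientEnd 𝒴.rightCore (LinearMap.mul ℂ _ ∘ₗ ι ℂ)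
    fun _ a ha => 𝒴.isGradedInvariantIdeal_rightCore.mul_mem_left _ a ha

/-- The braided derivations `∂(ab) = (x ▷ a) ∂(b) + ∂(a) b` of `T(Y)` that extend `f ∈ (Y*)_x`. -/
def dualDer : Module.Dual ℂ Y →ₗ[ℂ] Module.End ℂ (TensorAlgebra ℂ Y) :=
  𝒴.dual.gradedLift fun x => skewDerLin (tensorAction 𝒴.ρ x) (tensorAction 𝒴.ρ 1)

theorem dualDer_mem (f : Module.Dual ℂ Y) (a : TensorAlgebra ℂ Y) (ha : a ∈ 𝒴.rightCore) :
    dualDer 𝒴 f a ∈ 𝒴.rightCore := by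
  induction f using 𝒴.dual.grading_induction with
  | zero => simp
  | add f e hf he => rw [map_add]; exact Submodule.add_mem _ hf he
  | mem x f hf =>
    rw [dualDer, gradedLift_of_mem _ _ hf]
    exact skewDer_mem_rightCore 𝒴 hf ha

/-- The action of `Y*` on the space `FockSpace`. -/
def fockDual : Module.Dual ℂ Y →ₗ[ℂ] Module.End ℂ (FockSpace 𝒴 C) :=
  LinearMap.rTensorHom _ ∘ₗ quotientEnd 𝒴.rightCore (dualDer 𝒴) (dualDer_mem 𝒴) +
    𝒴.dual.gradedLift (E := Module.End ℂ (FockSpace 𝒴 C)) fun x =>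
      LinearMap.mulLeft ℂ (LinearMap.rTensor (C) (𝒴.rightCore.mapQ 𝒴.rightCore
        (tensorAction 𝒴.ρ x).toLinearMap (𝒴.isGradedInvariantIdeal_rightCore.invariant x))) ∘ₗ
      LinearMap.lTensorHom (TensorAlgebra ℂ Y ⧸ 𝒴.rightCore) ∘ₗ
      LinearMap.mul ℂ (C) ∘ₗ p.toLinearMap ∘ₗ ι ℂ

theorem fockY_tmul (v : Y) (a : TensorAlgebra ℂ Y) (c : C) :
    fockY 𝒴 C v (Submodule.Quotient.mk a ⊗ₜ c) = Submodule.Quotient.mk (ι ℂ v * a) ⊗ₜ c := rfl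

theorem fockDual_tmul {x : G} {f : Module.Dual ℂ Y} (hf : f ∈ 𝒴.dual.grading x)
    (a : TensorAlgebra ℂ Y) (c : C) :
    fockDual 𝒴 p f (Submodule.Quotient.mk a ⊗ₜ c) =
      Submodule.Quotient.mk (skewDer (tensorAction 𝒴.ρ x) (tensorAction 𝒴.ρ 1) f a) ⊗ₜ c +
        Submodule.Quotient.mk (tensorAction 𝒴.ρ x a) ⊗ₜ (p (ι ℂ f) * c) := by
  rw [fockDual, LinearMap.add_apply, gradedLift_of_mem _ _ hf, LinearMap.add_apply]
  congr 1
  rw [LinearMap.comp_apply, LinearMap.coe_rTensorHom, LinearMap.rTensor_tmul, quotientEnd_mk,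
    dualDer, gradedLift_of_mem _ _ hf]
  rfl

theorem fock_comm {x : G} {f : Module.Dual ℂ Y} (hf : f ∈ 𝒴.dual.grading x) (v : Y) :
    fockDual 𝒴 p f * fockY 𝒴 C v = fockY 𝒴 C (𝒴.ρ x v) * fockDual 𝒴 p f + f v • 1 := by
  refine TensorProduct.ext' fun a c => ?_
  obtain ⟨a, rfl⟩ := Submodule.Quotient.mk_surjective _ a
  rw [Module.End.mul_apply, fockY_tmul, fockDual_tmul 𝒴 p hf, LinearMap.add_apply,
    Module.End.mul_apply, fockDual_tmul 𝒴 p hf, map_add, fockY_tmul, fockY_tmul, skewDer_ι_mul,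
    tensorAction_one_apply, map_mul, tensorAction_ι, Submodule.Quotient.mk_add,
    Submodule.Quotient.mk_smul, TensorProduct.add_tmul, ← TensorProduct.smul_tmul',
    LinearMap.smul_apply, Module.End.one_apply]
  abel

theorem lift_fockY_tmul (b a : TensorAlgebra ℂ Y) (c : C) :
    TensorAlgebra.lift ℂ (fockY 𝒴 C) b (Submodule.Quotient.mk a ⊗ₜ c) =
      Submodule.Quotient.mk (b * a) ⊗ₜ c := by
  induction b using TensorAlgebra.left_induction with
  | one => simp
  | smul r b h =>
    rw [map_smul, LinearMap.smul_apply, h, smul_mul_assoc, Submodule.Quotient.mk_smul,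
      TensorProduct.smul_tmul']
  | add b b' h h' =>
    rw [map_add, LinearMap.add_apply, h, h', add_mul, Submodule.Quotient.mk_add,
      TensorProduct.add_tmul]
  | ι_mul v b h =>
    rw [map_mul, Module.End.mul_apply, h, lift_ι_apply, fockY_tmul, mul_assoc]

theorem lift_fockY_eq_zero {r : TensorAlgebra ℂ Y} (hr : r ∈ woronowiczKernel 𝒴.braiding) :
    TensorAlgebra.lift ℂ (fockY 𝒴 C) r = 0 := by
  rw [woronowiczKernel_eq_rightCore] at hr
  refine TensorProduct.ext' fun a c => ?_
  obtain ⟨a, rfl⟩ := Submodule.Quotient.mk_surjective _ a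
  rw [lift_fockY_tmul, (Submodule.Quotient.mk_eq_zero _).2
    (𝒴.isGradedInvariantIdeal_rightCore.mul_mem_right a r hr), TensorProduct.zero_tmul]
  rfl

theorem lift_fockDual_one_tmul (b : TensorAlgebra ℂ (Module.Dual ℂ Y))
    (c : C) :
    TensorAlgebra.lift ℂ (fockDual 𝒴 p) b (Submodule.Quotient.mk 1 ⊗ₜ c) =
      Submodule.Quotient.mk 1 ⊗ₜ (p b * c) := by
  induction b using 𝒴.dual.left_induction with
  | one => simp
  | smul r b h =>
    rw [map_smul, LinearMap.smul_apply, h, map_smul, smul_mul_assoc, TensorProduct.tmul_smul]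
  | add b b' h h' =>
    rw [map_add, LinearMap.add_apply, h, h', map_add, add_mul, TensorProduct.tmul_add]
  | ι_mul x f hf b h =>
    rw [map_mul, Module.End.mul_apply, h, lift_ι_apply, fockDual_tmul 𝒴 p hf, skewDer_one, map_one,
      Submodule.Quotient.mk_zero, TensorProduct.zero_tmul, zero_add, map_mul, mul_assoc]

/-- Induction on the length of `a`, for all relations `r` at once. On `1 ⊗ c` the algebra `T(Y*)`
acts through `p`, which kills `r`. For `v a`, moving `v` to the left of `r` by `lift_mul_of_comm`
leaves the `G`-components of `r` and a `twistedDer` of `r`; these are relations again and act on the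
shorter `a`. -/
theorem lift_fockDual_eq_zero
    (hp : ∀ r ∈ woronowiczKernel 𝒴.dual.braiding, p r = 0) {r : TensorAlgebra ℂ (Module.Dual ℂ Y)}
    (hr : r ∈ woronowiczKernel 𝒴.dual.braiding) : TensorAlgebra.lift ℂ (fockDual 𝒴 p) r = 0 := by
  refine TensorProduct.ext' fun a c => ?_
  obtain ⟨a, rfl⟩ := Submodule.Quotient.mk_surjective _ a
  rw [LinearMap.zero_apply]
  induction a using 𝒴.left_induction generalizing r with
  | one =>
    rw [lift_fockDual_one_tmul, hp r hr, zero_mul, TensorProduct.tmul_zero]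
  | smul s a h =>
    rw [Submodule.Quotient.mk_smul, ← TensorProduct.smul_tmul', map_smul, h hr, smul_zero]
  | add a b ha hb =>
    rw [Submodule.Quotient.mk_add, TensorProduct.add_tmul, map_add, ha hr, hb hr, add_zero]
  | ι_mul y v hv a h =>
    have he : Module.Dual.eval ℂ Y v ∈ 𝒴.dual.dualGrading y⁻¹⁻¹ := by
      rw [inv_inv]
      exact 𝒴.eval_mem_dualGrading hv
    have h' (r) (hr : r ∈ 𝒴.dual.rightCore) :
        TensorAlgebra.lift ℂ (fockDual 𝒴 p) r (Submodule.Quotient.mk a ⊗ₜ c) = 0 :=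
      h (𝒴.dual.woronowiczKernel_eq_rightCore.ge hr)
    have hr' := 𝒴.dual.woronowiczKernel_eq_rightCore.le hr
    rw [← fockY_tmul, ← Module.End.mul_apply, lift_mul_of_comm (B := Module.End ℂ (FockSpace 𝒴 C))
      (i := fockY 𝒴 C) (j := fockDual 𝒴 p) (fun _ _ hf => fock_comm 𝒴 p hf) hv,
      LinearMap.add_apply, h' _ (𝒴.dual.twistedDer_mem_rightCore he hr'), add_zero]
    refine (𝒴.dual.gradedSum_comp (LinearMap.applyₗ _) _ _).trans ?_
    rw [← Submodule.mem_bot ℂ]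
    refine 𝒴.dual.gradedSum_mem_of_mem_rightCore _ (fun X c hc => ?_) hr'
    rw [Submodule.mem_bot]
    change fockY 𝒴 C (𝒴.ρ X v) (TensorAlgebra.lift ℂ (fockDual 𝒴 p) c _) = 0
    rw [h' _ hc, map_zero]

/-- The representation of the braided Weyl algebra on the space `FockSpace`. -/
def fock (hp : ∀ r ∈ woronowiczKernel 𝒴.dual.braiding, p r = 0) :
    𝒴.Weyl →ₐ[ℂ] Module.End ℂ (FockSpace 𝒴 C) :=
  lift (B := Module.End ℂ (FockSpace 𝒴 C)) (fockY 𝒴 C) (fockDual 𝒴 p)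
    (fun _ _ hf => fock_comm 𝒴 p hf) (fun _ => lift_fockY_eq_zero 𝒴) (fun _ => lift_fockDual_eq_zero 𝒴 p hp)

end Fock

/-- The canonical map from `FockSpace` to `B(Y) ⊗ B(Y*)`. -/
def fockToNichols :
    FockSpace 𝒴 (NicholsAlgebra 𝒴.dual.braiding) →ₗ[ℂ]
      NicholsAlgebra 𝒴.braiding ⊗[ℂ] NicholsAlgebra 𝒴.dual.braiding :=
  LinearMap.rTensor _ (𝒴.rightCore.liftQ (NicholsAlgebra.mk 𝒴.braiding).toLinearMap (by
    intro r hr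
    rw [← woronowiczKernel_eq_rightCore] at hr
    exact NicholsAlgebra.mk_eq_zero hr))

/-- Applying `b c` to the vacuum `1 ⊗ 1` gives `b ⊗ c`: `c` annihilates nothing but multiplies the
second factor, since derivations vanish on `1`, and `b` multiplies the first. So acting on the
vacuum is a left inverse of multiplication. -/
theorem fockToNichols_mulMap
    (t : NicholsAlgebra 𝒴.braiding ⊗[ℂ] NicholsAlgebra 𝒴.dual.braiding) :
    fockToNichols 𝒴 (fock 𝒴 (NicholsAlgebra.mk _) (fun _ => NicholsAlgebra.mk_eq_zero) (mulMap 𝒴 t) (Submodule.Quotient.mk 1 ⊗ₜ 1)) = t := by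
  induction t with
  | zero => simp
  | add s t hs ht => rw [map_add, map_add, LinearMap.add_apply, map_add, hs, ht]
  | tmul b c =>
    obtain ⟨b, rfl⟩ := NicholsAlgebra.mk_surjective _ b
    obtain ⟨c, rfl⟩ := NicholsAlgebra.mk_surjective _ c
    rw [mulMap_tmul, map_mul, Module.End.mul_apply, fock, lift_ofTensor, lift_ofTensorDual,
      lift_fockDual_one_tmul, mul_one, lift_fockY_tmul, mul_one]
    rfl

theorem mulMap_bijective : Function.Bijective (mulMap 𝒴) := by
  refine ⟨fun s t h => ?_, mulMap_surjective 𝒴⟩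
  rw [← fockToNichols_mulMap 𝒴 s, h, fockToNichols_mulMap]

end Weyl

end YetterDrinfeld
end

theorem mainTheorem3 {G : Type*} [Group G] {Y : Type*} [AddCommGroup Y] [Module ℂ Y]
    [FiniteDimensional ℂ Y] (𝒴 : YetterDrinfeld G Y) :
    Function.Bijective (YetterDrinfeld.Weyl.mulMap 𝒴) ∧
      ∃! φ : Smash (YetterDrinfeld.Weyl.action 𝒴) ≃ₐ[ℂ] 𝒴.Heisenberg,
        (∀ v : Y, φ (Smash.ofAlg _ (YetterDrinfeld.Weyl.ofY 𝒴 v)) =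
          YetterDrinfeld.Heisenberg.ofY 𝒴 v) ∧
        (∀ (x : G) (f : Module.Dual ℂ Y), f ∈ 𝒴.dual.grading x →
          φ (Smash.ofAlg _ (YetterDrinfeld.Weyl.ofDual 𝒴 f)) =
            YetterDrinfeld.Heisenberg.ofGroup 𝒴 x * YetterDrinfeld.Heisenberg.ofDual 𝒴 f) ∧
        (∀ g : G, φ (Smash.ofGroup _ g) = YetterDrinfeld.Heisenberg.ofGroup 𝒴 g) := by
  refine ⟨YetterDrinfeld.Weyl.mulMap_bijective 𝒴, 𝒴.smashEquivHeisenberg,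
    ⟨fun v => ?_, fun x f hf => ?_, fun g => ?_⟩, ?_⟩
  · change 𝒴.smashToHeisenberg _ = _
    rw [YetterDrinfeld.smashToHeisenberg, Smash.lift_ofAlg, ← YetterDrinfeld.Weyl.ofTensor_ι,
      YetterDrinfeld.weylToHeisenberg_ofTensor_ι]
    rfl
  · change 𝒴.smashToHeisenberg _ = _
    rw [YetterDrinfeld.smashToHeisenberg, Smash.lift_ofAlg, ← YetterDrinfeld.Weyl.ofTensorDual_ι,
      YetterDrinfeld.weylToHeisenberg_ofTensorDual_ι, 𝒴.dualToHeisenberg_of_mem hf]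
    rfl
  · change 𝒴.smashToHeisenberg _ = _
    rw [YetterDrinfeld.smashToHeisenberg, Smash.lift_ofGroup]
    rfl
  -- Uniqueness: `Y`, the homogeneous functionals and `G` generate `A_Y ⋊ G`.
  · rintro φ ⟨h₁, h₂, h₃⟩
    refine AlgEquiv.coe_toAlgHom_injective (Smash.hom_ext (fun a => ?_) fun g => ?_)
    · refine DFunLike.congr_fun (F := 𝒴.Weyl →ₐ[ℂ] 𝒴.Heisenberg)
        (f := φ.toAlgHom.comp (Smash.ofAlg _))
        (g := 𝒴.smashToHeisenberg.comp (Smash.ofAlg _))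
        (YetterDrinfeld.Weyl.hom_ext (fun v => ?_) (fun x f hf => ?_)) a
      · rw [AlgHom.comp_apply, AlgHom.comp_apply, YetterDrinfeld.smashToHeisenberg,
          Smash.lift_ofAlg, YetterDrinfeld.weylToHeisenberg_ofTensor_ι,
          YetterDrinfeld.Weyl.ofTensor_ι]
        exact h₁ v
      · rw [AlgHom.comp_apply, AlgHom.comp_apply, YetterDrinfeld.smashToHeisenberg,
          Smash.lift_ofAlg, YetterDrinfeld.weylToHeisenberg_ofTensorDual_ι,
          𝒴.dualToHeisenberg_of_mem hf, YetterDrinfeld.Weyl.ofTensorDual_ι]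
        exact h₂ x f hf
    · change _ = 𝒴.smashToHeisenberg _
      rw [YetterDrinfeld.smashToHeisenberg, Smash.lift_ofGroup]
      exact h₃ g
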